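/- Let $N\ge 3$ be an integer and $R>0$. Let $\omega_N$ be the Lebesgue measure of the unit ball of $\mathbb{R}^N$, let $|\mathbb{S}_N|$ be the area of the $N$-dimensional unit sphere (the unit sphere of $\mathbb{R}^{N+1}$), and put $S(N)=\frac{N(N-2)}{4}\,|\mathbb{S}_N|^{2/N}$. All functions are real-valued. For a constant $c\in\mathbb{R}$ consider the inequality $$\int_0^R r\,|v'|^2\,dr\;\ge\; c\left(\int_0^R r^{-1}\left(-\log\frac rR\right)^{-\frac{2(N-1)}{N-2}}|v|^{\frac{2N}{N-2}}\,dr\right)^{\frac{N-2}{N}}\qquad (m)$$ for $v\in C_0^\infty(0,R)$, and, for a constant $S$, the Sobolev inequality $$\int_{\mathbb{R}^N}|\nabla u|^2\,dx\;\ge\; S\left(\int_{\mathbb{R}^N}|u|^{\frac{2N}{N-2}}\,dx\right)^{\frac{N-2}{N}}\qquad (s)$$ for $u\in C_0^\infty(\mathbb{R}^N)$. 1. (Equivalence.) The transformation $v(r)=w(t)$, $t=\left(-\log\frac rR\right)^{-\frac1{N-2}}$, is a bijection between the functions $v\in C_0^\infty(0,R)$ and the functions $w\in C_0^\infty(0,\infty)$.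 For such a pair, $x\mapsto w(|x|)$ belongs to $C_0^\infty(\mathbb{R}^N)$ and, for every $c\in\mathbb{R}$, (m) holds for $v$ with the constant $c$ if and only if (s) holds for $x\mapsto w(|x|)$ with the constant $S=c\,(N-2)^{\frac{2(N-1)}{N}}(N\omega_N)^{\frac2N}$. Moreover, for every $c\in\mathbb{R}$, (m) holds with the constant $c$ for all $v\in C_0^\infty(0,R)$ if and only if (s) holds with the constant $S=c\,(N-2)^{\frac{2(N-1)}{N}}(N\omega_N)^{\frac2N}$ for all $u\in C_0^\infty(\mathbb{R}^N)$. 2. (Best constant.) The largest $c$ for which (m) holds for all $v\in C_0^\infty(0,R)$ is $$C_M=(N-2)^{-\frac{2(N-1)}{N}}(N\omega_N)^{-\frac2N}S(N)=\frac14\left(\frac{N}{N-2}\right)^{\frac{N-2}{N}}\left(\frac{|\mathbb{S}_N|}{\omega_N}\right)^{\frac2N}.$$ 3. (Minimizers.) Let $X$ be the completion of $C_0^\infty(0,R)$ under the norm $\left(\int_0^R r|v'|^2dr\right)^{1/2}$, regarded as a space of functions on $(0,R)$. The nonzero $v\in X$ that minimize over $X\setminus\{0\}$ the quotient of the left-hand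 side of (m) by $\left(\int_0^R r^{-1}(-\log\frac rR)^{-\frac{2(N-1)}{N-2}}|v|^{\frac{2N}{N-2}}dr\right)^{\frac{N-2}{N}}$ are exactly the functions $\pm\phi_{\mu,\nu}$, $\mu\ne0$, $\nu\ne0$, where, with $\psi_{\mu,\nu}(t)=(\mu^2+\nu^2t^2)^{-\frac{N-2}{2}}$ and $t$ as in 1, $$\phi_{\mu,\nu}(r)=\psi_{\mu,\nu}(t)=\left(\mu^2+\nu^2\left(-\log\frac rR\right)^{-\frac{2}{N-2}}\right)^{-\frac{N-2}{2}},$$ and the minimum is $C_M$. -/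

import Mathlib

open MeasureTheory Set Filter Topology
open scoped ContDiff ENNReal

noncomputable section

/-- `ω_N`, the Lebesgue measure of the unit ball of `ℝ^N`. -/
def unitBallVolume (N : ℕ) : ℝ :=
  (volume : Measure (EuclideanSpace ℝ (Fin N))).real (Metric.ball 0 1)

/-- `|𝕊_N|`, the area of the `N`-dimensional unit sphere (the unit sphere of `ℝ^(N+1)`),
with respect to its standard surface measure. -/
def unitSphereArea (N : ℕ) : ℝ :=
  (volume : Measure (EuclideanSpace ℝ (Fin (N + 1)))).toSphere.real univ

/-- The Sobolev constant `S(N) = N (N - 2) / 4 * |𝕊_N|^(2/N)`. -/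
def sobolevConst (N : ℕ) : ℝ :=
  (N : ℝ) * ((N : ℝ) - 2) / 4 * unitSphereArea N ^ (2 / (N : ℝ))

/-- `C_M = (N - 2)^(-2(N-1)/N) * (N ω_N)^(-2/N) * S(N)`. -/
def weightedConst (N : ℕ) : ℝ :=
  ((N : ℝ) - 2) ^ (-(2 * ((N : ℝ) - 1) / (N : ℝ))) *
    ((N : ℝ) * unitBallVolume N) ^ (-(2 / (N : ℝ))) * sobolevConst N

/-- `C_0^∞(Ω)`: smooth real functions with compact support contained in `Ω`. -/
def IsTestFunction {E : Type*} [NormedAddCommGroup E] [NormedSpace ℝ E]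
    (Ω : Set E) (v : E → ℝ) : Prop :=
  ContDiff ℝ ∞ v ∧ HasCompactSupport v ∧ tsupport v ⊆ Ω

/-- The change of variables `t = (-log (r / R))^(-1/(N-2))`. -/
def logVar (N : ℕ) (R r : ℝ) : ℝ :=
  (-Real.log (r / R)) ^ (-(1 / ((N : ℝ) - 2)))

/-- `∫_0^R r |v'|^2 dr`. -/
def weightedEnergy (R : ℝ) (v : ℝ → ℝ) : ℝ≥0∞ :=
  ∫⁻ r in Ioo 0 R, ENNReal.ofReal (r * |deriv v r| ^ 2)

/-- `(∫_0^R r⁻¹ (-log (r/R))^(-2(N-1)/(N-2)) |v|^(2N/(N-2)) dr)^((N-2)/N)`. -/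
def weightedPotential (N : ℕ) (R : ℝ) (v : ℝ → ℝ) : ℝ≥0∞ :=
  (∫⁻ r in Ioo 0 R, ENNReal.ofReal
    (r⁻¹ * (-Real.log (r / R)) ^ (-(2 * ((N : ℝ) - 1) / ((N : ℝ) - 2))) *
      |v r| ^ (2 * (N : ℝ) / ((N : ℝ) - 2)))) ^ (((N : ℝ) - 2) / (N : ℝ))

/-- The one-dimensional weighted inequality with constant `c`, for the function `v`. -/
def WeightedIneq (N : ℕ) (R c : ℝ) (v : ℝ → ℝ) : Prop :=
  ENNReal.ofReal c * weightedPotential N R v ≤ weightedEnergy R v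

/-- The Sobolev inequality in `ℝ^N` with constant `S`, for the function `u`:
`∫ |∇u|^2 ≥ S (∫ |u|^(2N/(N-2)))^((N-2)/N)`. -/
def SobolevIneq (N : ℕ) (S : ℝ) (u : EuclideanSpace ℝ (Fin N) → ℝ) : Prop :=
  ENNReal.ofReal S *
      (∫⁻ x, ENNReal.ofReal (|u x| ^ (2 * (N : ℝ) / ((N : ℝ) - 2)))) ^ (((N : ℝ) - 2) / (N : ℝ))
    ≤ ∫⁻ x, ENNReal.ofReal (‖gradient u x‖ ^ 2)

/-- The completion of `C_0^∞(0, R)` under the norm `(∫_0^R r |v'|^2 dr)^(1/2)`, realised as a space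
of functions on `(0, R)`: since `|v r| ≤ (log (R/r))^(1/2) (∫_0^R r |v'|^2 dr)^(1/2)` for test
functions, a Cauchy sequence converges at every point of `(0, R)`, and its limit `v` is locally
absolutely continuous with (a.e.) derivative the limit of the derivatives. Only the values of `v` on
`(0, R)` matter. -/
def MemEnergySpace (R : ℝ) (v : ℝ → ℝ) : Prop :=
  ∃ f : ℕ → ℝ → ℝ, (∀ n, IsTestFunction (Ioo 0 R) (f n)) ∧
    (∀ r ∈ Ioo 0 R, Tendsto (fun n => f n r) atTop (𝓝 (v r))) ∧
    Tendsto (fun n => ∫⁻ r in Ioo 0 R, ENNReal.ofReal (r * |deriv (f n) r - deriv v r| ^ 2))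
      atTop (𝓝 0)

/-- The quotient of the two sides of the weighted inequality. -/
def weightedQuotient (N : ℕ) (R : ℝ) (v : ℝ → ℝ) : ℝ≥0∞ :=
  weightedEnergy R v / weightedPotential N R v

/-- `v` is a minimizer: a nonzero element of the energy space at which the quotient is smallest. -/
def IsWeightedMinimizer (N : ℕ) (R : ℝ) (v : ℝ → ℝ) : Prop :=
  MemEnergySpace R v ∧ (∃ r ∈ Ioo 0 R, v r ≠ 0) ∧
    ∀ w : ℝ → ℝ, MemEnergySpace R w → (∃ r ∈ Ioo 0 R, w r ≠ 0) →
      weightedQuotient N R v ≤ weightedQuotient N R w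

/-- `ψ_{μ,ν}(t) = (μ² + ν² t²)^(-(N-2)/2)`. -/
def sobolevExtremal (N : ℕ) (μ ν t : ℝ) : ℝ :=
  (μ ^ 2 + ν ^ 2 * t ^ 2) ^ (-(((N : ℝ) - 2) / 2))

/-- `φ_{μ,ν}(r) = (μ² + ν² (-log (r/R))^(-2/(N-2)))^(-(N-2)/2)`. -/
def weightedExtremal (N : ℕ) (R μ ν r : ℝ) : ℝ :=
  (μ ^ 2 + ν ^ 2 * (-Real.log (r / R)) ^ (-(2 / ((N : ℝ) - 2)))) ^ (-(((N : ℝ) - 2) / 2))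

end

/-! The substitution t = (-log(r/R))^(-1/(N-2)) turns ∫ r v'² dr into (N-2)⁻¹ ∫ t^(N-1) w'² dt and
the potential integral into (N-2) ∫ t^(N-1) |w|^(2N/(N-2)) dt (`weightedEnergy_eq`,
`weightedPotential_eq`). Up to powers of N ω_N these are the two sides of the Sobolev inequality for
w(|x|), so (m) is its radial case (`weightedIneq_iff_sobolevIneq`).

The sharp Sobolev inequality (`sharp_sobolev_pi`) is proved by mass transport. With p = 2n/(n-2), a
density F close to |u|^p, of mass m, is carried to a multiple of (1+|y|²)^(-n) by a triangular
(Knothe) map T. The determinant of DT is the product of its diagonal, so AM-GM gives n (det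
DT)^(1/n) ≤ div T. Multiplying by |u|^(2(n-1)/(n-2)), integrating by parts and applying
Cauchy-Schwarz yields the inequality, and the moments of the target give the sharp constant. In the
coordinates y_k = s_k ∏_{j<k} √(1+s_j²) one has 1+|y|² = ∏(1+s_k²), so the target becomes a product
measure and T is built from one-dimensional quantile functions. Since |u|^p has zeros, a small
Gaussian is added and removed in the limit, with the moments truncated meanwhile.

Optimality: both integrals of φ_{μ,ν} are beta integrals with quotient C_M
(`weightedQuotient_weightedExtremal`), φ_{μ,ν} lies in X by a cutoff in the variable log(-log(r/R)),
and a weighted inequality passes from test functions to X by Fatou (`MemEnergySpace.weightedIneq`).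
Hence (m) for all v forces c ≤ C_M, and the sharp Sobolev inequality then covers all u, radial or
not; no rearrangement is needed.

Minimizers: a minimizer satisfies a weak Euler-Lagrange equation, and the lemma of du Bois-Reymond
makes it classical (`IsWeightedMinimizer.exists_flux`). Then h(s) = e^(-s/2) v(R exp(-e^s)) solves
the autonomous equation h'' = h/4 - l|h|^(p-2)h on ℝ, and h → 0 at ±∞ because v ∈ X. The first
integral therefore vanishes, which ties l to the maximum of |h|, and ODE uniqueness identifies ±h
with a power of cosh (`exists_eq_soliton_of_tendsto_zero`). Back in r this is φ_{μ,ν}. -/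

/-! ### Beta integrals and the constants ω_N and |𝕊_N| -/

lemma lintegral_rpow_mul_exp_neg_mul {c r : ℝ} (hc : 0 < c) (hr : 0 < r) :
    ∫⁻ t in Ioi (0 : ℝ), ENNReal.ofReal (t ^ (c - 1) * Real.exp (-(r * t))) =
      ENNReal.ofReal (r ^ (-c) * Real.Gamma c) := by
  have h := integral_rpow_mul_exp_neg_mul_rpow (p := 1) (q := c - 1) (b := r) one_pos
    (by linarith) hr
  have hi := integrableOn_rpow_mul_exp_neg_mul_rpow (p := 1) (s := c - 1) (b := r)
    (by linarith) one_pos hr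
  simp only [Real.rpow_one, neg_mul] at h hi
  rw [← ofReal_integral_eq_lintegral_ofReal hi, h]
  · congr 1
    simp
  · filter_upwards [self_mem_ae_restrict measurableSet_Ioi] with t ht
    have : (0 : ℝ) < t := ht
    positivity

lemma lintegral_rpow_mul_exp_neg_mul_sq {α b : ℝ} (hα : 0 < α) (hb : 0 < b) :
    ∫⁻ t in Ioi (0 : ℝ), ENNReal.ofReal (t ^ (2 * α - 1) * Real.exp (-(b * t ^ 2))) =
      ENNReal.ofReal (b ^ (-α) * Real.Gamma α / 2) := by
  have h := integral_rpow_mul_exp_neg_mul_rpow (p := 2) (q := 2 * α - 1) (b := b) two_pos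
    (by linarith) hb
  have hi := integrableOn_rpow_mul_exp_neg_mul_rpow (p := 2) (s := 2 * α - 1) (b := b)
    (by linarith) two_pos hb
  simp only [Real.rpow_two, neg_mul] at h hi
  rw [← ofReal_integral_eq_lintegral_ofReal hi, h]
  · congr 1
    ring_nf
  · filter_upwards [self_mem_ae_restrict measurableSet_Ioi] with t ht
    have : (0 : ℝ) < t := ht
    positivity

/-- The beta-type integral `∫_0^∞ t^(2α-1) (a + b t²)^(-c) dt`. -/
lemma lintegral_rpow_mul_add_sq_rpow {α c a b : ℝ} (hα : 0 < α) (hc : α < c) (ha : 0 < a)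
    (hb : 0 < b) :
    ∫⁻ t in Ioi (0 : ℝ), ENNReal.ofReal (t ^ (2 * α - 1) * (a + b * t ^ 2) ^ (-c)) =
      ENNReal.ofReal (Real.Gamma α * Real.Gamma (c - α) / (2 * Real.Gamma c) *
        (b ^ (-α) * a ^ (-(c - α)))) := by
  have hc0 : 0 < c := hα.trans hc
  have hG : 0 < Real.Gamma c := Real.Gamma_pos_of_pos hc0
  have hm : Measurable (fun z : ℝ × ℝ => ENNReal.ofReal
      (z.1 ^ (2 * α - 1) * (z.2 ^ (c - 1) * Real.exp (-((a + b * z.1 ^ 2) * z.2))))) := by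
    fun_prop
  -- Γ(c)(a+bt²)^(-c) is the integral of u^(c-1) e^(-(a+bt²)u) in u; after Tonelli the t-integral is
  -- Gaussian and the remaining u-integral is again a Gamma function.
  have h1 : ENNReal.ofReal (Real.Gamma c) *
      ∫⁻ t in Ioi (0 : ℝ), ENNReal.ofReal (t ^ (2 * α - 1) * (a + b * t ^ 2) ^ (-c)) =
      ∫⁻ t in Ioi (0 : ℝ), ∫⁻ u in Ioi (0 : ℝ), ENNReal.ofReal
        (t ^ (2 * α - 1) * (u ^ (c - 1) * Real.exp (-((a + b * t ^ 2) * u)))) := by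
    rw [← lintegral_const_mul' _ _ ENNReal.ofReal_ne_top]
    refine setLIntegral_congr_fun measurableSet_Ioi fun t ht => ?_
    have ht0 : (0 : ℝ) < t := ht
    have hp : 0 < a + b * t ^ 2 := by positivity
    have : ∀ u : ℝ, ENNReal.ofReal
        (t ^ (2 * α - 1) * (u ^ (c - 1) * Real.exp (-((a + b * t ^ 2) * u)))) =
        ENNReal.ofReal (t ^ (2 * α - 1)) *
          ENNReal.ofReal (u ^ (c - 1) * Real.exp (-((a + b * t ^ 2) * u))) := fun u => by
      rw [ENNReal.ofReal_mul (by positivity)]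
    simp only [this]
    rw [lintegral_const_mul' _ _ ENNReal.ofReal_ne_top, lintegral_rpow_mul_exp_neg_mul hc0 hp,
      ← ENNReal.ofReal_mul hG.le, ← ENNReal.ofReal_mul (by positivity)]
    congr 1
    ring
  have h2 : ∫⁻ t in Ioi (0 : ℝ), ∫⁻ u in Ioi (0 : ℝ), ENNReal.ofReal
        (t ^ (2 * α - 1) * (u ^ (c - 1) * Real.exp (-((a + b * t ^ 2) * u)))) =
      ENNReal.ofReal (Real.Gamma α / 2 * b ^ (-α)) *
        ENNReal.ofReal (a ^ (-(c - α)) * Real.Gamma (c - α)) := by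
    rw [lintegral_lintegral_swap (by exact hm.aemeasurable),
      ← lintegral_rpow_mul_exp_neg_mul (sub_pos.2 hc) ha,
      ← lintegral_const_mul' _ _ ENNReal.ofReal_ne_top]
    refine setLIntegral_congr_fun measurableSet_Ioi fun u hu => ?_
    have hu0 : (0 : ℝ) < u := hu
    have : ∀ t : ℝ, ENNReal.ofReal
        (t ^ (2 * α - 1) * (u ^ (c - 1) * Real.exp (-((a + b * t ^ 2) * u)))) =
        ENNReal.ofReal (u ^ (c - 1) * Real.exp (-(a * u))) *
          ENNReal.ofReal (t ^ (2 * α - 1) * Real.exp (-((b * u) * t ^ 2))) := fun t => by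
      rw [← ENNReal.ofReal_mul (by positivity)]
      congr 1
      rw [show -((a + b * t ^ 2) * u) = -(a * u) + -((b * u) * t ^ 2) by ring, Real.exp_add]
      ring
    simp only [this]
    rw [lintegral_const_mul' _ _ ENNReal.ofReal_ne_top,
      lintegral_rpow_mul_exp_neg_mul_sq hα (by positivity), ← ENNReal.ofReal_mul (by positivity),
      ← ENNReal.ofReal_mul (by have := Real.Gamma_pos_of_pos hα; positivity)]
    congr 1
    rw [Real.mul_rpow hb.le hu0.le, show c - α - 1 = (c - 1) + -α by ring, Real.rpow_add hu0]
    ring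
  have h3 := h1.trans h2
  have hGa := Real.Gamma_pos_of_pos hα
  have hGb := Real.Gamma_pos_of_pos (sub_pos.2 hc)
  rw [← ENNReal.ofReal_mul (by positivity)] at h3
  have h0 : ENNReal.ofReal (Real.Gamma c) ≠ 0 := by simpa using hG
  rw [← ENNReal.mul_right_inj h0 ENNReal.ofReal_ne_top, h3, ← ENNReal.ofReal_mul hG.le]
  congr 1
  field_simp

lemma lintegral_one_add_sq_rpow {c : ℝ} (hc : 1 / 2 < c) :
    ∫⁻ s : ℝ, ENNReal.ofReal ((1 + s ^ 2) ^ (-c)) =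
      ENNReal.ofReal (√Real.pi * Real.Gamma (c - 1 / 2) / Real.Gamma c) := by
  have h := lintegral_rpow_mul_add_sq_rpow (α := 1 / 2) (c := c) one_half_pos hc one_pos one_pos
  have h' : ∫⁻ t in Ioi (0 : ℝ), ENNReal.ofReal ((1 + t ^ 2) ^ (-c)) =
      ENNReal.ofReal (√Real.pi * Real.Gamma (c - 1 / 2) / (2 * Real.Gamma c)) := by
    rw [Real.Gamma_one_half_eq] at h
    simpa using h
  have h2 : ∫⁻ t in Iio (0 : ℝ), ENNReal.ofReal ((1 + t ^ 2) ^ (-c)) =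
      ∫⁻ t in Ioi (0 : ℝ), ENNReal.ofReal ((1 + t ^ 2) ^ (-c)) := by
    have := (Measure.measurePreserving_neg (volume : Measure ℝ)).setLIntegral_comp_preimage_emb
      (MeasurableEquiv.neg ℝ).measurableEmbedding
      (fun t => ENNReal.ofReal ((1 + t ^ 2) ^ (-c))) (Ioi (0 : ℝ))
    simpa using this
  have h3 : ∫⁻ s : ℝ, ENNReal.ofReal ((1 + s ^ 2) ^ (-c)) =
      (∫⁻ t in Iic (0 : ℝ), ENNReal.ofReal ((1 + t ^ 2) ^ (-c))) +
      ∫⁻ t in Ioi (0 : ℝ), ENNReal.ofReal ((1 + t ^ 2) ^ (-c)) := by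
    rw [← compl_Iic]
    exact (lintegral_add_compl _ (measurableSet_Iic (a := (0 : ℝ)))).symm
  have hGb := Real.Gamma_pos_of_pos (sub_pos.2 hc)
  have hG := Real.Gamma_pos_of_pos (one_half_pos.trans hc)
  rw [h3, ← setLIntegral_congr (Iio_ae_eq_Iic (a := (0 : ℝ))), h2, h',
    ← ENNReal.ofReal_add (by positivity) (by positivity)]
  congr 1
  field_simp
  ring

lemma unitBallVolume_eq {N : ℕ} (hN : 0 < N) :
    unitBallVolume N = Real.pi ^ ((N : ℝ) / 2) / Real.Gamma ((N : ℝ) / 2 + 1) := by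
  have : Nonempty (Fin N) := ⟨⟨0, hN⟩⟩
  have hG : 0 < Real.Gamma ((N : ℝ) / 2 + 1) := Real.Gamma_pos_of_pos (by positivity)
  rw [unitBallVolume, Measure.real, EuclideanSpace.volume_ball]
  simp only [ENNReal.ofReal_one, one_pow, one_mul, Fintype.card_fin]
  rw [ENNReal.toReal_ofReal (by positivity), Real.sqrt_eq_rpow, ← Real.rpow_natCast,
    ← Real.rpow_mul Real.pi_pos.le]
  congr 2
  ring

lemma unitBallVolume_pos {N : ℕ} (hN : 0 < N) : 0 < unitBallVolume N := by
  rw [unitBallVolume_eq hN]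
  have hG : 0 < Real.Gamma ((N : ℝ) / 2 + 1) := Real.Gamma_pos_of_pos (by positivity)
  have := Real.pi_pos
  positivity

lemma mul_unitBallVolume_eq {N : ℕ} (hN : 0 < N) :
    (N : ℝ) * unitBallVolume N = 2 * Real.pi ^ ((N : ℝ) / 2) / Real.Gamma ((N : ℝ) / 2) := by
  have hN' : (0 : ℝ) < N := by exact_mod_cast hN
  have hG : 0 < Real.Gamma ((N : ℝ) / 2) := Real.Gamma_pos_of_pos (by positivity)
  rw [unitBallVolume_eq hN, Real.Gamma_add_one (by positivity)]
  field_simp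

lemma unitSphereArea_eq (N : ℕ) :
    unitSphereArea N = 2 * Real.pi ^ (((N : ℝ) + 1) / 2) / Real.Gamma (((N : ℝ) + 1) / 2) := by
  have h : unitSphereArea N = ((N + 1 : ℕ) : ℝ) * unitBallVolume (N + 1) := by
    rw [unitSphereArea, Measure.real, Measure.toSphere_apply_univ, ENNReal.toReal_mul,
      unitBallVolume, Measure.real, finrank_euclideanSpace_fin, ENNReal.toReal_natCast]
  rw [h, mul_unitBallVolume_eq N.succ_pos]
  push_cast
  rfl

/-- The Gamma-function form of the area of the sphere that enters the sharp constants. -/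
lemma unitSphereArea_eq_Gamma {N : ℕ} (hN : 0 < N) :
    unitSphereArea N =
      2 ^ (N : ℝ) * (Real.pi ^ ((N : ℝ) / 2) * Real.Gamma ((N : ℝ) / 2) / Real.Gamma N) := by
  have hN' : (0 : ℝ) < N := by exact_mod_cast hN
  -- Legendre's duplication formula at N/2 replaces Γ((N+1)/2) by Γ(N)/Γ(N/2).
  have hd := Real.Gamma_mul_Gamma_add_half ((N : ℝ) / 2)
  rw [show (N : ℝ) / 2 + 1 / 2 = ((N : ℝ) + 1) / 2 by ring, show 2 * ((N : ℝ) / 2) = N by ring,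
    Real.rpow_sub two_pos, Real.rpow_one] at hd
  have h1 : 0 < Real.Gamma ((N : ℝ) / 2) := Real.Gamma_pos_of_pos (by positivity)
  have h2 : 0 < Real.Gamma (((N : ℝ) + 1) / 2) := Real.Gamma_pos_of_pos (by positivity)
  have h3 : 0 < Real.Gamma (N : ℝ) := Real.Gamma_pos_of_pos hN'
  have h4 : (0 : ℝ) < 2 ^ (N : ℝ) := by positivity
  have hpi := Real.pi_pos
  rw [unitSphereArea_eq, show ((N : ℝ) + 1) / 2 = (N : ℝ) / 2 + 1 / 2 by ring,
    Real.rpow_add hpi, ← Real.sqrt_eq_rpow]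
  rw [show (N : ℝ) / 2 + 1 / 2 = ((N : ℝ) + 1) / 2 by ring]
  rw [div_eq_iff h2.ne']
  have : Real.Gamma ((N : ℝ) / 2) * Real.Gamma (((N : ℝ) + 1) / 2) * 2 ^ (N : ℝ) =
      Real.Gamma N * 2 * √Real.pi := by rw [hd]; field_simp
  field_simp
  nlinarith [this]

lemma unitSphereArea_pos {N : ℕ} : 0 < unitSphereArea N := by
  rw [unitSphereArea_eq]
  have h2 : 0 < Real.Gamma (((N : ℝ) + 1) / 2) := Real.Gamma_pos_of_pos (by positivity)
  have := Real.pi_pos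
  positivity

/-! ### One-dimensional transport: distribution and quantile functions -/

/-- The normalised distribution function of a density on the line. -/
noncomputable def lineCdf (f : ℝ → ℝ) (x : ℝ) : ℝ :=
  (∫ t in Iic x, f t) / ∫ t, f t

section LineCdf

variable {f : ℝ → ℝ} (hc : Continuous f) (hp : ∀ x, 0 < f x) (hi : Integrable f)

include hp hi in
lemma integral_pos_of_density : 0 < ∫ t, f t := by
  rw [integral_pos_iff_support_of_nonneg (fun x => (hp x).le) hi]
  have : Function.support f = univ := by ext x; simp [(hp x).ne']
  simp [this]

include hc hi in
lemma hasDerivAt_lineCdf (x : ℝ) : HasDerivAt (lineCdf f) (f x / ∫ t, f t) x := by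
  have h : HasDerivAt (fun u => ∫ t in (0 : ℝ)..u, f t) (f x) x :=
    intervalIntegral.integral_hasDerivAt_right hi.intervalIntegrable
      hc.aestronglyMeasurable.stronglyMeasurableAtFilter hc.continuousAt
  have h2 : (fun u => ∫ t in Iic u, f t) =
      fun u => (∫ t in Iic (0 : ℝ), f t) + ∫ t in (0 : ℝ)..u, f t := by
    ext u
    rw [← intervalIntegral.integral_Iic_sub_Iic hi.integrableOn hi.integrableOn]
    ring
  have h3 : HasDerivAt (fun u => ∫ t in Iic u, f t) (f x) x := by
    rw [h2]
    exact h.const_add _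
  exact h3.div_const _

include hc hp hi in
lemma strictMono_lineCdf : StrictMono (lineCdf f) :=
  strictMono_of_hasDerivAt_pos (hasDerivAt_lineCdf hc hi)
    fun x => div_pos (hp x) (integral_pos_of_density hp hi)

include hp hi in
lemma tendsto_lineCdf_atTop : Tendsto (lineCdf f) atTop (𝓝 1) := by
  have h := (tendsto_setIntegral_of_monotone (μ := volume) (f := f) (s := fun x : ℝ => Iic x)
    (fun _ => measurableSet_Iic) (fun _ _ h => Iic_subset_Iic.2 h) hi.integrableOn).div_const
      (∫ t, f t)
  have hu : (⋃ x : ℝ, Iic x) = univ := iUnion_Iic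
  rw [hu, setIntegral_univ, div_self (integral_pos_of_density hp hi).ne'] at h
  exact h

include hi in
lemma tendsto_lineCdf_atBot : Tendsto (lineCdf f) atBot (𝓝 0) := by
  have h := (tendsto_setIntegral_of_antitone (μ := volume) (f := f) (s := fun x : ℝ => Iic (-x))
    (fun _ => measurableSet_Iic) (fun _ _ h => Iic_subset_Iic.2 (neg_le_neg h))
      ⟨0, hi.integrableOn⟩).div_const (∫ t, f t)
  have hu : (⋂ x : ℝ, Iic (-x)) = ∅ := by
    refine eq_empty_of_forall_notMem fun y hy => ?_
    have := mem_iInter.1 hy (-y + 1)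
    simp only [mem_Iic] at this
    linarith
  rw [hu, setIntegral_empty, zero_div] at h
  have h2 := h.comp tendsto_neg_atBot_atTop
  refine h2.congr fun x => ?_
  simp [lineCdf]

include hc hp hi in
lemma lineCdf_mem_Ioo (x : ℝ) : lineCdf f x ∈ Ioo (0 : ℝ) 1 := by
  have hs := strictMono_lineCdf hc hp hi
  constructor
  · have h1 : lineCdf f (x - 1) < lineCdf f x := hs (by linarith)
    have h2 : 0 ≤ lineCdf f (x - 1) :=
      hs.monotone.le_of_tendsto (tendsto_lineCdf_atBot hi) _
    linarith
  · have h1 : lineCdf f x < lineCdf f (x + 1) := hs (by linarith)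
    have h2 : lineCdf f (x + 1) ≤ 1 :=
      hs.monotone.ge_of_tendsto (tendsto_lineCdf_atTop hp hi) _
    linarith

include hc hp hi in
lemma range_lineCdf : range (lineCdf f) = Ioo 0 1 := by
  refine Subset.antisymm (range_subset_iff.2 (lineCdf_mem_Ioo hc hp hi)) fun y hy => ?_
  have hcont : Continuous (lineCdf f) :=
    continuous_iff_continuousAt.2 fun x => (hasDerivAt_lineCdf hc hi x).continuousAt
  refine mem_range_of_exists_le_of_exists_ge hcont ?_ ?_
  · exact ((tendsto_lineCdf_atBot hi).eventually (eventually_le_nhds hy.1)).exists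
  · exact ((tendsto_lineCdf_atTop hp hi).eventually (eventually_ge_nhds hy.2)).exists

include hc hp hi in
/-- The distribution function transports the density to the uniform law on `(0, 1)`. -/
lemma lintegral_comp_lineCdf (h : ℝ → ℝ≥0∞) :
    ∫⁻ x, ENNReal.ofReal (f x) * h (lineCdf f x) =
      ENNReal.ofReal (∫ t, f t) * ∫⁻ u in Ioo 0 1, h u := by
  have hm := integral_pos_of_density hp hi
  have h1 := lintegral_image_eq_lintegral_abs_deriv_mul MeasurableSet.univ
    (fun x _ => (hasDerivAt_lineCdf hc hi x).hasDerivWithinAt)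
    (strictMono_lineCdf hc hp hi).injective.injOn h
  rw [image_univ, range_lineCdf hc hp hi, setLIntegral_univ] at h1
  rw [h1, ← lintegral_const_mul' _ _ ENNReal.ofReal_ne_top]
  refine lintegral_congr fun x => ?_
  rw [← mul_assoc, ← ENNReal.ofReal_mul hm.le, abs_of_pos (div_pos (hp x) hm),
    mul_div_cancel₀ _ hm.ne']

/-- The quantile function of a density on the line. -/
noncomputable def lineQuantile (f : ℝ → ℝ) : ℝ → ℝ :=
  (Ioo (0 : ℝ) 1).indicator (Function.invFun (lineCdf f))

include hc hp hi in
lemma lineQuantile_lineCdf (x : ℝ) : lineQuantile f (lineCdf f x) = x := by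
  rw [lineQuantile, indicator_of_mem (lineCdf_mem_Ioo hc hp hi x)]
  exact Function.leftInverse_invFun (strictMono_lineCdf hc hp hi).injective x

include hc hp hi in
lemma lineCdf_lineQuantile {u : ℝ} (hu : u ∈ Ioo (0 : ℝ) 1) : lineCdf f (lineQuantile f u) = u := by
  obtain ⟨x, rfl⟩ := (range_lineCdf hc hp hi).symm ▸ hu
  rw [lineQuantile_lineCdf hc hp hi]

include hc hp hi in
-- A strictly monotone function on an open interval whose image is all of ℝ cannot jump.
lemma continuousOn_lineQuantile : ContinuousOn (lineQuantile f) (Ioo 0 1) := by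
  have hs := strictMono_lineCdf hc hp hi
  have hmono : StrictMonoOn (lineQuantile f) (Ioo 0 1) := by
    intro u hu v hv huv
    rwa [← hs.lt_iff_lt, lineCdf_lineQuantile hc hp hi hu, lineCdf_lineQuantile hc hp hi hv]
  intro u hu
  refine (hmono.continuousAt_of_image_mem_nhds (Ioo_mem_nhds hu.1 hu.2) ?_).continuousWithinAt
  have : lineQuantile f '' Ioo 0 1 = univ := by
    refine eq_univ_of_forall fun x => ⟨lineCdf f x, lineCdf_mem_Ioo hc hp hi x, ?_⟩
    exact lineQuantile_lineCdf hc hp hi x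
  rw [this]
  exact univ_mem

include hc hp hi in
lemma measurable_lineQuantile : Measurable (lineQuantile f) := by
  classical
  have h := (continuousOn_lineQuantile hc hp hi).measurable_piecewise
    (g := fun _ => (0 : ℝ)) continuousOn_const measurableSet_Ioo
  convert h using 1
  ext u
  by_cases hu : u ∈ Ioo (0 : ℝ) 1
  · simp [Set.piecewise, hu]
  · simp only [Set.piecewise, hu, if_false]
    rw [lineQuantile, indicator_of_notMem hu]

include hc hp hi in
lemma hasDerivAt_lineQuantile {u : ℝ} (hu : u ∈ Ioo (0 : ℝ) 1) :
    HasDerivAt (lineQuantile f) ((∫ t, f t) / f (lineQuantile f u)) u := by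
  have hm := integral_pos_of_density hp hi
  have hq := hp (lineQuantile f u)
  have h := HasDerivAt.of_local_left_inverse (f := lineCdf f) (g := lineQuantile f)
    ((continuousOn_lineQuantile hc hp hi).continuousAt (Ioo_mem_nhds hu.1 hu.2))
    (hasDerivAt_lineCdf hc hi (lineQuantile f u)) (div_pos hq hm).ne'
    (by filter_upwards [Ioo_mem_nhds hu.1 hu.2] with v hv using lineCdf_lineQuantile hc hp hi hv)
  rwa [inv_div] at h

include hc hp hi in
lemma lintegral_comp_lineQuantile (h : ℝ → ℝ≥0∞) :
    ∫⁻ x, ENNReal.ofReal (f x) * h x =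
      ENNReal.ofReal (∫ t, f t) * ∫⁻ u in Ioo 0 1, h (lineQuantile f u) := by
  rw [← lintegral_comp_lineCdf hc hp hi (fun u => h (lineQuantile f u))]
  simp only [lineQuantile_lineCdf hc hp hi]

end LineCdf

/-! ### Marginals of a density with Gaussian decay -/

/-- The marginal of `F` obtained by integrating out the coordinates of index at least `k`. -/
noncomputable def tailMarginal {n : ℕ} (F : (Fin n → ℝ) → ℝ) (k : ℕ) (x : Fin n → ℝ) : ℝ≥0∞ :=
  lmarginal (fun _ => volume) (Finset.univ.filter fun j : Fin n => k ≤ j)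
    (fun x => ENNReal.ofReal (F x)) x

/-- A positive continuous density with Gaussian decay. -/
structure IsGaussianBounded {n : ℕ} (F : (Fin n → ℝ) → ℝ) : Prop where
  cont : Continuous F
  pos : ∀ x, 0 < F x
  bound : ∃ C, ∀ x, F x ≤ C * ∏ j, Real.exp (-(x j) ^ 2)

lemma integrable_exp_neg_sq : Integrable (fun t : ℝ => Real.exp (-t ^ 2)) := by
  simpa using integrable_exp_neg_mul_sq (b := 1) one_pos

section TailMarginal

variable {n : ℕ} {F : (Fin n → ℝ) → ℝ}

lemma filter_le_eq_insert (k : Fin n) :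
    (Finset.univ.filter fun j : Fin n => (k : ℕ) ≤ j) =
      insert k (Finset.univ.filter fun j : Fin n => (k : ℕ) + 1 ≤ j) := by
  ext j
  simp only [Finset.mem_filter, Finset.mem_univ, true_and, Finset.mem_insert, Fin.ext_iff]
  omega

lemma notMem_filter_succ_le (k : Fin n) :
    k ∉ (Finset.univ.filter fun j : Fin n => (k : ℕ) + 1 ≤ j) := by
  simp

lemma filter_lt_eq_insert (k : Fin n) :
    (Finset.univ.filter fun j : Fin n => (j : ℕ) < k + 1) =
      insert k (Finset.univ.filter fun j : Fin n => (j : ℕ) < k) := by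
  ext j
  simp only [Finset.mem_filter, Finset.mem_univ, true_and, Finset.mem_insert, Fin.ext_iff]
  omega

lemma notMem_filter_lt (k : Fin n) :
    k ∉ (Finset.univ.filter fun j : Fin n => (j : ℕ) < k) := by
  simp

lemma tailMarginal_self (x : Fin n → ℝ) : tailMarginal F n x = ENNReal.ofReal (F x) := by
  have : (Finset.univ.filter fun j : Fin n => n ≤ (j : ℕ)) = ∅ := by
    ext j; simp
  rw [tailMarginal, this, lmarginal_empty]

lemma tailMarginal_zero (x : Fin n → ℝ) :
    tailMarginal F 0 x = ∫⁻ y, ENNReal.ofReal (F y) := by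
  have : (Finset.univ.filter fun j : Fin n => 0 ≤ (j : ℕ)) = Finset.univ := by
    ext j; simp
  rw [tailMarginal, this, lmarginal_univ]
  rfl

lemma tailMarginal_update_of_le {k : ℕ} {j : Fin n} (h : k ≤ j) (x : Fin n → ℝ) (t : ℝ) :
    tailMarginal F k (Function.update x j t) = tailMarginal F k x :=
  lmarginal_update_of_mem _ (by simpa using h) _ _ _

lemma tailMarginal_eq_lintegral (hF : Measurable F) (k : Fin n) (x : Fin n → ℝ) :
    tailMarginal F k x = ∫⁻ t, tailMarginal F (k + 1) (Function.update x k t) := by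
  rw [tailMarginal, filter_le_eq_insert, lmarginal_insert _ (by fun_prop)
    (notMem_filter_succ_le k)]
  rfl

/-- Induction downwards from `k = n`. Each integration uses up one Gaussian factor of the bound;
that factor dominates the integrand uniformly in the other coordinates, which gives continuity by
dominated convergence, and the remaining factors bound the next marginal. -/
lemma tailMarginal_properties (hF : IsGaussianBounded F) (i : ℕ) : ∀ k, k + i = n →
    Continuous (fun x => (tailMarginal F k x).toReal) ∧
    (∀ x, 0 < (tailMarginal F k x).toReal) ∧
    ∃ C, ∀ x, (tailMarginal F k x).toReal ≤
      C * ∏ j ∈ Finset.univ.filter (fun j : Fin n => (j : ℕ) < k), Real.exp (-(x j) ^ 2) := by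
  induction i with
  | zero =>
    intro k hk
    obtain rfl : k = n := hk
    simp only [tailMarginal_self, ENNReal.toReal_ofReal (hF.pos _).le]
    refine ⟨hF.cont, hF.pos, ?_⟩
    simpa using hF.bound
  | succ i ih =>
    intro k hk
    obtain ⟨hc, hp, C, hC⟩ := ih (k + 1) (by omega)
    obtain ⟨kf, rfl⟩ : ∃ kf : Fin n, (kf : ℕ) = k := ⟨⟨k, by omega⟩, rfl⟩
    have htop : ∀ x, ENNReal.ofReal (tailMarginal F (kf + 1) x).toReal =
        tailMarginal F (kf + 1) x := fun x =>
      ENNReal.ofReal_toReal (ENNReal.toReal_pos_iff.1 (hp x)).2.ne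
    have hC0 : 0 ≤ C := by
      have h := (hp 0).le.trans (hC 0)
      simpa using h
    have hb : ∀ (x : Fin n → ℝ) (t : ℝ),
        (tailMarginal F (kf + 1) (Function.update x kf t)).toReal ≤
        C * (∏ j ∈ Finset.univ.filter (fun j : Fin n => (j : ℕ) < kf), Real.exp (-(x j) ^ 2)) *
          Real.exp (-t ^ 2) := by
      intro x t
      refine (hC _).trans_eq ?_
      rw [filter_lt_eq_insert, Finset.prod_insert (notMem_filter_lt kf), Function.update_self,
        mul_comm (Real.exp _), ← mul_assoc]
      congr 2
      refine Finset.prod_congr rfl fun j hj => ?_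
      have : j ≠ kf := by
        rintro rfl
        exact notMem_filter_lt _ hj
      rw [Function.update_of_ne this]
    have hcu : ∀ x, Continuous fun t => (tailMarginal F (kf + 1) (Function.update x kf t)).toReal :=
      fun x => hc.comp (by fun_prop)
    have hint : ∀ x, Integrable
        fun t => (tailMarginal F (kf + 1) (Function.update x kf t)).toReal := fun x =>
      (integrable_exp_neg_sq.const_mul _).mono' (hcu x).aestronglyMeasurable
        (Eventually.of_forall fun t => by
          rw [Real.norm_of_nonneg (hp _).le]
          exact hb x t)
    have heq : ∀ x, (tailMarginal F kf x).toReal =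
        ∫ t, (tailMarginal F (kf + 1) (Function.update x kf t)).toReal := by
      intro x
      rw [tailMarginal_eq_lintegral hF.cont.measurable,
        integral_eq_lintegral_of_nonneg_ae (Eventually.of_forall fun t => (hp _).le)
          (hcu x).aestronglyMeasurable]
      simp only [htop]
    simp only [heq]
    refine ⟨?_, fun x => integral_pos_of_density (fun t => hp _) (hint x),
      C * ∫ t, Real.exp (-t ^ 2), fun x => ?_⟩
    · refine continuous_of_dominated (bound := fun t => C * Real.exp (-t ^ 2))
        (fun x => (hcu x).aestronglyMeasurable) ?_ (integrable_exp_neg_sq.const_mul _) ?_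
      · refine fun x => Eventually.of_forall fun t => ?_
        rw [Real.norm_of_nonneg (hp _).le]
        refine (hb x t).trans ?_
        refine mul_le_mul_of_nonneg_right ?_ (Real.exp_pos _).le
        refine mul_le_of_le_one_right hC0 ?_
        exact Finset.prod_le_one (fun j _ => (Real.exp_pos _).le)
          fun j _ => Real.exp_le_one_iff.2 (by nlinarith [sq_nonneg (x j)])
      · exact Eventually.of_forall fun t => hc.comp (by fun_prop)
    · refine (integral_mono (hint x) (integrable_exp_neg_sq.const_mul _) (hb x)).trans_eq ?_
      rw [integral_const_mul]
      ring

variable (hF : IsGaussianBounded F)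
include hF

lemma continuous_tailMarginal {k : ℕ} (hk : k ≤ n) :
    Continuous (fun x => (tailMarginal F k x).toReal) :=
  (tailMarginal_properties hF (n - k) k (by omega)).1

lemma tailMarginal_pos {k : ℕ} (hk : k ≤ n) (x) : 0 < (tailMarginal F k x).toReal :=
  (tailMarginal_properties hF (n - k) k (by omega)).2.1 x

lemma ofReal_tailMarginal {k : ℕ} (hk : k ≤ n) (x) :
    ENNReal.ofReal (tailMarginal F k x).toReal = tailMarginal F k x :=
  ENNReal.ofReal_toReal (ENNReal.toReal_pos_iff.1 (tailMarginal_pos hF hk x)).2.ne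

lemma continuous_tailMarginal_update (k : Fin n) (x : Fin n → ℝ) :
    Continuous fun t => (tailMarginal F (k + 1) (Function.update x k t)).toReal :=
  (continuous_tailMarginal hF k.2).comp (by fun_prop)

lemma tailMarginal_update_pos (k : Fin n) (x : Fin n → ℝ) (t : ℝ) :
    0 < (tailMarginal F (k + 1) (Function.update x k t)).toReal :=
  tailMarginal_pos hF k.2 _

lemma integrable_tailMarginal_update (k : Fin n) (x : Fin n → ℝ) :
    Integrable fun t => (tailMarginal F (k + 1) (Function.update x k t)).toReal := by
  refine integrable_toReal_of_lintegral_ne_top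
    (by
      have := (continuous_tailMarginal_update hF k x).measurable.ennreal_ofReal
      simp only [ofReal_tailMarginal hF (k := (k : ℕ) + 1) k.2] at this
      exact this.aemeasurable) ?_
  rw [← tailMarginal_eq_lintegral hF.cont.measurable]
  exact (ENNReal.toReal_pos_iff.1 (tailMarginal_pos hF k.2.le x)).2.ne

lemma tailMarginal_toReal_eq_integral (k : Fin n) (x : Fin n → ℝ) :
    (tailMarginal F k x).toReal =
      ∫ t, (tailMarginal F (k + 1) (Function.update x k t)).toReal := by
  rw [tailMarginal_eq_lintegral hF.cont.measurable,
    integral_eq_lintegral_of_nonneg_ae (Eventually.of_forall fun t =>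
      (tailMarginal_update_pos hF k x t).le)
      (continuous_tailMarginal_update hF k x).aestronglyMeasurable]
  simp only [ofReal_tailMarginal hF (k := (k : ℕ) + 1) k.2]

end TailMarginal

/-! ### The triangular rearrangement onto a product density -/

/-- The distribution function of the `k`-th coordinate conditioned on the previous ones. -/
noncomputable def condCdf {n : ℕ} (F : (Fin n → ℝ) → ℝ) (k : Fin n) (x : Fin n → ℝ) : ℝ :=
  lineCdf (fun t => (tailMarginal F (k + 1) (Function.update x k t)).toReal) (x k)

/-- The coordinates of the triangular (Knothe) rearrangement of the density `F` onto the product of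
the one-dimensional densities `q k`. -/
noncomputable def knothe {n : ℕ} (F : (Fin n → ℝ) → ℝ) (q : Fin n → ℝ → ℝ) (k : Fin n)
    (x : Fin n → ℝ) : ℝ :=
  lineQuantile (q k) (condCdf F k x)

/-- The derivative of the `k`-th coordinate of the triangular rearrangement along the `k`-th
direction. -/
noncomputable def knotheDeriv {n : ℕ} (F : (Fin n → ℝ) → ℝ) (q : Fin n → ℝ → ℝ) (k : Fin n)
    (x : Fin n → ℝ) : ℝ :=
  (tailMarginal F (k + 1) x).toReal / (tailMarginal F k x).toReal / q k (knothe F q k x)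

section Knothe

variable {n : ℕ} {F : (Fin n → ℝ) → ℝ}

lemma condCdf_update (k : Fin n) (x : Fin n → ℝ) (s : ℝ) :
    condCdf F k (Function.update x k s) =
      lineCdf (fun t => (tailMarginal F (k + 1) (Function.update x k t)).toReal) s := by
  simp [condCdf]

/-- Triangularity: the conditional law of coordinate j involves only coordinates up to j, the later
ones having been integrated out. -/
lemma knothe_update_of_lt {q : Fin n → ℝ → ℝ} {j k : Fin n} (h : j < k) (x : Fin n → ℝ) (s : ℝ) :
    knothe F q j (Function.update x k s) = knothe F q j x := by
  have h1 : ∀ t, tailMarginal F (j + 1) (Function.update (Function.update x k s) j t) =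
      tailMarginal F (j + 1) (Function.update x j t) := by
    intro t
    rw [Function.update_comm h.ne', tailMarginal_update_of_le (by exact h)]
  simp only [knothe, condCdf, h1, Function.update_of_ne h.ne]

variable (hF : IsGaussianBounded F) {q : Fin n → ℝ → ℝ} (hqc : ∀ k, Continuous (q k))
  (hqp : ∀ k s, 0 < q k s) (hqi : ∀ k, Integrable (q k)) (hq1 : ∀ k, ∫ s, q k s = 1)

include hF in
lemma condCdf_mem_Ioo (k : Fin n) (x : Fin n → ℝ) : condCdf F k x ∈ Ioo (0 : ℝ) 1 :=
  lineCdf_mem_Ioo (continuous_tailMarginal_update hF k x) (tailMarginal_update_pos hF k x)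
    (integrable_tailMarginal_update hF k x) _

include hF in
-- The upper limit of integration also depends on the point, so the integral is rewritten with an
-- indicator over the whole line, where measurability of parametric integrals applies.
lemma measurable_condCdf (k : Fin n) : Measurable (condCdf F k) := by
  have h1 : ∀ x, condCdf F k x = (∫ t, ({p : (Fin n → ℝ) × ℝ | p.2 ≤ p.1 k}.indicator
      (fun p => (tailMarginal F (k + 1) (Function.update p.1 k p.2)).toReal) (x, t))) /
      (tailMarginal F k x).toReal := by
    intro x
    rw [condCdf, lineCdf, ← tailMarginal_toReal_eq_integral hF, ← integral_indicator
      measurableSet_Iic]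
    rfl
  have h2 : Continuous fun p : (Fin n → ℝ) × ℝ => Function.update p.1 k p.2 := by fun_prop
  have h3 : StronglyMeasurable (fun p : (Fin n → ℝ) × ℝ =>
      {p : (Fin n → ℝ) × ℝ | p.2 ≤ p.1 k}.indicator
      (fun p => (tailMarginal F (k + 1) (Function.update p.1 k p.2)).toReal) p) := by
    refine StronglyMeasurable.indicator ?_ ?_
    · exact ((continuous_tailMarginal hF (k := (k : ℕ) + 1) k.2).comp h2).stronglyMeasurable
    · exact measurableSet_le (by fun_prop) (by fun_prop)
  rw [funext h1]
  exact h3.integral_prod_right'.measurable.div (continuous_tailMarginal hF k.2.le).measurable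

include hF hqc hqp hqi in
lemma measurable_knothe (k : Fin n) : Measurable (knothe F q k) :=
  (measurable_lineQuantile (hqc k) (hqp k) (hqi k)).comp (measurable_condCdf hF k)

include hF hqc hqp hqi hq1 in
-- Chain rule for a quantile function after a distribution function: the conditional density of F
-- divided by the target density at the image point. The normalising marginal at level k does not
-- see the k-th coordinate.
lemma hasDerivAt_knothe (k : Fin n) (x : Fin n → ℝ) (s : ℝ) :
    HasDerivAt (fun s => knothe F q k (Function.update x k s))
      (knotheDeriv F q k (Function.update x k s)) s := by
  have h1 := hasDerivAt_lineCdf (continuous_tailMarginal_update hF k x)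
    (integrable_tailMarginal_update hF k x) s
  have h2 := hasDerivAt_lineQuantile (hqc k) (hqp k) (hqi k)
    (condCdf_mem_Ioo hF k (Function.update x k s))
  rw [condCdf_update] at h2
  have h3 := h2.comp s h1
  rw [hq1, ← tailMarginal_toReal_eq_integral hF] at h3
  simp only [knothe, knotheDeriv, condCdf_update]
  rw [tailMarginal_update_of_le le_rfl]
  convert! h3 using 1
  ring

include hF hqc hqp hqi hq1 in
-- Regularity is needed only along the k-th coordinate line, where the integration by parts takes
-- place; in the other variables measurability suffices.
lemma continuous_knotheDeriv_update (k : Fin n) (x : Fin n → ℝ) :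
    Continuous fun s => knotheDeriv F q k (Function.update x k s) := by
  have h : Continuous fun s => knothe F q k (Function.update x k s) :=
    continuous_iff_continuousAt.2 fun s =>
      (hasDerivAt_knothe hF hqc hqp hqi hq1 k x s).continuousAt
  refine Continuous.div (Continuous.div (continuous_tailMarginal_update hF k x) ?_ fun s => ?_)
    ((hqc k).comp h) fun s => (hqp k _).ne'
  · simp only [tailMarginal_update_of_le (F := F) (le_refl (k : ℕ))]
    exact continuous_const
  · exact (tailMarginal_pos hF k.2.le _).ne'

include hF hqp in
lemma knotheDeriv_pos (k : Fin n) (x : Fin n → ℝ) : 0 < knotheDeriv F q k x :=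
  div_pos (div_pos (tailMarginal_pos hF (k := (k : ℕ) + 1) k.2 x)
    (tailMarginal_pos hF k.2.le x)) (hqp _ _)

include hF in
-- The conditional densities are quotients of consecutive marginals, so their product telescopes
-- from F down to its total mass.
lemma prod_knotheDeriv (x : Fin n → ℝ) :
    ∏ k, knotheDeriv F q k x =
      F x / (∫⁻ y, ENNReal.ofReal (F y)).toReal / ∏ k, q k (knothe F q k x) := by
  simp only [knotheDeriv, Finset.prod_div_distrib]
  congr 1
  have h : ∀ m ≤ n, ∏ k ∈ Finset.range m,
      (tailMarginal F (k + 1) x).toReal / (tailMarginal F k x).toReal =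
      (tailMarginal F m x).toReal / (tailMarginal F 0 x).toReal := by
    intro m hm
    induction m with
    | zero => simp [(tailMarginal_pos hF (Nat.zero_le n) x).ne']
    | succ m ih =>
      rw [Finset.prod_range_succ, ih (by omega)]
      have h1 := (tailMarginal_pos hF (show m ≤ n by omega) x).ne'
      field_simp
  rw [← Finset.prod_div_distrib, Fin.prod_univ_eq_prod_range
    (fun k => (tailMarginal F (k + 1) x).toReal / (tailMarginal F k x).toReal) n, h n le_rfl,
    tailMarginal_self, tailMarginal_zero, ENNReal.toReal_ofReal (hF.pos x).le]

include hF hqc hqp hqi hq1 in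
-- Coordinates are integrated out from the last to the first. By triangularity the integral in
-- coordinate k meets only the factor `h k`, and the one-dimensional transport of the conditional
-- law turns it into the integral against `q k`.
lemma lmarginal_knothe {h : Fin n → ℝ → ℝ≥0∞} (hh : ∀ k, Measurable (h k)) (i : ℕ) :
    ∀ k, k + i = n → ∀ x : Fin n → ℝ,
    lmarginal (fun _ => volume) (Finset.univ.filter fun j : Fin n => k ≤ j)
      (fun x => ENNReal.ofReal (F x) * ∏ j, h j (knothe F q j x)) x =
    ((∏ j ∈ Finset.univ.filter (fun j : Fin n => (j : ℕ) < k), h j (knothe F q j x)) *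
      ∏ j ∈ Finset.univ.filter (fun j : Fin n => k ≤ j), ∫⁻ s, ENNReal.ofReal (q j s) * h j s) *
      tailMarginal F k x := by
  have hmF := hF.cont.measurable
  have hmk := fun k => measurable_knothe hF hqc hqp hqi k
  induction i with
  | zero =>
    intro k hk x
    obtain rfl : k = n := hk
    have h1 : (Finset.univ.filter fun j : Fin k => k ≤ (j : ℕ)) = ∅ := by
      ext j; simp
    have h2 : (Finset.univ.filter fun j : Fin k => (j : ℕ) < k) = Finset.univ := by
      ext j; simp
    rw [h1, h2, lmarginal_empty]
    simp only [tailMarginal_self, Finset.prod_empty, mul_one]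
    rw [mul_comm]
  | succ i ih =>
    intro k hk x
    obtain ⟨kf, rfl⟩ : ∃ kf : Fin n, (kf : ℕ) = k := ⟨⟨k, by omega⟩, rfl⟩
    rw [filter_le_eq_insert, lmarginal_insert _ (by fun_prop) (notMem_filter_succ_le kf)]
    simp only [ih (kf + 1) (by omega)]
    have hprod : ∀ t : ℝ, ∏ j ∈ Finset.univ.filter (fun j : Fin n => (j : ℕ) < kf + 1),
        h j (knothe F q j (Function.update x kf t)) =
        h kf (knothe F q kf (Function.update x kf t)) *
          ∏ j ∈ Finset.univ.filter (fun j : Fin n => (j : ℕ) < kf), h j (knothe F q j x) := by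
      intro t
      rw [filter_lt_eq_insert, Finset.prod_insert (notMem_filter_lt kf)]
      congr 1
      refine Finset.prod_congr rfl fun j hj => ?_
      rw [knothe_update_of_lt]
      simpa using hj
    simp only [hprod]
    rw [Finset.prod_insert (notMem_filter_succ_le kf)]
    set P := ∏ j ∈ Finset.univ.filter (fun j : Fin n => (j : ℕ) < kf), h j (knothe F q j x)
    set C := ∏ j ∈ Finset.univ.filter (fun j : Fin n => (kf : ℕ) + 1 ≤ j),
      ∫⁻ s, ENNReal.ofReal (q j s) * h j s
    have h3 : ∀ t : ℝ, h kf (knothe F q kf (Function.update x kf t)) * P * C *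
        tailMarginal F (kf + 1) (Function.update x kf t) =
        (P * C) * (ENNReal.ofReal (tailMarginal F (kf + 1) (Function.update x kf t)).toReal *
          h kf (lineQuantile (q kf) (lineCdf
          (fun t => (tailMarginal F (kf + 1) (Function.update x kf t)).toReal) t))) := by
      intro t
      rw [ofReal_tailMarginal hF (k := (kf : ℕ) + 1) kf.2, knothe, condCdf_update]
      ring
    have h4 := lintegral_comp_lineCdf (continuous_tailMarginal_update hF kf x)
      (tailMarginal_update_pos hF kf x) (integrable_tailMarginal_update hF kf x)
      (fun u => h kf (lineQuantile (q kf) u))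
    have h5 := lintegral_comp_lineQuantile (hqc kf) (hqp kf) (hqi kf) (h kf)
    rw [hq1, ENNReal.ofReal_one, one_mul] at h5
    rw [← h5, ← tailMarginal_toReal_eq_integral hF, ofReal_tailMarginal hF kf.2.le] at h4
    simp only [h3]
    have hm1 := (continuous_tailMarginal_update hF kf x).measurable
    have hm2 : Measurable fun t : ℝ => h kf (lineQuantile (q kf) (lineCdf
          (fun t => (tailMarginal F (kf + 1) (Function.update x kf t)).toReal) t)) := by
      refine (hh kf).comp ((measurable_lineQuantile (hqc kf) (hqp kf) (hqi kf)).comp ?_)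
      exact (strictMono_lineCdf (continuous_tailMarginal_update hF kf x)
        (tailMarginal_update_pos hF kf x)
        (integrable_tailMarginal_update hF kf x)).monotone.measurable
    refine ((lintegral_const_mul _ (hm1.ennreal_ofReal.mul hm2)).trans
      (congrArg (P * C * ·) h4)).trans ?_
    ring

include hF hqc hqp hqi hq1 in
/-- Under `F`, the coordinates of the triangular rearrangement are independent with densities
`q k`. -/
lemma lintegral_prod_knothe {h : Fin n → ℝ → ℝ≥0∞} (hh : ∀ k, Measurable (h k)) :
    ∫⁻ x, ENNReal.ofReal (F x) * ∏ j, h j (knothe F q j x) =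
      (∫⁻ x, ENNReal.ofReal (F x)) * ∏ j, ∫⁻ s, ENNReal.ofReal (q j s) * h j s := by
  have h1 := lmarginal_knothe hF hqc hqp hqi hq1 hh n 0 (zero_add n) 0
  have h2 : (Finset.univ.filter fun j : Fin n => 0 ≤ (j : ℕ)) = Finset.univ := by
    ext j; simp
  have h3 : (Finset.univ.filter fun j : Fin n => (j : ℕ) < 0) = ∅ := by
    ext j; simp
  rw [h2, h3, lmarginal_univ, tailMarginal_zero, Finset.prod_empty, one_mul, mul_comm] at h1
  exact h1

end Knothe

/-! ### The target density in product form -/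

/-- The conditional densities `(1 + s²)^(-(n+k+1)/2)`, normalised, of the extremal density
`(1 + |y|²)^(-n)` on `ℝ^n`. -/
noncomputable def extremalNorm (n : ℕ) (k : ℕ) : ℝ :=
  √Real.pi * Real.Gamma (((n : ℝ) + k + 1) / 2 - 1 / 2) / Real.Gamma (((n : ℝ) + k + 1) / 2)

/-- Origin of the exponent: with y_k = s_k ∏_{j<k} √(1+s_j²), the factor (1+s_k²)^(-n) of
(1+|y|²)^(-n) meets (1+s_k²)^((n-1-k)/2) from the Jacobian; indices start at 0. -/
noncomputable def extremalDensity (n : ℕ) (k : Fin n) (s : ℝ) : ℝ :=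
  (1 + s ^ 2) ^ (-(((n : ℝ) + (k : ℕ) + 1) / 2)) / extremalNorm n k

section ExtremalDensity

variable {n : ℕ} (hn : 3 ≤ n)
include hn

lemma extremalNorm_pos (k : ℕ) : 0 < extremalNorm n k := by
  have hn' : (3 : ℝ) ≤ n := by exact_mod_cast hn
  have h1 : 0 < Real.Gamma (((n : ℝ) + k + 1) / 2 - 1 / 2) :=
    Real.Gamma_pos_of_pos (by have : (0 : ℝ) ≤ k := k.cast_nonneg; linarith)
  have h2 : 0 < Real.Gamma (((n : ℝ) + k + 1) / 2) := Real.Gamma_pos_of_pos (by positivity)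
  have := Real.pi_pos
  unfold extremalNorm
  positivity

omit hn in
lemma continuous_extremalDensity (k : Fin n) : Continuous (extremalDensity n k) := by
  unfold extremalDensity
  refine Continuous.div_const (Continuous.rpow_const (by fun_prop) fun s => ?_) _
  left
  positivity

lemma extremalDensity_pos (k : Fin n) (s : ℝ) : 0 < extremalDensity n k s :=
  div_pos (by positivity) (extremalNorm_pos hn k)

lemma lintegral_extremalDensity (k : Fin n) :
    ∫⁻ s, ENNReal.ofReal (extremalDensity n k s) = 1 := by
  have hn' : (3 : ℝ) ≤ n := by exact_mod_cast hn
  have hk : (0 : ℝ) ≤ (k : ℕ) := Nat.cast_nonneg _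
  have hI := extremalNorm_pos hn k
  simp only [extremalDensity, ENNReal.ofReal_div_of_pos hI]
  simp only [ENNReal.div_eq_inv_mul]
  rw [lintegral_const_mul' _ _ (by simpa using hI), lintegral_one_add_sq_rpow (by linarith)]
  exact ENNReal.inv_mul_cancel (by simpa using hI) ENNReal.ofReal_ne_top

lemma integrable_extremalDensity (k : Fin n) : Integrable (extremalDensity n k) := by
  refine ⟨(continuous_extremalDensity k).aestronglyMeasurable, ?_⟩
  rw [hasFiniteIntegral_iff_ofReal (Eventually.of_forall fun s => (extremalDensity_pos hn k s).le),
    lintegral_extremalDensity hn]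
  exact ENNReal.one_lt_top

lemma integral_extremalDensity (k : Fin n) : ∫ s, extremalDensity n k s = 1 := by
  rw [integral_eq_lintegral_of_nonneg_ae
    (Eventually.of_forall fun s => (extremalDensity_pos hn k s).le)
    (continuous_extremalDensity k).aestronglyMeasurable, lintegral_extremalDensity hn]
  simp

/-- The extra factor lowers the exponent by one, so this is a quotient of two beta integrals that
collapses by Γ(x+1) = xΓ(x). The quotient is written with consecutive terms so that the product over
k telescopes. -/
lemma lintegral_extremalDensity_mul (k : Fin n) :
    ∫⁻ s, ENNReal.ofReal (extremalDensity n k s) * ENNReal.ofReal (1 + s ^ 2) =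
      ENNReal.ofReal (((n : ℝ) + ((k : ℕ) + 1 : ℕ) - 2) / ((n : ℝ) + (k : ℕ) - 2)) := by
  have hn' : (3 : ℝ) ≤ n := by exact_mod_cast hn
  have hk : (0 : ℝ) ≤ (k : ℕ) := Nat.cast_nonneg _
  have hI := extremalNorm_pos hn k
  have h : ∀ s : ℝ, ENNReal.ofReal (extremalDensity n k s) * ENNReal.ofReal (1 + s ^ 2) =
      ENNReal.ofReal (extremalNorm n k)⁻¹ *
        ENNReal.ofReal ((1 + s ^ 2) ^ (-(((n : ℝ) + (k : ℕ) + 1) / 2 - 1))) := by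
    intro s
    have hs : 0 < 1 + s ^ 2 := by positivity
    rw [← ENNReal.ofReal_mul (extremalDensity_pos hn k s).le, ← ENNReal.ofReal_mul (by positivity),
      extremalDensity, neg_sub, show (1 : ℝ) - ((n : ℝ) + (k : ℕ) + 1) / 2 =
        -(((n : ℝ) + (k : ℕ) + 1) / 2) + 1 by ring, Real.rpow_add_one hs.ne']
    congr 1
    field_simp
  simp only [h]
  rw [lintegral_const_mul' _ _ ENNReal.ofReal_ne_top, lintegral_one_add_sq_rpow (by linarith),
    ← ENNReal.ofReal_mul (by positivity)]
  congr 1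
  have e1 : ((n : ℝ) + (k : ℕ) + 1) / 2 - 1 / 2 =
      (((n : ℝ) + (k : ℕ) + 1) / 2 - 1 - 1 / 2) + 1 := by ring
  have e2 : Real.Gamma (((n : ℝ) + (k : ℕ) + 1) / 2) =
      (((n : ℝ) + (k : ℕ) + 1) / 2 - 1) * Real.Gamma (((n : ℝ) + (k : ℕ) + 1) / 2 - 1) := by
    rw [← Real.Gamma_add_one (by linarith)]
    congr 1
    ring
  unfold extremalNorm
  rw [e1, Real.Gamma_add_one (by linarith), e2]
  have g1 : 0 < Real.Gamma (((n : ℝ) + (k : ℕ) + 1) / 2 - 1 - 1 / 2) :=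
    Real.Gamma_pos_of_pos (by linarith)
  have g2 : 0 < Real.Gamma (((n : ℝ) + (k : ℕ) + 1) / 2 - 1) :=
    Real.Gamma_pos_of_pos (by linarith)
  have hpi : 0 < √Real.pi := Real.sqrt_pos.2 Real.pi_pos
  have d1 : (n : ℝ) + (k : ℕ) - 2 ≠ 0 := by intro h; linarith
  have d2 : ((n : ℝ) + (k : ℕ) + 1) / 2 - 1 - 1 / 2 = ((n : ℝ) + (k : ℕ) - 2) / 2 := by ring
  have d3 : ((n : ℝ) + (k : ℕ) + 1) / 2 - 1 = ((n : ℝ) + ((k : ℕ) + 1 : ℕ) - 2) / 2 := by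
    push_cast; ring
  have d4 : ((n : ℝ) + ((k : ℕ) + 1 : ℕ) - 2) ≠ 0 := by push_cast; intro h; linarith
  rw [d2] at g1 ⊢
  rw [d3] at g2 ⊢
  field_simp

/-- The value is the mean of 1+|y|² under the normalised target. It equals the exponent 2(n-1)/(n-2)
of the Sobolev argument, and the two cancel there. -/
lemma prod_extremal_moments :
    ∏ k : Fin n, (((n : ℝ) + ((k : ℕ) + 1 : ℕ) - 2) / ((n : ℝ) + (k : ℕ) - 2)) =
      2 * ((n : ℝ) - 1) / ((n : ℝ) - 2) := by
  have hn' : (3 : ℝ) ≤ n := by exact_mod_cast hn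
  rw [Fin.prod_univ_eq_prod_range
    (fun k : ℕ => ((n : ℝ) + (k + 1 : ℕ) - 2) / ((n : ℝ) + (k : ℕ) - 2)) n]
  have h : ∀ m : ℕ, ∏ k ∈ Finset.range m, (((n : ℝ) + (k + 1 : ℕ) - 2) / ((n : ℝ) + k - 2)) =
      ((n : ℝ) + m - 2) / ((n : ℝ) - 2) := by
    intro m
    induction m with
    | zero =>
      have : (n : ℝ) - 2 ≠ 0 := by intro h; linarith
      simp [this]
    | succ m ih =>
      have h1 : (n : ℝ) - 2 ≠ 0 := by intro h; linarith
      have h2 : (n : ℝ) + m - 2 ≠ 0 := by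
        have : (0 : ℝ) ≤ m := m.cast_nonneg
        intro h; linarith
      rw [Finset.prod_range_succ, ih]
      field_simp
  rw [h]
  congr 1
  ring

/-- The product is the total mass of (1+|y|²)^(-n). The Gamma quotients telescope to π^(n/2)
Γ(n/2)/Γ(n), which the duplication formula identifies with the area of the sphere. -/
lemma prod_extremalNorm :
    ∏ k : Fin n, extremalNorm n k = unitSphereArea n / 2 ^ (n : ℝ) := by
  rw [Fin.prod_univ_eq_prod_range (fun k : ℕ => extremalNorm n k) n]
  have hn' : (3 : ℝ) ≤ n := by exact_mod_cast hn
  have h : ∀ m : ℕ, ∏ k ∈ Finset.range m, extremalNorm n k =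
      √Real.pi ^ m * Real.Gamma ((n : ℝ) / 2) / Real.Gamma (((n : ℝ) + m) / 2) := by
    intro m
    induction m with
    | zero =>
      have : Real.Gamma ((n : ℝ) / 2) ≠ 0 := (Real.Gamma_pos_of_pos (by linarith)).ne'
      simp [this]
    | succ m ih =>
      have : (0 : ℝ) ≤ m := m.cast_nonneg
      have h1 : Real.Gamma (((n : ℝ) + m) / 2) ≠ 0 := (Real.Gamma_pos_of_pos (by linarith)).ne'
      rw [Finset.prod_range_succ, ih, extremalNorm,
        show ((n : ℝ) + m + 1) / 2 - 1 / 2 = ((n : ℝ) + m) / 2 by ring]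
      push_cast
      rw [← add_assoc]
      field_simp
      ring
  rw [h, unitSphereArea_eq_Gamma (by omega), show ((n : ℝ) + n) / 2 = n by ring,
    Real.sqrt_eq_rpow, ← Real.rpow_natCast, ← Real.rpow_mul Real.pi_pos.le,
    show (1 : ℝ) / 2 * n = n / 2 by ring]
  have : (0 : ℝ) < 2 ^ (n : ℝ) := by positivity
  field_simp

end ExtremalDensity

/-! ### The transport map: Jacobian, divergence and moments -/

/-- Integration by parts on a line against an increasing function. -/
lemma lintegral_mul_deriv_le {g g' T T' : ℝ → ℝ} (hg : ∀ s, HasDerivAt g (g' s) s)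
    (hg' : Continuous g') (hgs : HasCompactSupport g) (hg0 : ∀ s, 0 ≤ g s)
    (hT : ∀ s, HasDerivAt T (T' s) s) (hT' : Continuous T') (hT0 : ∀ s, 0 ≤ T' s) :
    ∫⁻ s, ENNReal.ofReal (g s * T' s) ≤ ∫⁻ s, ENNReal.ofReal (|T s| * |g' s|) := by
  have hgc : Continuous g := continuous_iff_continuousAt.2 fun s => (hg s).continuousAt
  have hTc : Continuous T := continuous_iff_continuousAt.2 fun s => (hT s).continuousAt
  have hgs' : HasCompactSupport g' := by
    have : g' = deriv g := funext fun s => (hg s).deriv.symm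
    rw [this]
    exact hgs.deriv
  have i1 : Integrable (fun s => g s * T' s) :=
    (hgc.mul hT').integrable_of_hasCompactSupport hgs.mul_right
  have i2 : Integrable (fun s => g' s * T s) :=
    (hg'.mul hTc).integrable_of_hasCompactSupport hgs'.mul_right
  have i3 : Integrable (fun s => g s * T s) :=
    (hgc.mul hTc).integrable_of_hasCompactSupport hgs.mul_right
  have i4 : Integrable (fun s => |T s| * |g' s|) := by
    refine i2.norm.congr (Eventually.of_forall fun s => ?_)
    simp [mul_comm]
  rw [← ofReal_integral_eq_lintegral_ofReal i1
      (Eventually.of_forall fun s => mul_nonneg (hg0 s) (hT0 s)),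
    ← ofReal_integral_eq_lintegral_ofReal i4
      (Eventually.of_forall fun s => mul_nonneg (abs_nonneg _) (abs_nonneg _))]
  refine ENNReal.ofReal_le_ofReal ?_
  rw [integral_mul_deriv_eq_deriv_mul_of_integrable (fun s _ => hg s) (fun s _ => hT s) i1 i2 i3, ← integral_neg]
  refine integral_mono i2.neg i4 fun s => ?_
  rw [← abs_mul, mul_comm]
  exact neg_le_abs _

/-- The product is expanded according to the largest index at which s_k² is chosen; the left side is
1+|y|² for y_k = s_k ∏_{j<k} √(1+s_j²). -/
lemma sum_sq_mul_prod_one_add_sq {n : ℕ} (s : Fin n → ℝ) :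
    1 + ∑ k, (s k * ∏ j ∈ Finset.univ.filter (· < k), √(1 + s j ^ 2)) ^ 2 =
      ∏ k, (1 + s k ^ 2) := by
  rw [Finset.prod_add_ordered]
  simp only [Finset.prod_const_one, mul_one]
  congr 1
  refine Finset.sum_congr rfl fun k _ => ?_
  rw [mul_pow, ← Finset.prod_pow]
  congr 1
  refine Finset.prod_congr rfl fun j _ => ?_
  exact Real.sq_sqrt (by positivity)

/-- This is the Jacobian of s ↦ y: the factor with index j occurs once for each of the n-1-j indices
above j. -/
lemma prod_prod_lt {n : ℕ} (b : Fin n → ℝ) :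
    ∏ k, ∏ j ∈ Finset.univ.filter (· < k), b j = ∏ j : Fin n, b j ^ (n - 1 - (j : ℕ)) := by
  have h : ∏ k, ∏ j ∈ Finset.univ.filter (· < k), b j =
      ∏ j, ∏ k ∈ Finset.univ.filter (j < ·), b j := by
    refine Finset.prod_comm' ?_
    simp
  rw [h]
  refine Finset.prod_congr rfl fun j _ => ?_
  rw [Finset.prod_const]
  congr 1
  have : (Finset.univ.filter (j < ·)) = Finset.Ioi j := by ext; simp
  rw [this, Fin.card_Ioi]

lemma lintegral_ofReal_sqrt_mul_sqrt_le {α : Type*} [MeasurableSpace α] {μ : Measure α}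
    {A B : α → ℝ} (hA : Measurable A) (hB : Measurable B) :
    ∫⁻ x, ENNReal.ofReal (√(A x) * √(B x)) ∂μ ≤
      (∫⁻ x, ENNReal.ofReal (A x) ∂μ) ^ (1 / 2 : ℝ) *
        (∫⁻ x, ENNReal.ofReal (B x) ∂μ) ^ (1 / 2 : ℝ) := by
  have hp : ∀ y : ℝ, ENNReal.ofReal √y ^ (2 : ℝ) = ENNReal.ofReal y := by
    intro y
    rcases le_total 0 y with h | h
    · rw [ENNReal.ofReal_rpow_of_nonneg (Real.sqrt_nonneg _) (by norm_num), Real.rpow_two,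
        Real.sq_sqrt h]
    · rw [Real.sqrt_eq_zero_of_nonpos h, ENNReal.ofReal_of_nonpos h]
      simp
  have h := ENNReal.lintegral_mul_le_Lp_mul_Lq μ (p := 2) (q := 2) (by constructor <;> norm_num)
    (f := fun x => ENNReal.ofReal √(A x)) (g := fun x => ENNReal.ofReal √(B x))
    (by fun_prop) (by fun_prop)
  simp only [hp] at h
  refine le_trans (le_of_eq (lintegral_congr fun x => ?_)) h
  rw [Pi.mul_apply, ENNReal.ofReal_mul (Real.sqrt_nonneg _)]

/-- The triangular transport map from `F` to a multiple of `(1 + |y|²)^(-n)`. -/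
noncomputable def transportMap {n : ℕ} (F : (Fin n → ℝ) → ℝ) (k : Fin n) (x : Fin n → ℝ) : ℝ :=
  knothe F (extremalDensity n) k x *
    ∏ j ∈ Finset.univ.filter (· < k), √(1 + knothe F (extremalDensity n) j x ^ 2)

/-- The diagonal entries of the derivative of the transport map. -/
noncomputable def transportDeriv {n : ℕ} (F : (Fin n → ℝ) → ℝ) (k : Fin n) (x : Fin n → ℝ) : ℝ :=
  knotheDeriv F (extremalDensity n) k x *
    ∏ j ∈ Finset.univ.filter (· < k), √(1 + knothe F (extremalDensity n) j x ^ 2)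

section Transport

variable {n : ℕ} (hn : 3 ≤ n) {F : (Fin n → ℝ) → ℝ} (hF : IsGaussianBounded F)

lemma prod_knothe_update (k : Fin n) (x : Fin n → ℝ) (s : ℝ) :
    ∏ j ∈ Finset.univ.filter (· < k),
        √(1 + knothe F (extremalDensity n) j (Function.update x k s) ^ 2) =
      ∏ j ∈ Finset.univ.filter (· < k), √(1 + knothe F (extremalDensity n) j x ^ 2) := by
  refine Finset.prod_congr rfl fun j hj => ?_
  rw [knothe_update_of_lt (by simpa using hj)]

include hn hF

lemma hasDerivAt_transportMap (k : Fin n) (x : Fin n → ℝ) (s : ℝ) :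
    HasDerivAt (fun s => transportMap F k (Function.update x k s))
      (transportDeriv F k (Function.update x k s)) s := by
  simp only [transportMap, transportDeriv, prod_knothe_update]
  exact (hasDerivAt_knothe hF continuous_extremalDensity (extremalDensity_pos hn)
    (integrable_extremalDensity hn) (integral_extremalDensity hn) k x s).mul_const _

lemma continuous_transportDeriv_update (k : Fin n) (x : Fin n → ℝ) :
    Continuous (fun s => transportDeriv F k (Function.update x k s)) := by
  simp only [transportDeriv, prod_knothe_update]
  exact (continuous_knotheDeriv_update hF continuous_extremalDensity (extremalDensity_pos hn)
    (integrable_extremalDensity hn) (integral_extremalDensity hn) k x).mul_const _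

lemma transportDeriv_nonneg (k : Fin n) (x : Fin n → ℝ) : 0 ≤ transportDeriv F k x :=
  mul_nonneg (knotheDeriv_pos hF (extremalDensity_pos hn) k x).le
    (Finset.prod_nonneg fun _ _ => Real.sqrt_nonneg _)

lemma measurable_knothe_extremal (k : Fin n) : Measurable (knothe F (extremalDensity n) k) :=
  measurable_knothe hF continuous_extremalDensity (extremalDensity_pos hn)
    (integrable_extremalDensity hn) k

lemma measurable_transportMap (k : Fin n) : Measurable (transportMap F k) := by
  have := measurable_knothe_extremal hn hF
  unfold transportMap
  fun_prop

lemma measurable_transportDeriv (k : Fin n) : Measurable (transportDeriv F k) := by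
  have h1 := measurable_knothe_extremal hn hF
  have h2 := (continuous_tailMarginal hF (k := (k : ℕ) + 1) k.2).measurable
  have h3 := (continuous_tailMarginal hF (k := (k : ℕ)) k.2.le).measurable
  have h4 := (continuous_extremalDensity k).measurable
  unfold transportDeriv knotheDeriv
  exact ((h2.div h3).div (h4.comp (h1 k))).mul (by fun_prop)

/-- The Monge-Ampère equation of the transport: since DT is triangular, its diagonal product is the
Jacobian. In each variable the exponents (n+k+1)/2 from the density and (n-1-k)/2 from the
coordinates add up to n. -/
lemma prod_transportDeriv (x : Fin n → ℝ) :
    ∏ k, transportDeriv F k x =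
      F x / (∫⁻ y, ENNReal.ofReal (F y)).toReal * (unitSphereArea n / 2 ^ (n : ℝ)) *
        (∏ k, (1 + knothe F (extremalDensity n) k x ^ 2)) ^ (n : ℝ) := by
  simp only [transportDeriv, Finset.prod_mul_distrib]
  rw [prod_prod_lt (fun j => √(1 + knothe F (extremalDensity n) j x ^ 2)), prod_knotheDeriv hF,
    ← prod_extremalNorm hn, ← Real.finsetProd_rpow _ _ (fun k _ => by positivity)]
  rw [div_mul_eq_mul_div, mul_div_assoc, ← Finset.prod_div_distrib, mul_assoc,
    ← Finset.prod_mul_distrib]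
  congr 1
  refine Finset.prod_congr rfl fun k _ => ?_
  set s := knothe F (extremalDensity n) k x
  have hs : 0 < 1 + s ^ 2 := by positivity
  have hI := extremalNorm_pos hn k
  have hk : ((n - 1 - (k : ℕ) : ℕ) : ℝ) = n - 1 - (k : ℕ) := by
    have := k.2
    rw [Nat.cast_sub (by omega), Nat.cast_sub (by omega)]
    simp
  rw [Real.sqrt_eq_rpow, ← Real.rpow_natCast, ← Real.rpow_mul hs.le, hk, extremalDensity,
    div_div_eq_mul_div, mul_comm, mul_div_assoc, ← Real.rpow_sub hs]
  congr 2
  ring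

/-- AM-GM for the diagonal entries, that is, n (det DT)^(1/n) ≤ div T. -/
lemma card_mul_le_sum_transportDeriv (x : Fin n → ℝ) :
    n * ((F x / (∫⁻ y, ENNReal.ofReal (F y)).toReal *
        (unitSphereArea n / 2 ^ (n : ℝ))) ^ (1 / (n : ℝ)) *
        ∏ k, (1 + knothe F (extremalDensity n) k x ^ 2)) ≤ ∑ k, transportDeriv F k x := by
  have hn0 : (0 : ℝ) < n := by have : 0 < n := by omega
                               exact_mod_cast this
  have h := Real.geom_mean_le_arith_mean_weighted Finset.univ (fun _ : Fin n => 1 / (n : ℝ))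
    (fun k => transportDeriv F k x) (fun _ _ => by positivity)
    (by simp [hn0.ne']) (fun k _ => transportDeriv_nonneg hn hF k x)
  rw [Real.finsetProd_rpow _ _ (fun k _ => transportDeriv_nonneg hn hF k x),
    prod_transportDeriv hn hF, ← Finset.mul_sum] at h
  have hP : 0 ≤ ∏ k, (1 + knothe F (extremalDensity n) k x ^ 2) :=
    Finset.prod_nonneg fun _ _ => by positivity
  have hA : 0 ≤ F x / (∫⁻ y, ENNReal.ofReal (F y)).toReal * (unitSphereArea n / 2 ^ (n : ℝ)) := by
    have := (hF.pos x).le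
    have := (unitSphereArea_pos (N := n)).le
    positivity
  rw [Real.mul_rpow hA (by positivity), ← Real.rpow_mul hP, mul_one_div_cancel hn0.ne',
    Real.rpow_one] at h
  calc _ ≤ n * (1 / (n : ℝ) * ∑ k, transportDeriv F k x) := by gcongr
    _ = _ := by field_simp

/-- Integration by parts for the transport map in all coordinate directions. -/
lemma lintegral_mul_sum_transportDeriv_le {φ : (Fin n → ℝ) → ℝ} {φ' : Fin n → (Fin n → ℝ) → ℝ}
    (hφ : ∀ k x s, HasDerivAt (fun s => φ (Function.update x k s))
      (φ' k (Function.update x k s)) s)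
    (hφ' : ∀ k, Continuous (φ' k)) (hφc : Continuous φ) (hφs : HasCompactSupport φ)
    (hφ0 : ∀ x, 0 ≤ φ x) :
    ∫⁻ x, ENNReal.ofReal (φ x * ∑ k, transportDeriv F k x) ≤
      ∫⁻ x, ENNReal.ofReal (∑ k, |transportMap F k x| * |φ' k x|) := by
  have hm1 := fun k => measurable_transportDeriv hn hF k
  have hm2 := fun k => measurable_transportMap hn hF k
  have hm3 := fun k => (hφ' k).measurable
  have hm4 := hφc.measurable
  have h1 : ∀ x, ENNReal.ofReal (φ x * ∑ k, transportDeriv F k x) =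
      ∑ k, ENNReal.ofReal (φ x * transportDeriv F k x) := by
    intro x
    rw [Finset.mul_sum, ENNReal.ofReal_sum_of_nonneg]
    exact fun k _ => mul_nonneg (hφ0 x) (transportDeriv_nonneg hn hF k x)
  have h2 : ∀ x, ENNReal.ofReal (∑ k, |transportMap F k x| * |φ' k x|) =
      ∑ k, ENNReal.ofReal (|transportMap F k x| * |φ' k x|) := by
    intro x
    rw [ENNReal.ofReal_sum_of_nonneg]
    exact fun k _ => by positivity
  simp only [h1, h2]
  rw [lintegral_finsetSum _ (fun k _ => by fun_prop), lintegral_finsetSum _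
    (fun k _ => by fun_prop)]
  refine Finset.sum_le_sum fun k _ => ?_
  -- It suffices to compare the integrals on each line in direction k, where T_k is continuously
  -- differentiable.
  refine lintegral_le_of_lmarginal_le {k} (by fun_prop) (by fun_prop) ?_
  rw [lmarginal_singleton, lmarginal_singleton]
  intro x
  refine lintegral_mul_deriv_le (hφ k x) ((hφ' k).comp (by fun_prop)) ?_ (fun _ => hφ0 _)
    (hasDerivAt_transportMap hn hF k x) (continuous_transportDeriv_update hn hF k x)
    (fun _ => transportDeriv_nonneg hn hF k _)
  refine HasCompactSupport.intro (hφs.isCompact.image (continuous_apply k)) fun s hs => ?_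
  by_contra hne
  exact hs ⟨Function.update x k s, subset_tsupport _ hne, by simp⟩

lemma lintegral_mul_prod_knothe :
    ∫⁻ x, ENNReal.ofReal (F x) *
        ENNReal.ofReal (∏ k, (1 + knothe F (extremalDensity n) k x ^ 2)) =
      (∫⁻ x, ENNReal.ofReal (F x)) * ENNReal.ofReal (2 * ((n : ℝ) - 1) / ((n : ℝ) - 2)) := by
  have h := lintegral_prod_knothe hF continuous_extremalDensity (extremalDensity_pos hn)
    (integrable_extremalDensity hn) (integral_extremalDensity hn)
    (h := fun _ s => ENNReal.ofReal (1 + s ^ 2)) (fun _ => by fun_prop)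
  simp only [lintegral_extremalDensity_mul hn] at h
  have hn' : (3 : ℝ) ≤ n := by exact_mod_cast hn
  rw [← ENNReal.ofReal_prod_of_nonneg (fun k _ => by
      have hk : (0 : ℝ) ≤ (k : ℕ) := Nat.cast_nonneg _
      push_cast
      exact div_nonneg (by linarith) (by linarith)), prod_extremal_moments hn] at h
  rw [← h]
  refine lintegral_congr fun x => ?_
  rw [ENNReal.ofReal_prod_of_nonneg (fun k _ => by positivity)]

/-- Subtract the mass of F from the mean of 1+|T|² = ∏(1+s_k²); the mass has to be finite to be
cancelled. -/
lemma lintegral_mul_sum_transportMap_sq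
    (hfin : ∫⁻ x, ENNReal.ofReal (F x) ≠ ⊤) :
    ∫⁻ x, ENNReal.ofReal (F x * ∑ k, transportMap F k x ^ 2) =
      (∫⁻ x, ENNReal.ofReal (F x)) * ENNReal.ofReal ((n : ℝ) / ((n : ℝ) - 2)) := by
  have hn' : (3 : ℝ) ≤ n := by exact_mod_cast hn
  have hmF := hF.cont.measurable
  have hm2 := fun k => measurable_transportMap hn hF k
  have h := lintegral_mul_prod_knothe hn hF
  have h1 : ∀ x, ENNReal.ofReal (F x) *
      ENNReal.ofReal (∏ k, (1 + knothe F (extremalDensity n) k x ^ 2)) =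
      ENNReal.ofReal (F x) + ENNReal.ofReal (F x * ∑ k, transportMap F k x ^ 2) := by
    intro x
    have hFx := (hF.pos x).le
    rw [← sum_sq_mul_prod_one_add_sq, ← ENNReal.ofReal_mul hFx,
      ← ENNReal.ofReal_add hFx (mul_nonneg hFx (Finset.sum_nonneg fun _ _ => sq_nonneg _))]
    congr 1
    simp only [transportMap]
    ring
  simp only [h1] at h
  rw [lintegral_add_left (by fun_prop)] at h
  have h2 : ENNReal.ofReal (2 * ((n : ℝ) - 1) / ((n : ℝ) - 2)) =
      1 + ENNReal.ofReal ((n : ℝ) / ((n : ℝ) - 2)) := by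
    rw [← ENNReal.ofReal_one, ← ENNReal.ofReal_add zero_le_one
      (div_nonneg (by linarith) (by linarith))]
    congr 1
    have : (n : ℝ) - 2 ≠ 0 := by intro h; linarith
    field_simp
    ring
  rw [h2, mul_add, mul_one] at h
  exact (ENNReal.add_right_inj hfin).1 h

end Transport

/-! ### The sharp Sobolev inequality by mass transport -/

section SharpSobolev

variable {n : ℕ}

lemma integrable_prod_exp_neg_sq :
    Integrable (fun x : Fin n → ℝ => ∏ j, Real.exp (-(x j) ^ 2)) :=
  Integrable.fintype_prod (f := fun (_ : Fin n) (t : ℝ) => Real.exp (-t ^ 2))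
    fun _ => integrable_exp_neg_sq

/-- A compactly supported density has zeros, where the conditional laws degenerate; a small Gaussian
restores positivity and keeps the decay bound. -/
lemma isGaussianBounded_add {F₀ : (Fin n → ℝ) → ℝ} (hc : Continuous F₀) (hs : HasCompactSupport F₀)
    (h0 : ∀ x, 0 ≤ F₀ x) {ε : ℝ} (hε : 0 < ε) :
    IsGaussianBounded fun x => F₀ x + ε * ∏ j, Real.exp (-(x j) ^ 2) := by
  have hρ : ∀ x : Fin n → ℝ, 0 < ∏ j, Real.exp (-(x j) ^ 2) := fun x =>
    Finset.prod_pos fun j _ => Real.exp_pos _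
  have hρc : Continuous fun x : Fin n → ℝ => ∏ j, Real.exp (-(x j) ^ 2) := by fun_prop
  refine ⟨by fun_prop, fun x => add_pos_of_nonneg_of_pos (h0 x) (mul_pos hε (hρ x)), ?_⟩
  have h1 : Continuous fun x => F₀ x * (∏ j, Real.exp (-(x j) ^ 2))⁻¹ :=
    hc.mul (hρc.inv₀ fun x => (hρ x).ne')
  obtain ⟨C, hC⟩ := h1.bounded_above_of_compact_support (hs.mul_right)
  refine ⟨C + ε, fun x => ?_⟩
  have h2 := (le_abs_self _).trans (hC x)
  rw [← div_eq_mul_inv, div_le_iff₀ (hρ x)] at h2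
  rw [add_mul]
  linarith

/-- The truncated moments of the extremal densities. -/
noncomputable def truncMoment (n : ℕ) (K : ℕ) (k : Fin n) : ℝ≥0∞ :=
  ∫⁻ s, ENNReal.ofReal (extremalDensity n k s) * ENNReal.ofReal (min (1 + s ^ 2) K)

lemma tendsto_truncMoment (hn : 3 ≤ n) (k : Fin n) :
    Tendsto (fun K => truncMoment n K k) atTop
      (𝓝 (ENNReal.ofReal (((n : ℝ) + ((k : ℕ) + 1 : ℕ) - 2) / ((n : ℝ) + (k : ℕ) - 2)))) := by
  rw [← lintegral_extremalDensity_mul hn]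
  have hq := (continuous_extremalDensity k).measurable
  refine lintegral_tendsto_of_tendsto_of_monotone (fun K => by fun_prop) ?_ ?_
  · refine Eventually.of_forall fun s K K' h => ?_
    dsimp only
    gcongr
  · refine Eventually.of_forall fun s => tendsto_const_nhds.congr' ?_
    obtain ⟨K₀, hK₀⟩ := exists_nat_ge (1 + s ^ 2)
    filter_upwards [eventually_ge_atTop K₀] with K hK
    rw [min_eq_left (hK₀.trans (by exact_mod_cast hK))]

lemma truncMoment_ne_top (hn : 3 ≤ n) (K : ℕ) (k : Fin n) : truncMoment n K k ≠ ⊤ := by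
  refine ne_top_of_le_ne_top ?_ (lintegral_mono (g := fun s =>
    ENNReal.ofReal (extremalDensity n k s) * ENNReal.ofReal (1 + s ^ 2)) fun s => ?_)
  · rw [lintegral_extremalDensity_mul hn]
    exact ENNReal.ofReal_ne_top
  · dsimp only
    gcongr
    exact min_le_left _ _

lemma tendsto_prod_truncMoment (hn : 3 ≤ n) :
    Tendsto (fun K => ∏ k, (truncMoment n K k).toReal) atTop
      (𝓝 (2 * ((n : ℝ) - 1) / ((n : ℝ) - 2))) := by
  rw [← prod_extremal_moments hn]
  refine tendsto_finsetProd _ fun k _ => ?_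
  have h := (ENNReal.tendsto_toReal ENNReal.ofReal_ne_top).comp (tendsto_truncMoment hn k)
  rwa [ENNReal.toReal_ofReal] at h
  have hn' : (3 : ℝ) ≤ n := by exact_mod_cast hn
  have hk : (0 : ℝ) ≤ (k : ℕ) := Nat.cast_nonneg _
  push_cast
  exact div_nonneg (by linarith) (by linarith)

/-- The map transports F₀+ρ, while the moment of F₀ alone is wanted. Truncation at K makes the share
of ρ at most K^n ∫ρ, which vanishes with ρ for fixed K. -/
lemma trunc_moment_le (hn : 3 ≤ n) {F₀ ρ : (Fin n → ℝ) → ℝ} (h0 : ∀ x, 0 ≤ F₀ x)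
    (hm0 : Measurable F₀) (hmρ : Measurable ρ) (hρ : ∀ x, 0 ≤ ρ x)
    (hF : IsGaussianBounded fun x => F₀ x + ρ x) (K : ℕ) :
    (∫⁻ x, ENNReal.ofReal (F₀ x + ρ x)) * ∏ k, truncMoment n K k ≤
      (∫⁻ x, ENNReal.ofReal (F₀ x * ∏ k, (1 + knothe (fun x => F₀ x + ρ x)
        (extremalDensity n) k x ^ 2))) +
      (∫⁻ x, ENNReal.ofReal (ρ x)) * (K : ℝ≥0∞) ^ n := by
  have hmk := measurable_knothe_extremal hn hF
  have h := lintegral_prod_knothe hF continuous_extremalDensity (extremalDensity_pos hn)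
    (integrable_extremalDensity hn) (integral_extremalDensity hn)
    (h := fun _ s => ENNReal.ofReal (min (1 + s ^ 2) K)) (fun _ => by fun_prop)
  unfold truncMoment
  rw [← h, ← lintegral_mul_const _ (by fun_prop), ← lintegral_add_left (by fun_prop)]
  refine lintegral_mono fun x => ?_
  rw [ENNReal.ofReal_add (h0 x) (hρ x), add_mul, ENNReal.ofReal_mul (h0 x),
    ENNReal.ofReal_prod_of_nonneg (fun k _ => by positivity)]
  gcongr
  · exact min_le_left _ _
  · refine (Finset.prod_le_prod' (g := fun _ => (K : ℝ≥0∞)) fun k _ => ?_).trans_eq (by simp)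
    refine (ENNReal.ofReal_le_ofReal (min_le_right _ _)).trans_eq (by simp)

variable {u : (Fin n → ℝ) → ℝ}

lemma hasDerivAt_comp_update (hu : ContDiff ℝ 1 u) (k : Fin n) (x : Fin n → ℝ) (s : ℝ) :
    HasDerivAt (fun s => u (Function.update x k s))
      (fderiv ℝ u (Function.update x k s) (Pi.single k 1)) s :=
  ((hu.differentiable one_ne_zero) _).hasFDerivAt.comp_hasDerivAt s (hasDerivAt_update x k s)

/-- The mass transport estimate behind the sharp Sobolev inequality. -/
lemma transport_estimate (hn : 3 ≤ n) (hu : ContDiff ℝ 1 u) (hs : HasCompactSupport u)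
    {F : (Fin n → ℝ) → ℝ} (hF : IsGaussianBounded F) {m : ℝ} (hm : 0 < m)
    (hmF : ∫⁻ x, ENNReal.ofReal (F x) = ENNReal.ofReal m)
    (hle : ∀ x, |u x| ^ (2 * (n : ℝ) / ((n : ℝ) - 2)) ≤ F x) :
    ENNReal.ofReal (n * (unitSphereArea n / 2 ^ (n : ℝ) / m) ^ (1 / (n : ℝ))) *
      ∫⁻ x, ENNReal.ofReal (|u x| ^ (2 * (n : ℝ) / ((n : ℝ) - 2)) *
        ∏ k, (1 + knothe F (extremalDensity n) k x ^ 2)) ≤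
    ENNReal.ofReal (2 * ((n : ℝ) - 1) / ((n : ℝ) - 2)) *
      (ENNReal.ofReal (m * ((n : ℝ) / ((n : ℝ) - 2))) ^ (1 / 2 : ℝ) *
      (∫⁻ x, ENNReal.ofReal (∑ k, fderiv ℝ u x (Pi.single k 1) ^ 2)) ^ (1 / 2 : ℝ)) := by
  have hn' : (3 : ℝ) ≤ n := by exact_mod_cast hn
  have hn2 : (n : ℝ) - 2 ≠ 0 := by intro h; linarith
  set p : ℝ := 2 * (n : ℝ) / ((n : ℝ) - 2) with hp
  set a : ℝ := 2 * ((n : ℝ) - 1) / ((n : ℝ) - 2) with ha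
  set Z : ℝ := unitSphereArea n / 2 ^ (n : ℝ) with hZ
  have hZpos : 0 < Z := div_pos unitSphereArea_pos (by positivity)
  -- These relations dictate the exponent a: the gradient of |u|^a carries |u|^(p/2), which pairs
  -- with √F in Cauchy-Schwarz, while |u|^a times the n-th root of |u|^p restores |u|^p.
  have hp2 : a - 1 = p / 2 := by rw [ha, hp]; field_simp; ring
  have hap : a + p * (1 / (n : ℝ)) = p := by
    have : (n : ℝ) ≠ 0 := by intro h; linarith
    rw [ha, hp]; field_simp; ring
  have ha2 : 2 < a := by
    rw [ha, lt_div_iff₀ (by linarith)]; linarith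
  have hp0 : 0 < p := by rw [hp]; exact div_pos (by linarith) (by linarith)
  have hmm : (∫⁻ y, ENNReal.ofReal (F y)).toReal = m := by
    rw [hmF, ENNReal.toReal_ofReal hm.le]
  have huc := hu.continuous
  have hdc : ∀ k, Continuous fun x => fderiv ℝ u x (Pi.single k 1) := fun k =>
    (hu.continuous_fderiv one_ne_zero).clm_apply continuous_const
  have hmT := fun k => measurable_transportMap hn hF k
  have hmk := measurable_knothe_extremal hn hF
  set φ : (Fin n → ℝ) → ℝ := fun x => |u x| ^ a with hφ
  set φ' : Fin n → (Fin n → ℝ) → ℝ := fun k x =>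
    (a * |u x| ^ (a - 2) * u x) * fderiv ℝ u x (Pi.single k 1) with hφ'
  have hφc : Continuous φ := by
    rw [hφ]
    exact huc.abs.rpow_const fun x => Or.inr (by linarith)
  have hφ'c : ∀ k, Continuous (φ' k) := fun k => by
    refine Continuous.mul (Continuous.mul (continuous_const.mul ?_) huc) (hdc k)
    exact huc.abs.rpow_const fun x => Or.inr (by linarith)
  have hφs : HasCompactSupport φ := by
    refine hs.comp_left (g := fun y : ℝ => |y| ^ a) ?_
    simp only [abs_zero]
    exact Real.zero_rpow (by linarith)
  have h1 := lintegral_mul_sum_transportDeriv_le hn hF (φ := φ) (φ' := φ')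
    (fun k x s => (hasDerivAt_abs_rpow _ (by linarith)).comp s (hasDerivAt_comp_update hu k x s))
    hφ'c hφc hφs (fun x => by positivity)
  have h2 : ∀ x, ENNReal.ofReal (n * (Z / m) ^ (1 / (n : ℝ))) *
      ENNReal.ofReal (|u x| ^ p * ∏ k, (1 + knothe F (extremalDensity n) k x ^ 2)) ≤
      ENNReal.ofReal (φ x * ∑ k, transportDeriv F k x) := by
    intro x
    rw [← ENNReal.ofReal_mul (by positivity)]
    refine ENNReal.ofReal_le_ofReal ?_
    have h3 := card_mul_le_sum_transportDeriv hn hF x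
    rw [hmm, ← hZ] at h3
    have hP : 0 ≤ ∏ k, (1 + knothe F (extremalDensity n) k x ^ 2) :=
      Finset.prod_nonneg fun _ _ => by positivity
    refine le_trans ?_ (mul_le_mul_of_nonneg_left h3 (by positivity : 0 ≤ φ x))
    -- Only |u|^p ≤ F is used, so the added Gaussian does no harm here.
    have h4 : |u x| ^ p * (Z / m) ^ (1 / (n : ℝ)) ≤ φ x * (F x / m * Z) ^ (1 / (n : ℝ)) := by
      have e1 : |u x| ^ p = |u x| ^ a * (|u x| ^ p) ^ (1 / (n : ℝ)) := by
        rw [← Real.rpow_mul (abs_nonneg _), ← Real.rpow_add_of_nonneg (abs_nonneg _)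
          (by linarith) (by positivity), hap]
      have e2 : F x / m * Z = F x * (Z / m) := by ring
      rw [e2, Real.mul_rpow (hF.pos x).le (by positivity), e1, mul_assoc]
      gcongr
      exact hle x
    calc n * (Z / m) ^ (1 / (n : ℝ)) *
          (|u x| ^ p * ∏ k, (1 + knothe F (extremalDensity n) k x ^ 2))
        = n * ((|u x| ^ p * (Z / m) ^ (1 / (n : ℝ))) *
          ∏ k, (1 + knothe F (extremalDensity n) k x ^ 2)) := by ring
      _ ≤ n * ((φ x * (F x / m * Z) ^ (1 / (n : ℝ))) *
          ∏ k, (1 + knothe F (extremalDensity n) k x ^ 2)) := by gcongr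
      _ = _ := by ring
  have h5 : ∀ x, ∑ k, |transportMap F k x| * |φ' k x| ≤
      a * (√(F x * ∑ k, transportMap F k x ^ 2) * √(∑ k, fderiv ℝ u x (Pi.single k 1) ^ 2)) := by
    intro x
    have e1 : ∀ k, |φ' k x| = a * |u x| ^ (p / 2) * |fderiv ℝ u x (Pi.single k 1)| := by
      intro k
      rw [hφ']
      simp only [abs_mul]
      rw [abs_of_pos (by linarith : 0 < a), abs_of_nonneg (by positivity : 0 ≤ |u x| ^ (a - 2)),
        mul_assoc a, ← hp2, show a - 1 = (a - 2) + 1 by ring,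
        Real.rpow_add_of_nonneg (abs_nonneg _) (by linarith) zero_le_one, Real.rpow_one]
    have e2 : ∑ k, |transportMap F k x| * |φ' k x| =
        a * (|u x| ^ (p / 2) *
          ∑ k, |transportMap F k x| * |fderiv ℝ u x (Pi.single k 1)|) := by
      rw [Finset.mul_sum, Finset.mul_sum]
      refine Finset.sum_congr rfl fun k _ => ?_
      rw [e1]; ring
    have e3 := Real.sum_mul_le_sqrt_mul_sqrt Finset.univ (fun k => |transportMap F k x|)
      (fun k => |fderiv ℝ u x (Pi.single k 1)|)
    simp only [sq_abs] at e3
    have e4 : |u x| ^ (p / 2) ≤ √(F x) := by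
      refine Real.le_sqrt_of_sq_le ((le_of_eq ?_).trans (hle x))
      rw [← Real.rpow_natCast, ← Real.rpow_mul (abs_nonneg _)]
      norm_num
    rw [e2, Real.sqrt_mul (hF.pos x).le, mul_assoc]
    gcongr
  calc _ = ∫⁻ x, ENNReal.ofReal (n * (Z / m) ^ (1 / (n : ℝ))) *
        ENNReal.ofReal (|u x| ^ p * ∏ k, (1 + knothe F (extremalDensity n) k x ^ 2)) := by
        rw [lintegral_const_mul' _ _ ENNReal.ofReal_ne_top]
    _ ≤ ∫⁻ x, ENNReal.ofReal (φ x * ∑ k, transportDeriv F k x) := lintegral_mono h2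
    _ ≤ _ := h1
    _ ≤ ∫⁻ x, ENNReal.ofReal a * ENNReal.ofReal (√(F x * ∑ k, transportMap F k x ^ 2) *
        √(∑ k, fderiv ℝ u x (Pi.single k 1) ^ 2)) := by
        refine lintegral_mono fun x => ?_
        rw [← ENNReal.ofReal_mul (by linarith)]
        exact ENNReal.ofReal_le_ofReal (h5 x)
    _ ≤ _ := by
        rw [lintegral_const_mul' _ _ ENNReal.ofReal_ne_top]
        gcongr
        have hmF' := hF.cont.measurable
        have hmd := fun k => (hdc k).measurable
        refine (lintegral_ofReal_sqrt_mul_sqrt_le (by fun_prop) (by fun_prop)).trans_eq ?_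
        rw [lintegral_mul_sum_transportMap_sq hn hF (by rw [hmF]; exact ENNReal.ofReal_ne_top),
          hmF, ← ENNReal.ofReal_mul hm.le]

/-- The sharp Sobolev inequality in coordinates. -/
theorem sharp_sobolev_pi (hn : 3 ≤ n) (hu : ContDiff ℝ 1 u) (hs : HasCompactSupport u) :
    ENNReal.ofReal (sobolevConst n) *
      (∫⁻ x, ENNReal.ofReal (|u x| ^ (2 * (n : ℝ) / ((n : ℝ) - 2)))) ^
        (((n : ℝ) - 2) / (n : ℝ)) ≤
      ∫⁻ x, ENNReal.ofReal (∑ k, fderiv ℝ u x (Pi.single k 1) ^ 2) := by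
  have hn' : (3 : ℝ) ≤ n := by exact_mod_cast hn
  have hn0 : (n : ℝ) ≠ 0 := by intro h; linarith
  have hn2 : (n : ℝ) - 2 ≠ 0 := by intro h; linarith
  set p : ℝ := 2 * (n : ℝ) / ((n : ℝ) - 2) with hp
  set a : ℝ := 2 * ((n : ℝ) - 1) / ((n : ℝ) - 2) with ha
  have ha0 : 0 < a := div_pos (by linarith) (by linarith)
  set Z : ℝ := unitSphereArea n / 2 ^ (n : ℝ) with hZ
  have hZpos : 0 < Z := div_pos unitSphereArea_pos (by positivity)
  have hp0 : 0 < p := by rw [hp]; exact div_pos (by linarith) (by linarith)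
  have hdc : ∀ k, Continuous fun x => fderiv ℝ u x (Pi.single k 1) := fun k =>
    (hu.continuous_fderiv one_ne_zero).clm_apply continuous_const
  have hF₀c : Continuous fun x => |u x| ^ p := hu.continuous.abs.rpow_const fun x => Or.inr hp0.le
  have hF₀s : HasCompactSupport fun x => |u x| ^ p := by
    refine hs.comp_left (g := fun y : ℝ => |y| ^ p) ?_
    simp only [abs_zero]
    exact Real.zero_rpow hp0.ne'
  have hF₀i : Integrable (fun x => |u x| ^ p) volume :=
    hF₀c.integrable_of_hasCompactSupport hF₀s
  have hF₀n : ∀ x, 0 ≤ |u x| ^ p := fun x => by positivity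
  set m₀ : ℝ := ∫ x, |u x| ^ p with hm₀
  have hm₀e : ∫⁻ x, ENNReal.ofReal (|u x| ^ p) = ENNReal.ofReal m₀ :=
    (ofReal_integral_eq_lintegral_ofReal hF₀i (Eventually.of_forall hF₀n)).symm
  have hm₀0 : 0 ≤ m₀ := integral_nonneg hF₀n
  rcases hm₀0.eq_or_lt with h0 | hm₀pos
  · rw [hm₀e, ← h0, ENNReal.ofReal_zero, ENNReal.zero_rpow_of_pos
      (div_pos (by linarith) (by linarith)), mul_zero]
    exact zero_le
  set Γ : (Fin n → ℝ) → ℝ := fun x => ∏ j, Real.exp (-(x j) ^ 2) with hΓ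
  have hΓi : Integrable Γ := integrable_prod_exp_neg_sq
  have hΓ0 : ∀ x, 0 ≤ Γ x := fun x => Finset.prod_nonneg fun _ _ => (Real.exp_pos _).le
  set r : ℝ := ∫ x, Γ x with hr
  have hr0 : 0 ≤ r := integral_nonneg hΓ0
  set D : (Fin n → ℝ) → ℝ := fun x => ∑ k, fderiv ℝ u x (Pi.single k 1) ^ 2 with hD
  have hD0 : ∀ x, 0 ≤ D x := fun x => Finset.sum_nonneg fun _ _ => sq_nonneg _
  have hDi : Integrable D := by
    refine Continuous.integrable_of_hasCompactSupport (by fun_prop) ?_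
    refine (hs.fderiv (𝕜 := ℝ)).comp_left
      (g := fun L : (Fin n → ℝ) →L[ℝ] ℝ => ∑ k, L (Pi.single k 1) ^ 2) ?_
    simp
  set G : ℝ := ∫ x, D x with hG
  have hG0 : 0 ≤ G := integral_nonneg hD0
  have hGe : ∫⁻ x, ENNReal.ofReal (D x) = ENNReal.ofReal G :=
    (ofReal_integral_eq_lintegral_ofReal hDi (Eventually.of_forall hD0)).symm
  set M : ℕ → ℝ := fun K => ∏ k, (truncMoment n K k).toReal with hM
  have hM0 : ∀ K, 0 ≤ M K := fun K => Finset.prod_nonneg fun _ _ => ENNReal.toReal_nonneg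
  have hMe : ∀ K, ∏ k, truncMoment n K k = ENNReal.ofReal (M K) := fun K => by
    rw [hM, ENNReal.ofReal_prod_of_nonneg fun _ _ => ENNReal.toReal_nonneg]
    exact Finset.prod_congr rfl fun k _ => (ENNReal.ofReal_toReal (truncMoment_ne_top hn K k)).symm
  -- The transport estimate for |u|^p + εΓ with its moment bounded below by the truncated one; the
  -- last summand pays for the Gaussian part.
  have key : ∀ (K : ℕ) (ε : ℝ), 0 < ε →
      n * (Z / (m₀ + ε * r)) ^ (1 / (n : ℝ)) * ((m₀ + ε * r) * M K) ≤
      a * (((m₀ + ε * r) * ((n : ℝ) / ((n : ℝ) - 2))) ^ (1 / 2 : ℝ) * G ^ (1 / 2 : ℝ)) +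
      n * (Z / (m₀ + ε * r)) ^ (1 / (n : ℝ)) * (ε * r * (K : ℝ) ^ n) := by
    intro K ε hε
    set m : ℝ := m₀ + ε * r with hm
    have hm0 : 0 < m := by positivity
    have hF := isGaussianBounded_add hF₀c hF₀s hF₀n hε
    have hmF : ∫⁻ x, ENNReal.ofReal (|u x| ^ p + ε * Γ x) = ENNReal.ofReal m := by
      refine (ofReal_integral_eq_lintegral_ofReal (hF₀i.add (hΓi.const_mul ε))
        (Eventually.of_forall fun x => (hF.pos x).le)).symm.trans ?_
      rw [integral_add' hF₀i (hΓi.const_mul ε), integral_const_mul]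
    have h1 := transport_estimate hn hu hs hF hm0 hmF (fun x =>
      le_add_of_nonneg_right (mul_nonneg hε.le (hΓ0 x)))
    have h2 := trunc_moment_le hn hF₀n hF₀c.measurable (ρ := fun x => ε * Γ x)
      (by fun_prop) (fun x => mul_nonneg hε.le (hΓ0 x)) hF K
    have h3 : ∫⁻ x, ENNReal.ofReal (ε * Γ x) = ENNReal.ofReal (ε * r) := by
      rw [← ofReal_integral_eq_lintegral_ofReal (hΓi.const_mul ε)
        (Eventually.of_forall fun x => mul_nonneg hε.le (hΓ0 x)), integral_const_mul]
    rw [hmF, h3, hMe] at h2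
    rw [hGe] at h1
    have h4 := mul_le_mul_right h2 (ENNReal.ofReal (n * (Z / m) ^ (1 / (n : ℝ))))
    rw [mul_add] at h4
    replace h4 := h4.trans (add_le_add h1 le_rfl)
    have e1 : (0 : ℝ) ≤ m * ((n : ℝ) / ((n : ℝ) - 2)) :=
      mul_nonneg hm0.le (div_nonneg (by linarith) (by linarith))
    have hKn : ((K : ℝ≥0∞)) ^ n = ENNReal.ofReal ((K : ℝ) ^ n) := by
      rw [ENNReal.ofReal_pow (by positivity), ENNReal.ofReal_natCast]
    rw [ENNReal.ofReal_rpow_of_nonneg e1 (by norm_num),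
      ENNReal.ofReal_rpow_of_nonneg hG0 (by norm_num), hKn,
      ← ENNReal.ofReal_mul (by positivity), ← ENNReal.ofReal_mul (by positivity),
      ← ENNReal.ofReal_mul (by positivity), ← ENNReal.ofReal_mul (by positivity),
      ← ENNReal.ofReal_mul (by positivity), ← ENNReal.ofReal_mul (by positivity),
      ← ENNReal.ofReal_add (by positivity) (by positivity)] at h4
    exact (ENNReal.ofReal_le_ofReal_iff (by positivity)).1 h4
  -- First ε → 0 with K fixed: the error ε r K^n disappears.
  have key2 : ∀ K : ℕ, n * (Z / m₀) ^ (1 / (n : ℝ)) * (m₀ * M K) ≤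
      a * ((m₀ * ((n : ℝ) / ((n : ℝ) - 2))) ^ (1 / 2 : ℝ) * G ^ (1 / 2 : ℝ)) := by
    intro K
    have hc : Tendsto (fun ε : ℝ => m₀ + ε * r) (𝓝[>] 0) (𝓝 m₀) := by
      have : Tendsto (fun ε : ℝ => m₀ + ε * r) (𝓝 0) (𝓝 (m₀ + 0 * r)) :=
        (Continuous.tendsto (by fun_prop) _)
      rw [zero_mul, add_zero] at this
      exact this.mono_left nhdsWithin_le_nhds
    have hc1 : Tendsto (fun ε : ℝ => n * (Z / (m₀ + ε * r)) ^ (1 / (n : ℝ))) (𝓝[>] 0)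
        (𝓝 (n * (Z / m₀) ^ (1 / (n : ℝ)))) :=
      ((tendsto_const_nhds.div hc hm₀pos.ne').rpow_const (Or.inr (by positivity))).const_mul _
    have hc2 : Tendsto (fun ε : ℝ => ε * r * (K : ℝ) ^ n) (𝓝[>] 0) (𝓝 0) := by
      have : Tendsto (fun ε : ℝ => ε * r * (K : ℝ) ^ n) (𝓝 0) (𝓝 (0 * r * (K : ℝ) ^ n)) :=
        (Continuous.tendsto (by fun_prop) _)
      rw [zero_mul, zero_mul] at this
      exact this.mono_left nhdsWithin_le_nhds
    have l1 := hc1.mul (hc.mul_const (M K))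
    have l2 := (((((hc.mul_const ((n : ℝ) / ((n : ℝ) - 2))).rpow_const
      (Or.inr (by norm_num : (0 : ℝ) ≤ 1 / 2))).mul_const (G ^ (1 / 2 : ℝ))).const_mul a).add
        (hc1.mul hc2))
    rw [mul_zero, add_zero] at l2
    exact le_of_tendsto_of_tendsto l1 l2
      (by filter_upwards [self_mem_nhdsWithin] with ε hε using key K ε hε)
  -- Then K → ∞: the truncated moments increase to the full one, which equals a and cancels against
  -- the a on the right.
  have key3 : n * (Z / m₀) ^ (1 / (n : ℝ)) * (m₀ * a) ≤
      a * ((m₀ * ((n : ℝ) / ((n : ℝ) - 2))) ^ (1 / 2 : ℝ) * G ^ (1 / 2 : ℝ)) :=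
    le_of_tendsto' (((tendsto_prod_truncMoment hn).const_mul m₀).const_mul _) key2
  have key4 : n * (Z / m₀) ^ (1 / (n : ℝ)) * m₀ ≤
      √(m₀ * ((n : ℝ) / ((n : ℝ) - 2)) * G) := by
    rw [Real.sqrt_mul (mul_nonneg hm₀0 (div_nonneg (by linarith) (by linarith))),
      Real.sqrt_eq_rpow, Real.sqrt_eq_rpow]
    refine le_of_mul_le_mul_left ?_ ha0
    calc _ = n * (Z / m₀) ^ (1 / (n : ℝ)) * (m₀ * a) := by ring
      _ ≤ _ := key3
  have hnn : 0 ≤ (n : ℝ) / ((n : ℝ) - 2) := div_nonneg (by linarith) (by linarith)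
  have key5 := (Real.le_sqrt (by positivity) (by positivity)).1 key4
  rw [hm₀e, hGe, ENNReal.ofReal_rpow_of_nonneg hm₀0 (div_nonneg (by linarith) (by linarith)),
    ← ENNReal.ofReal_mul (by
      unfold sobolevConst
      have := (unitSphereArea_pos (N := n)).le
      have : (0 : ℝ) ≤ (n : ℝ) - 2 := by linarith
      positivity)]
  refine ENNReal.ofReal_le_ofReal ?_
  have hS : sobolevConst n = n * ((n : ℝ) - 2) * Z ^ (2 / (n : ℝ)) := by
    have hA := unitSphereArea_pos (N := n)
    have h4 : ((2 : ℝ) ^ (n : ℝ)) ^ (2 / (n : ℝ)) = 4 := by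
      rw [← Real.rpow_mul zero_le_two, mul_div_cancel₀ _ hn0]; norm_num
    rw [hZ, Real.div_rpow hA.le (by positivity), h4, sobolevConst]
    ring
  have e1 : ((Z / m₀) ^ (1 / (n : ℝ))) ^ 2 = Z ^ (2 / (n : ℝ)) / m₀ ^ (2 / (n : ℝ)) := by
    rw [← Real.rpow_natCast, ← Real.rpow_mul (by positivity), Real.div_rpow hZpos.le hm₀0]
    norm_num
    ring_nf
  have e2 : m₀ ^ (((n : ℝ) - 2) / n) = m₀ / m₀ ^ (2 / (n : ℝ)) := by
    rw [sub_div, div_self hn0, Real.rpow_sub hm₀pos, Real.rpow_one]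
  rw [hS, e2]
  rw [mul_pow, mul_pow, e1] at key5
  have hx : 0 < m₀ ^ (2 / (n : ℝ)) := by positivity
  have hn3 : (0 : ℝ) < (n : ℝ) - 2 := by linarith
  set y := m₀ ^ (2 / (n : ℝ)) with hy
  set z := Z ^ (2 / (n : ℝ)) with hz
  have key6 : n * (m₀ * (n / ((n : ℝ) - 2))) * (((n : ℝ) - 2) * z * (m₀ / y)) ≤
      n * (m₀ * (n / ((n : ℝ) - 2))) * (G / n) := by
    calc _ = (n : ℝ) ^ 2 * (z / y) * m₀ ^ 2 := by field_simp
      _ ≤ _ := key5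
      _ = _ := by field_simp
  have key7 := le_of_mul_le_mul_left key6 (by positivity)
  rw [le_div_iff₀ (by linarith)] at key7
  linarith

end SharpSobolev

/-! ### From coordinates to Euclidean space -/

lemma SobolevIneq.mono {N : ℕ} {S S' : ℝ} (h : S ≤ S') {u : EuclideanSpace ℝ (Fin N) → ℝ}
    (hu : SobolevIneq N S' u) : SobolevIneq N S u :=
  (mul_le_mul_left (ENNReal.ofReal_le_ofReal h) _).trans hu

lemma norm_gradient_sq {N : ℕ} (u : EuclideanSpace ℝ (Fin N) → ℝ) (x : EuclideanSpace ℝ (Fin N)) :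
    ‖gradient u x‖ ^ 2 = ∑ k, fderiv ℝ u x (EuclideanSpace.single k 1) ^ 2 := by
  rw [EuclideanSpace.real_norm_sq_eq]
  refine Finset.sum_congr rfl fun k _ => ?_
  have h : inner ℝ (gradient u x) (EuclideanSpace.single k 1) =
      fderiv ℝ u x (EuclideanSpace.single k 1) := by
    rw [gradient, InnerProductSpace.toDual_symm_apply]
  rw [← h, EuclideanSpace.inner_single_right]
  simp

/-- The sharp Sobolev inequality. -/
theorem sobolevIneq_sobolevConst {N : ℕ} (hN : 3 ≤ N) {u : EuclideanSpace ℝ (Fin N) → ℝ}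
    (hu : IsTestFunction univ u) : SobolevIneq N (sobolevConst N) u := by
  obtain ⟨hsm, hcs, -⟩ := hu
  have hsm1 : ContDiff ℝ 1 u := hsm.of_le (by exact_mod_cast le_top)
  set e := (EuclideanSpace.equiv (Fin N) ℝ).symm with he
  have hv := PiLp.volume_preserving_toLp (Fin N)
  have hee : ∀ y, e y = WithLp.toLp 2 y := fun y => rfl
  have h1 : ContDiff ℝ 1 (fun y : Fin N → ℝ => u (e y)) := hsm1.comp e.contDiff
  have h2 : HasCompactSupport (fun y : Fin N → ℝ => u (e y)) :=
    hcs.comp_homeomorph e.toHomeomorph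
  have h3 := sharp_sobolev_pi hN h1 h2
  have hd : ∀ (y : Fin N → ℝ) (k : Fin N), fderiv ℝ (fun y => u (e y)) y (Pi.single k 1) =
      fderiv ℝ u (e y) (EuclideanSpace.single k 1) := by
    intro y k
    have h := ((hsm1.differentiable one_ne_zero (e y)).hasFDerivAt.comp y e.hasFDerivAt).fderiv
    change fderiv ℝ (fun y => u (e y)) y = _ at h
    rw [h]
    rfl
  simp only [hd] at h3
  have hme : MeasurableEmbedding (WithLp.toLp 2 : (Fin N → ℝ) → EuclideanSpace ℝ (Fin N)) :=
    (MeasurableEquiv.toLp 2 (Fin N → ℝ)).measurableEmbedding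
  unfold SobolevIneq
  simp only [norm_gradient_sq]
  rw [← hv.lintegral_comp_emb hme, ← hv.lintegral_comp_emb hme]
  exact h3

/-! ### Radial functions and polar coordinates -/

section Radial

variable {N : ℕ}

/-- Polar coordinates off the origin: the volume is the product of the sphere measure, of total mass
N ω_N, and t^(N-1) dt. -/
lemma lintegral_fun_norm (hN : 0 < N) {f : ℝ → ℝ≥0∞} (hf : Measurable f) :
    ∫⁻ x : EuclideanSpace ℝ (Fin N), f ‖x‖ =
      ENNReal.ofReal (N * unitBallVolume N) *
        ∫⁻ t in Ioi (0 : ℝ), ENNReal.ofReal (t ^ ((N : ℝ) - 1)) * f t := by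
  have : Nonempty (Fin N) := ⟨⟨0, hN⟩⟩
  have : Nontrivial (EuclideanSpace ℝ (Fin N)) := by
    refine ⟨⟨0, EuclideanSpace.single ⟨0, hN⟩ 1, ?_⟩⟩
    intro h
    have := congrArg (fun x => x ⟨0, hN⟩) h
    simp at this
  set μ : Measure (EuclideanSpace ℝ (Fin N)) := volume
  have h1 : ∫⁻ x, f ‖x‖ ∂μ = ∫⁻ x : ({0}ᶜ : Set (EuclideanSpace ℝ (Fin N))),
      f ‖x.1‖ ∂(μ.comap (↑)) := by
    rw [lintegral_subtype_comap (measurableSet_singleton _).compl fun x => f ‖x‖,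
      restrict_compl_singleton]
  have h2 : ∫⁻ x : ({0}ᶜ : Set (EuclideanSpace ℝ (Fin N))), f ‖x.1‖ ∂(μ.comap (↑)) =
      ∫⁻ p, f p.2.1 ∂(μ.toSphere.prod (Measure.volumeIoiPow (N - 1))) := by
    have h := μ.measurePreserving_homeomorphUnitSphereProd
    rw [finrank_euclideanSpace_fin] at h
    rw [← h.lintegral_comp_emb (Homeomorph.measurableEmbedding _)]
    simp only [homeomorphUnitSphereProd_apply_snd_coe]
  have h3 : ∫⁻ p, f p.2.1 ∂(μ.toSphere.prod (Measure.volumeIoiPow (N - 1))) =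
      μ.toSphere univ * ∫⁻ t : Ioi (0 : ℝ), f t ∂(Measure.volumeIoiPow (N - 1)) := by
    rw [lintegral_prod _ (by fun_prop)]
    simp only [lintegral_const]
    rw [mul_comm]
  have h4 : ∫⁻ t : Ioi (0 : ℝ), f t ∂(Measure.volumeIoiPow (N - 1)) =
      ∫⁻ t in Ioi (0 : ℝ), ENNReal.ofReal (t ^ ((N : ℝ) - 1)) * f t := by
    rw [Measure.volumeIoiPow, lintegral_withDensity_eq_lintegral_mul _ (by fun_prop) (by fun_prop)]
    simp only [Pi.mul_apply]
    rw [lintegral_subtype_comap measurableSet_Ioi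
      (fun t : ℝ => ENNReal.ofReal (t ^ (N - 1)) * f t)]
    refine setLIntegral_congr_fun measurableSet_Ioi fun t _ => ?_
    rw [← Real.rpow_natCast, Nat.cast_sub (by omega), Nat.cast_one]
  have h5 : μ.toSphere univ = ENNReal.ofReal (N * unitBallVolume N) := by
    rw [Measure.toSphere_apply_univ, finrank_euclideanSpace_fin, unitBallVolume,
      ENNReal.ofReal_mul N.cast_nonneg, ENNReal.ofReal_natCast, Measure.real, ENNReal.ofReal_toReal]
    exact measure_ball_lt_top.ne
  rw [h1, h2, h3, h4, h5]

/-- The norm fails to be smooth only at the origin, and w vanishes near 0 because its support is a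
compact subset of (0, ∞). -/
lemma isTestFunction_comp_norm {w : ℝ → ℝ} (hw : IsTestFunction (Ioi 0) w) :
    IsTestFunction univ (fun x : EuclideanSpace ℝ (Fin N) => w ‖x‖) := by
  obtain ⟨hsm, hcs, hsub⟩ := hw
  refine ⟨contDiff_iff_contDiffAt.2 fun x => ?_, ?_, subset_univ _⟩
  · rcases eq_or_ne x 0 with rfl | hx
    · have h0 : (0 : ℝ) ∉ tsupport w := fun h => lt_irrefl (0 : ℝ) (mem_Ioi.1 (hsub h))
      have h1 : w =ᶠ[𝓝 0] fun _ => 0 := notMem_tsupport_iff_eventuallyEq.1 h0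
      have h2 : Tendsto (fun x : EuclideanSpace ℝ (Fin N) => ‖x‖) (𝓝 0) (𝓝 0) := by
        simpa using (continuous_norm (E := EuclideanSpace ℝ (Fin N))).tendsto 0
      exact (contDiffAt_const (c := (0 : ℝ))).congr_of_eventuallyEq (h2.eventually h1)
    · exact hsm.contDiffAt.comp x (contDiffAt_norm ℝ hx)
  · obtain ⟨C, hC⟩ := hcs.isBounded.exists_norm_le
    refine HasCompactSupport.intro (isCompact_closedBall (0 : EuclideanSpace ℝ (Fin N)) C)
      fun x hx => ?_
    by_contra hne
    refine hx ?_
    have := hC ‖x‖ (subset_tsupport _ hne)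
    simpa using this

lemma norm_gradient_comp_norm {w : ℝ → ℝ} (hw : Differentiable ℝ w)
    {x : EuclideanSpace ℝ (Fin N)} (hx : x ≠ 0) :
    ‖gradient (fun x : EuclideanSpace ℝ (Fin N) => w ‖x‖) x‖ = |deriv w ‖x‖| := by
  have : Nontrivial (EuclideanSpace ℝ (Fin N)) := ⟨⟨x, 0, hx⟩⟩
  have hd : DifferentiableAt ℝ (fun x : EuclideanSpace ℝ (Fin N) => ‖x‖) x :=
    (contDiffAt_norm ℝ hx).differentiableAt one_ne_zero
  have h := ((hw ‖x‖).hasDerivAt.comp_hasFDerivAt x hd.hasFDerivAt).fderiv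
  change fderiv ℝ (fun x : EuclideanSpace ℝ (Fin N) => w ‖x‖) x = _ at h
  rw [gradient, LinearIsometryEquiv.norm_map, h, norm_smul, norm_fderiv_norm hd, mul_one,
    Real.norm_eq_abs]

/-- `∫_0^∞ t^(N-1) |w'|² dt`. -/
noncomputable def radialEnergy (N : ℕ) (w : ℝ → ℝ) : ℝ≥0∞ :=
  ∫⁻ t in Ioi (0 : ℝ), ENNReal.ofReal (t ^ ((N : ℝ) - 1) * |deriv w t| ^ 2)

/-- `∫_0^∞ t^(N-1) |w|^(2N/(N-2)) dt`. -/
noncomputable def radialPower (N : ℕ) (w : ℝ → ℝ) : ℝ≥0∞ :=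
  ∫⁻ t in Ioi (0 : ℝ), ENNReal.ofReal (t ^ ((N : ℝ) - 1) *
    |w t| ^ (2 * (N : ℝ) / ((N : ℝ) - 2)))

lemma sobolevIneq_comp_norm_iff (hN : 0 < N) {w : ℝ → ℝ} (hw : ContDiff ℝ 1 w) (S : ℝ) :
    SobolevIneq N S (fun x => w ‖x‖) ↔
      ENNReal.ofReal S * (ENNReal.ofReal (N * unitBallVolume N) * radialPower N w) ^
        (((N : ℝ) - 2) / (N : ℝ)) ≤
      ENNReal.ofReal (N * unitBallVolume N) * radialEnergy N w := by
  have hdm : Measurable (deriv w) := (hw.continuous_deriv le_rfl).measurable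
  have hwm := hw.continuous.measurable
  have : Nontrivial (EuclideanSpace ℝ (Fin N)) := by
    refine ⟨⟨0, EuclideanSpace.single ⟨0, hN⟩ 1, ?_⟩⟩
    intro h
    have := congrArg (fun x => x ⟨0, hN⟩) h
    simp at this
  have h1 : ∫⁻ x : EuclideanSpace ℝ (Fin N),
      ENNReal.ofReal (‖gradient (fun x : EuclideanSpace ℝ (Fin N) => w ‖x‖) x‖ ^ 2) =
      ∫⁻ x : EuclideanSpace ℝ (Fin N), ENNReal.ofReal (|deriv w ‖x‖| ^ 2) := by
    refine lintegral_congr_ae ?_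
    filter_upwards [compl_mem_ae_iff.2 (measure_singleton (0 : EuclideanSpace ℝ (Fin N)))] with x hx
    rw [norm_gradient_comp_norm (hw.differentiable one_ne_zero) hx]
  have h2 := lintegral_fun_norm hN (f := fun t => ENNReal.ofReal (|deriv w t| ^ 2)) (by fun_prop)
  have h3 := lintegral_fun_norm hN
    (f := fun t => ENNReal.ofReal (|w t| ^ (2 * (N : ℝ) / ((N : ℝ) - 2)))) (by fun_prop)
  have hpos : ∀ t ∈ Ioi (0 : ℝ), 0 ≤ t ^ ((N : ℝ) - 1) := fun t ht =>
    Real.rpow_nonneg (le_of_lt ht) _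
  unfold SobolevIneq radialEnergy radialPower
  rw [h1, h2, h3]
  rw [setLIntegral_congr_fun measurableSet_Ioi fun t ht => (ENNReal.ofReal_mul (hpos t ht)).symm,
    setLIntegral_congr_fun measurableSet_Ioi fun t ht => (ENNReal.ofReal_mul (hpos t ht)).symm]

end Radial

/-! ### The change of variables between r and t -/

/-- Test functions are transported by smooth changes of variables. -/
lemma IsTestFunction.indicator_comp {U V : Set ℝ} (hU : IsOpen U) {g g' : ℝ → ℝ}
    (hg : ContDiffOn ℝ ∞ g U) (hg' : ContinuousOn g' V) (hmaps' : MapsTo g' V U)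
    (hinv : ∀ x ∈ U, g' (g x) = x) {f : ℝ → ℝ} (hf : IsTestFunction V f) :
    IsTestFunction U (U.indicator fun x => f (g x)) := by
  obtain ⟨hsm, hcs, hsub⟩ := hf
  have hK : IsCompact (g' '' tsupport f) := hcs.isCompact.image_of_continuousOn (hg'.mono hsub)
  have hKU : g' '' tsupport f ⊆ U := image_subset_iff.2 fun y hy => hmaps' (hsub hy)
  have h0 : ∀ x ∉ g' '' tsupport f, U.indicator (fun x => f (g x)) x = 0 := by
    intro x hx
    by_contra hne
    by_cases hxU : x ∈ U
    · rw [indicator_of_mem hxU] at hne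
      exact hx ⟨g x, subset_tsupport _ hne, hinv x hxU⟩
    · exact hne (indicator_of_notMem hxU _)
  have hts : tsupport (U.indicator fun x => f (g x)) ⊆ g' '' tsupport f :=
    closure_minimal (fun x hx => by_contra fun h => hx (h0 x h)) hK.isClosed
  refine ⟨contDiff_iff_contDiffAt.2 fun x => ?_, hK.of_isClosed_subset isClosed_closure hts,
    hts.trans hKU⟩
  by_cases hxU : x ∈ U
  · have h1 : ContDiffAt ℝ ∞ (fun x => f (g x)) x :=
      hsm.contDiffAt.comp x (hg.contDiffAt (hU.mem_nhds hxU))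
    refine h1.congr_of_eventuallyEq ?_
    filter_upwards [hU.mem_nhds hxU] with y hy using indicator_of_mem hy _
  · have hxK : x ∈ (g' '' tsupport f)ᶜ := fun h => hxU (hKU h)
    refine (contDiffAt_const (c := (0 : ℝ))).congr_of_eventuallyEq ?_
    filter_upwards [hK.isClosed.isOpen_compl.mem_nhds hxK] with y hy using h0 y hy

lemma IsTestFunction.eq_zero_of_notMem {U : Set ℝ} {f : ℝ → ℝ} (hf : IsTestFunction U f) {x : ℝ}
    (hx : x ∉ U) : f x = 0 :=
  image_eq_zero_of_notMem_tsupport fun h => hx (hf.2.2 h)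

/-- The inverse of `logVar`. -/
noncomputable def expVar (N : ℕ) (R t : ℝ) : ℝ :=
  R * Real.exp (-t ^ (-((N : ℝ) - 2)))

section ChangeOfVariables

variable {N : ℕ} {R : ℝ}

lemma neg_log_div_pos {r : ℝ} (hr : r ∈ Ioo 0 R) : 0 < -Real.log (r / R) := by
  have hR : 0 < R := hr.1.trans hr.2
  have := Real.log_neg (div_pos hr.1 hR) ((div_lt_one hR).2 hr.2)
  linarith

lemma logVar_pos {r : ℝ} (hr : r ∈ Ioo 0 R) : 0 < logVar N R r :=
  Real.rpow_pos_of_pos (neg_log_div_pos hr) _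

lemma expVar_mem (hR : 0 < R) {t : ℝ} (ht : 0 < t) : expVar N R t ∈ Ioo 0 R := by
  refine ⟨by unfold expVar; positivity, ?_⟩
  unfold expVar
  have : Real.exp (-t ^ (-((N : ℝ) - 2))) < 1 := by
    rw [Real.exp_lt_one_iff]
    have : 0 < t ^ (-((N : ℝ) - 2)) := by positivity
    linarith
  nlinarith

lemma neg_log_expVar_div (hR : 0 < R) (t : ℝ) :
    -Real.log (expVar N R t / R) = t ^ (-((N : ℝ) - 2)) := by
  rw [expVar, mul_div_cancel_left₀ _ hR.ne', Real.log_exp, neg_neg]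

lemma hasDerivAt_expVar {t : ℝ} (ht : 0 < t) :
    HasDerivAt (expVar N R) (((N : ℝ) - 2) * t ^ (-((N : ℝ) - 1)) * expVar N R t) t := by
  have h1 := (Real.hasDerivAt_rpow_const (x := t) (p := -((N : ℝ) - 2)) (Or.inl ht.ne')).neg
  have h2 := h1.exp.const_mul R
  have e : -((N : ℝ) - 2) - 1 = -((N : ℝ) - 1) := by ring
  rw [e] at h2
  convert! h2 using 1
  simp only [Pi.neg_apply]
  unfold expVar
  ring

lemma contDiffOn_expVar : ContDiffOn ℝ ∞ (expVar N R) (Ioi 0) := by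
  intro t ht
  refine ContDiffAt.contDiffWithinAt ?_
  exact contDiffAt_const.mul
    ((Real.contDiffAt_rpow_const_of_ne (ne_of_gt ht)).neg.exp)

lemma contDiffOn_logVar : ContDiffOn ℝ ∞ (logVar N R) (Ioo 0 R) := by
  intro r hr
  have hR : 0 < R := hr.1.trans hr.2
  refine ContDiffAt.contDiffWithinAt ?_
  have h1 : ContDiffAt ℝ ∞ (fun r => -Real.log (r / R)) r :=
    ((contDiffAt_id.div_const R).log (div_pos hr.1 hR).ne').neg
  exact h1.rpow_const_of_ne (neg_log_div_pos hr).ne'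

variable (hN : 3 ≤ N)
include hN

lemma logVar_expVar (hR : 0 < R) {t : ℝ} (ht : 0 < t) : logVar N R (expVar N R t) = t := by
  have hn' : (3 : ℝ) ≤ N := by exact_mod_cast hN
  rw [logVar, neg_log_expVar_div hR, ← Real.rpow_mul ht.le]
  have : -((N : ℝ) - 2) * -(1 / ((N : ℝ) - 2)) = 1 := by
    have : (N : ℝ) - 2 ≠ 0 := by intro h; linarith
    field_simp
  rw [this, Real.rpow_one]

lemma expVar_logVar {r : ℝ} (hr : r ∈ Ioo 0 R) : expVar N R (logVar N R r) = r := by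
  have hn' : (3 : ℝ) ≤ N := by exact_mod_cast hN
  have hR : 0 < R := hr.1.trans hr.2
  rw [expVar, logVar, ← Real.rpow_mul (neg_log_div_pos hr).le]
  have : -(1 / ((N : ℝ) - 2)) * -((N : ℝ) - 2) = 1 := by
    have : (N : ℝ) - 2 ≠ 0 := by intro h; linarith
    field_simp
  rw [this, Real.rpow_one, neg_neg, Real.exp_log (div_pos hr.1 hR), mul_div_cancel₀ _ hR.ne']

lemma expVar_image (hR : 0 < R) : expVar N R '' Ioi 0 = Ioo 0 R :=
  Subset.antisymm (image_subset_iff.2 fun _ ht => expVar_mem hR ht)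
    fun r hr => ⟨logVar N R r, logVar_pos hr, expVar_logVar hN hr⟩

lemma lintegral_Ioo_eq_expVar (hR : 0 < R) (G : ℝ → ℝ≥0∞) :
    ∫⁻ r in Ioo 0 R, G r = ∫⁻ t in Ioi (0 : ℝ),
      ENNReal.ofReal (((N : ℝ) - 2) * t ^ (-((N : ℝ) - 1)) * expVar N R t) *
        G (expVar N R t) := by
  have hn' : (3 : ℝ) ≤ N := by exact_mod_cast hN
  rw [← expVar_image hN hR, lintegral_image_eq_lintegral_abs_deriv_mul measurableSet_Ioi
    (fun t ht => (hasDerivAt_expVar ht).hasDerivWithinAt)]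
  · refine setLIntegral_congr_fun measurableSet_Ioi fun t ht => ?_
    rw [abs_of_nonneg]
    have h1 : (0 : ℝ) ≤ (N : ℝ) - 2 := by linarith
    have h2 := (expVar_mem (N := N) hR ht).1
    have h3 : (0 : ℝ) < t := ht
    positivity
  · intro s hs t ht h
    rw [← logVar_expVar hN hR hs, h, logVar_expVar hN hR ht]

/-- From dr/dt = (N-2) t^(-(N-1)) r, the quotient r/(dr/dt) is t^(N-1)/(N-2), free of r. Only
differentiability of v is assumed, so the formula also serves the extremals, which are not test
functions. -/
lemma weightedEnergy_eq (hR : 0 < R) {v w : ℝ → ℝ} (hv : ∀ r ∈ Ioo 0 R, DifferentiableAt ℝ v r)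
    (hvw : ∀ r ∈ Ioo 0 R, v r = w (logVar N R r)) :
    weightedEnergy R v = ENNReal.ofReal ((N : ℝ) - 2)⁻¹ * radialEnergy N w := by
  have hn' : (3 : ℝ) ≤ N := by exact_mod_cast hN
  have h2 : (0 : ℝ) < (N : ℝ) - 2 := by linarith
  rw [weightedEnergy, lintegral_Ioo_eq_expVar hN hR, radialEnergy,
    ← lintegral_const_mul' _ _ ENNReal.ofReal_ne_top]
  refine setLIntegral_congr_fun measurableSet_Ioi fun t ht => ?_
  have ht0 : (0 : ℝ) < t := ht
  have hr := expVar_mem (N := N) hR ht0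
  have h1 : deriv w t = deriv v (expVar N R t) *
      (((N : ℝ) - 2) * t ^ (-((N : ℝ) - 1)) * expVar N R t) := by
    have h := (hv _ hr).hasDerivAt.comp t (hasDerivAt_expVar ht0)
    rw [← h.deriv]
    refine Filter.EventuallyEq.deriv_eq ?_
    filter_upwards [Ioi_mem_nhds ht0] with s hs
    rw [Function.comp_apply, hvw _ (expVar_mem hR hs), logVar_expVar hN hR hs]
  have h3 : 0 < t ^ ((N : ℝ) - 1) := by positivity
  have h4 : t ^ (-((N : ℝ) - 1)) = (t ^ ((N : ℝ) - 1))⁻¹ := Real.rpow_neg ht0.le _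
  have hr0 := hr.1
  rw [← ENNReal.ofReal_mul (by positivity), ← ENNReal.ofReal_mul (by positivity), sq_abs, sq_abs,
    h1, h4]
  congr 1
  field_simp

/-- The logarithmic weight is t^(2(N-1)) and dr/r is (N-2) t^(-(N-1)) dt, which leaves (N-2) t^(N-1)
dt. -/
lemma weightedPotential_eq (hR : 0 < R) {v w : ℝ → ℝ}
    (hvw : ∀ r ∈ Ioo 0 R, v r = w (logVar N R r)) :
    weightedPotential N R v =
      (ENNReal.ofReal ((N : ℝ) - 2) * radialPower N w) ^ (((N : ℝ) - 2) / (N : ℝ)) := by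
  have hn' : (3 : ℝ) ≤ N := by exact_mod_cast hN
  have h2 : (0 : ℝ) < (N : ℝ) - 2 := by linarith
  rw [weightedPotential, lintegral_Ioo_eq_expVar hN hR, radialPower,
    ← lintegral_const_mul' _ _ ENNReal.ofReal_ne_top]
  congr 1
  refine setLIntegral_congr_fun measurableSet_Ioi fun t ht => ?_
  have ht0 : (0 : ℝ) < t := ht
  have hr := expVar_mem (N := N) hR ht0
  have hr0 := hr.1
  rw [← ENNReal.ofReal_mul (by positivity), ← ENNReal.ofReal_mul (by positivity), hvw _ hr,
    logVar_expVar hN hR ht0, neg_log_expVar_div hR, ← Real.rpow_mul ht0.le]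
  congr 1
  have e : -((N : ℝ) - 2) * -(2 * ((N : ℝ) - 1) / ((N : ℝ) - 2)) =
      ((N : ℝ) - 1) + ((N : ℝ) - 1) := by
    field_simp
    ring
  have h3 : 0 < t ^ ((N : ℝ) - 1) := by positivity
  rw [e, Real.rpow_add ht0, Real.rpow_neg ht0.le]
  field_simp

/-- Test functions live on all of ℝ, so the transformed function is extended by zero; uniqueness
holds because every test function vanishes off its interval. -/
lemma existsUnique_radial (hR : 0 < R) {v : ℝ → ℝ} (hv : IsTestFunction (Ioo 0 R) v) :
    ∃! w : ℝ → ℝ, IsTestFunction (Ioi 0) w ∧ ∀ r ∈ Ioo 0 R, v r = w (logVar N R r) := by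
  refine ⟨(Ioi 0).indicator fun t => v (expVar N R t), ⟨?_, fun r hr => ?_⟩, fun w hw => ?_⟩
  · exact hv.indicator_comp isOpen_Ioi contDiffOn_expVar contDiffOn_logVar.continuousOn
      (fun r hr => logVar_pos hr) (fun t ht => logVar_expVar hN hR ht)
  · rw [indicator_of_mem (show logVar N R r ∈ Ioi 0 from logVar_pos hr), expVar_logVar hN hr]
  · ext t
    by_cases ht : t ∈ Ioi (0 : ℝ)
    · rw [indicator_of_mem ht, hw.2 _ (expVar_mem hR ht), logVar_expVar hN hR ht]
    · rw [indicator_of_notMem ht, hw.1.eq_zero_of_notMem ht]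

lemma existsUnique_weighted (hR : 0 < R) {w : ℝ → ℝ} (hw : IsTestFunction (Ioi 0) w) :
    ∃! v : ℝ → ℝ, IsTestFunction (Ioo 0 R) v ∧ ∀ r ∈ Ioo 0 R, v r = w (logVar N R r) := by
  refine ⟨(Ioo 0 R).indicator fun r => w (logVar N R r), ⟨?_, fun r hr => ?_⟩, fun v hv => ?_⟩
  · exact hw.indicator_comp isOpen_Ioo contDiffOn_logVar contDiffOn_expVar.continuousOn
      (fun t ht => expVar_mem hR ht) (fun r hr => expVar_logVar hN hr)
  · rw [indicator_of_mem hr]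
  · ext r
    by_cases hr : r ∈ Ioo 0 R
    · rw [indicator_of_mem hr, hv.2 _ hr]
    · rw [indicator_of_notMem hr, hv.1.eq_zero_of_notMem hr]

/-- The factor between the constants in the weighted and in the Sobolev inequality. -/
lemma constFactor_pos :
    0 < ((N : ℝ) - 2) ^ (2 * ((N : ℝ) - 1) / (N : ℝ)) *
      ((N : ℝ) * unitBallVolume N) ^ (2 / (N : ℝ)) := by
  have hn' : (3 : ℝ) ≤ N := by exact_mod_cast hN
  have h2 : (0 : ℝ) < (N : ℝ) - 2 := by linarith
  have hb := unitBallVolume_pos (N := N) (by omega)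
  positivity

/-- Multiplying (m) by N ω_N (N-2) matches the two sides, by 1 + (N-2)/N = 2(N-1)/N for powers of
N-2 and 2/N + (N-2)/N = 1 for powers of N ω_N. For c ≤ 0 both left sides vanish. -/
lemma weightedIneq_iff_sobolevIneq (hR : 0 < R) {v w : ℝ → ℝ} (hv : IsTestFunction (Ioo 0 R) v)
    (hw : IsTestFunction (Ioi 0) w) (hvw : ∀ r ∈ Ioo 0 R, v r = w (logVar N R r)) (c : ℝ) :
    WeightedIneq N R c v ↔
        SobolevIneq N
          (c * ((N : ℝ) - 2) ^ (2 * ((N : ℝ) - 1) / (N : ℝ)) *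
            ((N : ℝ) * unitBallVolume N) ^ (2 / (N : ℝ)))
          (fun x => w ‖x‖) := by
  have hn' : (3 : ℝ) ≤ N := by exact_mod_cast hN
  have hn0 : (N : ℝ) ≠ 0 := by intro h; linarith
  have h2 : (0 : ℝ) < (N : ℝ) - 2 := by linarith
  have hσ : 0 < (N : ℝ) * unitBallVolume N :=
    mul_pos (by linarith) (unitBallVolume_pos (N := N) (by omega))
  have hk := constFactor_pos hN
  have he : 0 ≤ ((N : ℝ) - 2) / (N : ℝ) := by positivity
  rw [sobolevIneq_comp_norm_iff (by omega) (hw.1.of_le (by exact_mod_cast le_top)), WeightedIneq,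
    weightedEnergy_eq hN hR
      (fun r _ => (hv.1.differentiable (by simp)) r) hvw, weightedPotential_eq hN hR hvw, mul_assoc c,
    ENNReal.ofReal_mul' hk.le, ENNReal.mul_rpow_of_nonneg _ _ he, ENNReal.mul_rpow_of_nonneg _ _ he,
    ENNReal.ofReal_rpow_of_pos h2, ENNReal.ofReal_rpow_of_pos hσ]
  set σ := (N : ℝ) * unitBallVolume N
  set e := ((N : ℝ) - 2) / (N : ℝ) with hedef
  set B := radialPower N w ^ e
  set A := radialEnergy N w
  have hm : ENNReal.ofReal (σ * ((N : ℝ) - 2)) ≠ 0 := by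
    rw [Ne, ENNReal.ofReal_eq_zero, not_le]
    positivity
  rw [← ENNReal.mul_le_mul_iff_right hm ENNReal.ofReal_ne_top]
  have e1 : ENNReal.ofReal (σ * ((N : ℝ) - 2)) *
      (ENNReal.ofReal c * (ENNReal.ofReal (((N : ℝ) - 2) ^ e) * B)) =
      ENNReal.ofReal c * ENNReal.ofReal (((N : ℝ) - 2) ^ (2 * ((N : ℝ) - 1) / (N : ℝ)) *
        σ ^ (2 / (N : ℝ))) * (ENNReal.ofReal (σ ^ e) * B) := by
    have : σ * ((N : ℝ) - 2) * ((N : ℝ) - 2) ^ e =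
        ((N : ℝ) - 2) ^ (2 * ((N : ℝ) - 1) / (N : ℝ)) * σ ^ (2 / (N : ℝ)) * σ ^ e := by
      have t1 : ((N : ℝ) - 2) ^ (2 * ((N : ℝ) - 1) / (N : ℝ)) =
          ((N : ℝ) - 2) * ((N : ℝ) - 2) ^ e := by
        rw [← Real.rpow_one_add' h2.le (by positivity)]
        congr 1
        rw [hedef]
        field_simp
        ring
      have t2 : σ ^ (2 / (N : ℝ)) * σ ^ e = σ := by
        rw [← Real.rpow_add hσ]
        have : 2 / (N : ℝ) + e = 1 := by
          rw [hedef]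
          field_simp
          ring
        rw [this, Real.rpow_one]
      rw [t1, mul_assoc _ (σ ^ (2 / (N : ℝ))), t2]
      ring
    calc _ = ENNReal.ofReal c * (ENNReal.ofReal (σ * ((N : ℝ) - 2)) *
          ENNReal.ofReal (((N : ℝ) - 2) ^ e)) * B := by ring
      _ = ENNReal.ofReal c * (ENNReal.ofReal (((N : ℝ) - 2) ^ (2 * ((N : ℝ) - 1) / (N : ℝ)) *
          σ ^ (2 / (N : ℝ))) * ENNReal.ofReal (σ ^ e)) * B := by
          rw [← ENNReal.ofReal_mul (by positivity), this, ENNReal.ofReal_mul (by positivity)]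
      _ = _ := by ring
  have e2 : ENNReal.ofReal (σ * ((N : ℝ) - 2)) * (ENNReal.ofReal ((N : ℝ) - 2)⁻¹ * A) =
      ENNReal.ofReal σ * A := by
    rw [← mul_assoc, ← ENNReal.ofReal_mul (by positivity), mul_assoc, mul_inv_cancel₀ h2.ne',
      mul_one]
  rw [e1, e2]

lemma weightedConst_mul_constFactor :
    weightedConst N * ((N : ℝ) - 2) ^ (2 * ((N : ℝ) - 1) / (N : ℝ)) *
      ((N : ℝ) * unitBallVolume N) ^ (2 / (N : ℝ)) = sobolevConst N := by
  have hn' : (3 : ℝ) ≤ N := by exact_mod_cast hN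
  have h2 : (0 : ℝ) < (N : ℝ) - 2 := by linarith
  have hσ : 0 < (N : ℝ) * unitBallVolume N :=
    mul_pos (by linarith) (unitBallVolume_pos (N := N) (by omega))
  rw [weightedConst, Real.rpow_neg h2.le, Real.rpow_neg hσ.le]
  have := Real.rpow_pos_of_pos h2 (2 * ((N : ℝ) - 1) / (N : ℝ))
  have := Real.rpow_pos_of_pos hσ (2 / (N : ℝ))
  field_simp

lemma weightedIneq_weightedConst (hR : 0 < R) {v : ℝ → ℝ} (hv : IsTestFunction (Ioo 0 R) v) :
    WeightedIneq N R (weightedConst N) v := by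
  obtain ⟨w, ⟨hw, hvw⟩, -⟩ := existsUnique_radial hN hR hv
  rw [weightedIneq_iff_sobolevIneq hN hR hv hw hvw, weightedConst_mul_constFactor hN]
  exact sobolevIneq_sobolevConst hN (isTestFunction_comp_norm hw)

lemma sobolevConst_pos : 0 < sobolevConst N := by
  have hn' : (3 : ℝ) ≤ N := by exact_mod_cast hN
  have h2 : (0 : ℝ) < (N : ℝ) - 2 := by linarith
  have := unitSphereArea_pos (N := N)
  unfold sobolevConst
  positivity

lemma weightedConst_pos : 0 < weightedConst N := by
  have h := sobolevConst_pos hN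
  rw [← weightedConst_mul_constFactor hN, mul_assoc] at h
  exact pos_of_mul_pos_left h (constFactor_pos hN).le

lemma weightedConst_eq :
    weightedConst N =
      1 / 4 * ((N : ℝ) / ((N : ℝ) - 2)) ^ (((N : ℝ) - 2) / (N : ℝ)) *
        (unitSphereArea N / unitBallVolume N) ^ (2 / (N : ℝ)) := by
  have hn' : (3 : ℝ) ≤ N := by exact_mod_cast hN
  have hn0 : (0 : ℝ) < N := by linarith
  have h2 : (0 : ℝ) < (N : ℝ) - 2 := by linarith
  have hb := unitBallVolume_pos (N := N) (by omega)
  have hs := unitSphereArea_pos (N := N)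
  rw [weightedConst, sobolevConst, Real.div_rpow hn0.le h2.le, Real.div_rpow hs.le hb.le,
    Real.rpow_neg h2.le, Real.rpow_neg (by positivity), Real.mul_rpow hn0.le hb.le]
  have t1 : ((N : ℝ) - 2) ^ (2 * ((N : ℝ) - 1) / (N : ℝ)) =
      ((N : ℝ) - 2) * ((N : ℝ) - 2) ^ (((N : ℝ) - 2) / (N : ℝ)) := by
    rw [← Real.rpow_one_add' h2.le (by positivity)]
    congr 1
    field_simp
    ring
  have t2 : (N : ℝ) ^ (((N : ℝ) - 2) / (N : ℝ)) = N / (N : ℝ) ^ (2 / (N : ℝ)) := by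
    rw [sub_div, div_self hn0.ne', Real.rpow_sub hn0, Real.rpow_one]
  rw [t1, t2]
  have := Real.rpow_pos_of_pos h2 (((N : ℝ) - 2) / (N : ℝ))
  have := Real.rpow_pos_of_pos hn0 (2 / (N : ℝ))
  have := Real.rpow_pos_of_pos hb (2 / (N : ℝ))
  field_simp

end ChangeOfVariables

/-! ### The energy space: extension of inequalities and regularity -/

section EnergySpace

variable {N : ℕ} {R : ℝ}

lemma IsTestFunction.weightedEnergy_ne_top {U : Set ℝ} {f : ℝ → ℝ} (hf : IsTestFunction U f) :
    weightedEnergy R f ≠ ⊤ := by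
  have hd : Continuous (deriv f) := hf.1.continuous_deriv (by simp)
  have hs : HasCompactSupport (fun r => r * |deriv f r| ^ 2) := by
    refine HasCompactSupport.mul_left ?_
    exact hf.2.1.deriv.comp_left (g := fun y : ℝ => |y| ^ 2) (by simp)
  have hi : Integrable (fun r => r * |deriv f r| ^ 2) volume :=
    Continuous.integrable_of_hasCompactSupport (by fun_prop) hs
  exact (hi.integrableOn (s := Ioo 0 R)).lintegral_lt_top.ne

/-- The squared distance of `f` and `v` in the energy norm. -/
noncomputable def energyDist (R : ℝ) (f v : ℝ → ℝ) : ℝ≥0∞ :=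
  ∫⁻ r in Ioo 0 R, ENNReal.ofReal (r * |deriv f r - deriv v r| ^ 2)

/-- Pointwise x² ≤ (1+δ) y² + (1+δ⁻¹)(x-y)². It replaces the triangle inequality for the norm, with
δ sent to 0 at the end. -/
lemma weightedEnergy_le_add (f v : ℝ → ℝ) {δ : ℝ} (hδ : 0 < δ) :
    weightedEnergy R f ≤ ENNReal.ofReal (1 + δ) * weightedEnergy R v +
      ENNReal.ofReal (1 + δ⁻¹) * energyDist R f v := by
  have hf := measurable_deriv f
  have hv := measurable_deriv v
  unfold weightedEnergy energyDist
  rw [← lintegral_const_mul' _ _ ENNReal.ofReal_ne_top,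
    ← lintegral_const_mul' _ _ ENNReal.ofReal_ne_top, ← lintegral_add_left (by fun_prop)]
  refine setLIntegral_mono (by fun_prop) fun r hr => ?_
  have hr0 := hr.1
  rw [← ENNReal.ofReal_mul (by positivity), ← ENNReal.ofReal_mul (by positivity),
    ← ENNReal.ofReal_add (by positivity) (by positivity)]
  refine ENNReal.ofReal_le_ofReal ?_
  simp only [sq_abs]
  set x := deriv f r
  set y := deriv v r
  have h : x ^ 2 ≤ (1 + δ) * y ^ 2 + (1 + δ⁻¹) * (x - y) ^ 2 := by
    have h1 : (1 + δ) * y ^ 2 + (1 + δ⁻¹) * (x - y) ^ 2 - x ^ 2 =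
        δ⁻¹ * (δ * y - (x - y)) ^ 2 := by
      field_simp
      ring
    have h2 : 0 ≤ δ⁻¹ * (δ * y - (x - y)) ^ 2 := by positivity
    linarith
  nlinarith

lemma energyDist_comm (f v : ℝ → ℝ) : energyDist R f v = energyDist R v f := by
  unfold energyDist
  simp only [abs_sub_comm]

lemma MemEnergySpace.weightedEnergy_ne_top {v : ℝ → ℝ} (hv : MemEnergySpace R v) :
    weightedEnergy R v ≠ ⊤ := by
  obtain ⟨f, hf, -, hlim⟩ := hv
  obtain ⟨n, hn⟩ := (hlim.eventually (gt_mem_nhds ENNReal.zero_lt_top)).exists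
  refine ne_top_of_le_ne_top ?_ (weightedEnergy_le_add v (f n) one_pos)
  refine ENNReal.add_ne_top.2 ⟨ENNReal.mul_ne_top ENNReal.ofReal_ne_top
    (hf n).weightedEnergy_ne_top, ENNReal.mul_ne_top ENNReal.ofReal_ne_top ?_⟩
  rw [energyDist_comm]
  exact hn.ne

/-- A weighted inequality for test functions extends to the energy space. -/
lemma MemEnergySpace.weightedIneq (hN : 3 ≤ N) {c : ℝ}
    (hc : ∀ v : ℝ → ℝ, IsTestFunction (Ioo 0 R) v → WeightedIneq N R c v)
    {v : ℝ → ℝ} (hv : MemEnergySpace R v) : WeightedIneq N R c v := by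
  have hn' : (3 : ℝ) ≤ N := by exact_mod_cast hN
  rcases le_or_gt c 0 with hc0 | hc0
  · rw [WeightedIneq, ENNReal.ofReal_of_nonpos hc0, zero_mul]
    exact zero_le
  have hE := hv.weightedEnergy_ne_top
  obtain ⟨f, hf, hpt, hlim⟩ := hv
  set e := ((N : ℝ) - 2) / (N : ℝ) with he
  have he0 : 0 < e := div_pos (by linarith) (by linarith)
  have hc1 : ENNReal.ofReal c ≠ 0 := by simpa using hc0
  have key : ∀ δ : ℝ, 0 < δ →
      ENNReal.ofReal c * weightedPotential N R v ≤ ENNReal.ofReal (1 + δ) * weightedEnergy R v := by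
    intro δ hδ
    set Y : ℕ → ℝ≥0∞ := fun n => ENNReal.ofReal (1 + δ) * weightedEnergy R v +
      ENNReal.ofReal (1 + δ⁻¹) * energyDist R (f n) v with hY
    have hYlim : Tendsto Y atTop (𝓝 (ENNReal.ofReal (1 + δ) * weightedEnergy R v)) := by
      have h := (ENNReal.Tendsto.const_mul hlim (a := ENNReal.ofReal (1 + δ⁻¹))
        (Or.inr ENNReal.ofReal_ne_top)).const_add (ENNReal.ofReal (1 + δ) * weightedEnergy R v)
      rw [mul_zero, add_zero] at h
      exact h
    set G : (ℝ → ℝ) → ℝ → ℝ≥0∞ := fun v r => ENNReal.ofReal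
      (r⁻¹ * (-Real.log (r / R)) ^ (-(2 * ((N : ℝ) - 1) / ((N : ℝ) - 2))) *
      |v r| ^ (2 * (N : ℝ) / ((N : ℝ) - 2))) with hG
    have hpP : ∀ w, weightedPotential N R w = (∫⁻ r in Ioo 0 R, G w r) ^ e := fun w => rfl
    have hb : ∀ n, ∫⁻ r in Ioo 0 R, G (f n) r ≤ (Y n / ENNReal.ofReal c) ^ (1 / e) := by
      intro n
      have h1 := (hc _ (hf n)).trans (weightedEnergy_le_add (f n) v hδ)
      rw [hpP, mul_comm] at h1
      have h2 := (ENNReal.le_div_iff_mul_le (Or.inl hc1) (Or.inl ENNReal.ofReal_ne_top)).2 h1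
      have h3 := ENNReal.rpow_le_rpow h2 (by positivity : 0 ≤ 1 / e)
      rwa [← ENNReal.rpow_mul, mul_one_div_cancel he0.ne', ENNReal.rpow_one] at h3
    have hmG : ∀ n, Measurable (G (f n)) := fun n => by
      have := (hf n).1.continuous.measurable
      rw [hG]
      fun_prop
    -- The approximants are known to converge only pointwise on (0, R), and Fatou gives the
    -- inequality in the direction needed.
    have hfatou : ∫⁻ r in Ioo 0 R, G v r ≤
        (ENNReal.ofReal (1 + δ) * weightedEnergy R v / ENNReal.ofReal c) ^ (1 / e) := by
      have h1 : ∫⁻ r in Ioo 0 R, G v r ≤ ∫⁻ r in Ioo 0 R, liminf (fun n => G (f n) r) atTop := by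
        refine setLIntegral_mono' measurableSet_Ioo fun r hr => le_of_eq ?_
        refine (Tendsto.liminf_eq ?_).symm
        refine (ENNReal.continuous_ofReal.tendsto _).comp (Tendsto.const_mul _ ?_)
        refine Tendsto.rpow_const (hpt r hr).abs (Or.inr ?_)
        exact div_nonneg (by linarith) (by linarith)
      refine h1.trans ((lintegral_liminf_le hmG).trans ?_)
      refine (liminf_le_liminf (Eventually.of_forall hb)).trans_eq (Tendsto.liminf_eq ?_)
      exact (ENNReal.continuous_rpow_const.tendsto _).comp
        (ENNReal.Tendsto.div_const hYlim (Or.inr hc1))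
    have h3 := ENNReal.rpow_le_rpow hfatou he0.le
    rw [← ENNReal.rpow_mul, one_div_mul_cancel he0.ne', ENNReal.rpow_one, ← hpP,
      ENNReal.le_div_iff_mul_le (Or.inl hc1) (Or.inl ENNReal.ofReal_ne_top)] at h3
    rwa [mul_comm]
  have hl : Tendsto (fun δ : ℝ => ENNReal.ofReal (1 + δ) * weightedEnergy R v) (𝓝[>] 0)
      (𝓝 (weightedEnergy R v)) := by
    have h1 : Tendsto (fun δ : ℝ => ENNReal.ofReal (1 + δ)) (𝓝 0) (𝓝 (ENNReal.ofReal (1 + 0))) :=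
      (ENNReal.continuous_ofReal.comp (continuous_const.add continuous_id)).tendsto 0
    have h2 := ENNReal.Tendsto.mul_const (b := weightedEnergy R v) h1 (Or.inr hE)
    rw [add_zero, ENNReal.ofReal_one, one_mul] at h2
    exact h2.mono_left nhdsWithin_le_nhds
  refine ge_of_tendsto hl ?_
  filter_upwards [self_mem_nhdsWithin] with δ hδ using key δ hδ

lemma lintegral_inv_Ioo {a b : ℝ} (ha : 0 < a) (hab : a ≤ b) :
    ∫⁻ r in Ioo a b, ENNReal.ofReal r⁻¹ = ENNReal.ofReal (Real.log (b / a)) := by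
  have h0 : (0 : ℝ) ∉ uIcc a b := by
    rw [uIcc_of_le hab]
    exact fun h => absurd h.1 (not_le.2 ha)
  have hi : IntervalIntegrable (fun r : ℝ => r⁻¹) volume a b :=
    intervalIntegral.intervalIntegrable_inv (fun x hx h => h0 (h ▸ hx)) continuousOn_id
  rw [← integral_inv h0, intervalIntegral.integral_of_le hab,
    ofReal_integral_eq_lintegral_ofReal ((intervalIntegrable_iff_integrableOn_Ioc_of_le hab).1 hi)]
  · exact setLIntegral_congr Ioo_ae_eq_Ioc
  · filter_upwards [self_mem_ae_restrict measurableSet_Ioc] with r hr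
    exact inv_nonneg.2 (ha.le.trans hr.1.le)

/-- Cauchy-Schwarz with the weight of the energy. -/
lemma lintegral_abs_le_energy {g : ℝ → ℝ} (hg : Measurable g) {a b : ℝ} (ha : 0 < a) (hab : a ≤ b)
    (hb : b ≤ R) :
    ∫⁻ r in Ioo a b, ENNReal.ofReal |g r| ≤ ENNReal.ofReal (Real.log (b / a)) ^ (1 / 2 : ℝ) *
      (∫⁻ r in Ioo 0 R, ENNReal.ofReal (r * |g r| ^ 2)) ^ (1 / 2 : ℝ) := by
  have h1 : ∫⁻ r in Ioo a b, ENNReal.ofReal |g r| =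
      ∫⁻ r in Ioo a b, ENNReal.ofReal (√(r⁻¹) * √(r * |g r| ^ 2)) := by
    refine setLIntegral_congr_fun measurableSet_Ioo fun r hr => ?_
    have hr0 : 0 < r := ha.trans hr.1
    rw [← Real.sqrt_mul (by positivity), inv_mul_cancel_left₀ hr0.ne', Real.sqrt_sq (abs_nonneg _)]
  rw [h1, ← lintegral_inv_Ioo ha hab]
  refine (lintegral_ofReal_sqrt_mul_sqrt_le (by fun_prop) (by fun_prop)).trans ?_
  gcongr

lemma ofReal_abs_sub_le_lintegral {f : ℝ → ℝ} (hf : ContDiff ℝ 1 f) {a b : ℝ} (hab : a ≤ b) :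
    ENNReal.ofReal |f b - f a| ≤ ∫⁻ r in Ioo a b, ENNReal.ofReal |deriv f r| := by
  have hc := hf.continuous_deriv le_rfl
  rw [← intervalIntegral.integral_deriv_eq_sub
    (fun x _ => hf.differentiable one_ne_zero x) (hc.intervalIntegrable _ _),
    intervalIntegral.integral_of_le hab, setLIntegral_congr Ioo_ae_eq_Ioc]
  have h := enorm_integral_le_lintegral_enorm (μ := volume.restrict (Ioc a b)) (deriv f)
  simpa only [Real.enorm_eq_ofReal_abs] using h

lemma lintegral_abs_sub_le {f g v : ℝ → ℝ} (a b : ℝ) :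
    ∫⁻ r in Ioo a b, ENNReal.ofReal |deriv f r - deriv g r| ≤
      (∫⁻ r in Ioo a b, ENNReal.ofReal |deriv f r - deriv v r|) +
      ∫⁻ r in Ioo a b, ENNReal.ofReal |deriv g r - deriv v r| := by
  have hf := measurable_deriv f
  have hv := measurable_deriv v
  rw [← lintegral_add_left (by fun_prop)]
  refine lintegral_mono fun r => ?_
  rw [← ENNReal.ofReal_add (abs_nonneg _) (abs_nonneg _)]
  refine ENNReal.ofReal_le_ofReal ?_
  rw [abs_sub_comm (deriv g r)]
  exact abs_sub_le _ _ _

/-- Pointwise control of the distance to the approximating test functions. -/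
lemma ofReal_abs_sub_le_energyDist {v : ℝ → ℝ} {f : ℕ → ℝ → ℝ}
    (hf : ∀ n, IsTestFunction (Ioo 0 R) (f n))
    (hpt : ∀ r ∈ Ioo 0 R, Tendsto (fun n => f n r) atTop (𝓝 (v r)))
    (hlim : Tendsto (fun n => energyDist R (f n) v) atTop (𝓝 0)) {r : ℝ} (hr : r ∈ Ioo 0 R)
    (n : ℕ) :
    ENNReal.ofReal |f n r - v r| ≤
      ENNReal.ofReal (Real.log (R / r)) ^ (1 / 2 : ℝ) * energyDist R (f n) v ^ (1 / 2 : ℝ) := by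
  set Λ := ENNReal.ofReal (Real.log (R / r)) ^ (1 / 2 : ℝ) with hΛ
  have hΛt : Λ ≠ ⊤ := ENNReal.rpow_ne_top_of_nonneg (by norm_num) ENNReal.ofReal_ne_top
  have hsm : ∀ n, ContDiff ℝ 1 (f n) := fun n => (hf n).1.of_le (by exact_mod_cast le_top)
  have h1 : ∀ m, ENNReal.ofReal |f n r - f m r| ≤
      Λ * energyDist R (f n) v ^ (1 / 2 : ℝ) + Λ * energyDist R (f m) v ^ (1 / 2 : ℝ) := by
    intro m
    -- Test functions vanish at R, so the increment from r to R is the value at r up to sign. This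
    -- is where the factor log(R/r) originates.
    have hR : ∀ k, f k R = 0 := fun k => (hf k).eq_zero_of_notMem fun h => lt_irrefl _ h.2
    have h2 := ofReal_abs_sub_le_lintegral ((hsm n).sub (hsm m)) hr.2.le
    have h3 : ∀ s, deriv (fun x => f n x - f m x) s = deriv (f n) s - deriv (f m) s := fun s =>
      deriv_fun_sub ((hsm n).differentiable one_ne_zero s) ((hsm m).differentiable one_ne_zero s)
    simp only [h3, hR, sub_zero, zero_sub, abs_neg] at h2
    refine h2.trans ((lintegral_abs_sub_le (v := v) _ _).trans (add_le_add ?_ ?_))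
    · exact lintegral_abs_le_energy ((measurable_deriv _).sub (measurable_deriv _)) hr.1 hr.2.le
        le_rfl
    · exact lintegral_abs_le_energy ((measurable_deriv _).sub (measurable_deriv _)) hr.1 hr.2.le
        le_rfl
  have h2 : Tendsto (fun m => ENNReal.ofReal |f n r - f m r|) atTop
      (𝓝 (ENNReal.ofReal |f n r - v r|)) :=
    (ENNReal.continuous_ofReal.tendsto _).comp ((hpt r hr).const_sub _).abs
  have h3 : Tendsto (fun m => Λ * energyDist R (f n) v ^ (1 / 2 : ℝ) +
      Λ * energyDist R (f m) v ^ (1 / 2 : ℝ)) atTop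
      (𝓝 (Λ * energyDist R (f n) v ^ (1 / 2 : ℝ))) := by
    have h4 : Tendsto (fun m => energyDist R (f m) v ^ (1 / 2 : ℝ)) atTop (𝓝 0) := by
      have := (ENNReal.continuous_rpow_const (y := 1 / 2)).tendsto 0 |>.comp hlim
      rwa [ENNReal.zero_rpow_of_pos (by norm_num)] at this
    have h5 := (ENNReal.Tendsto.const_mul h4 (Or.inr hΛt)).const_add
      (Λ * energyDist R (f n) v ^ (1 / 2 : ℝ))
    simpa using h5
  exact le_of_tendsto_of_tendsto' h2 h3 h1

/-- On [a, b] inside (0, R) the energy controls the L¹ norm of derivatives, so the fundamental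
theorem passes to the limit. Hence `deriv v`, which is 0 by default where v is not differentiable,
is a true weak derivative of v. -/
lemma MemEnergySpace.intervalIntegrable_and_integral {v : ℝ → ℝ} (hv : MemEnergySpace R v)
    {a b : ℝ} (ha : 0 < a) (hab : a ≤ b) (hb : b < R) :
    IntervalIntegrable (deriv v) volume a b ∧ ∫ r in a..b, deriv v r = v b - v a := by
  obtain ⟨f, hf, hpt, hlim⟩ := hv
  set Λ := ENNReal.ofReal (Real.log (b / a)) ^ (1 / 2 : ℝ) with hΛ
  have hΛt : Λ ≠ ⊤ := ENNReal.rpow_ne_top_of_nonneg (by norm_num) ENNReal.ofReal_ne_top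
  have hsm : ∀ n, ContDiff ℝ 1 (f n) := fun n => (hf n).1.of_le (by exact_mod_cast le_top)
  have hcs : ∀ n, ∫⁻ r in Ioo a b, ENNReal.ofReal |deriv (f n) r - deriv v r| ≤
      Λ * energyDist R (f n) v ^ (1 / 2 : ℝ) := fun n =>
    lintegral_abs_le_energy ((measurable_deriv _).sub (measurable_deriv _)) ha hab hb.le
  have hfi : ∀ n, IntervalIntegrable (deriv (f n)) volume a b := fun n =>
    ((hsm n).continuous_deriv le_rfl).intervalIntegrable _ _
  have hint : IntervalIntegrable (deriv v) volume a b := by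
    obtain ⟨n, hn⟩ := (hlim.eventually (gt_mem_nhds ENNReal.zero_lt_top)).exists
    have h1 : IntervalIntegrable (fun r => deriv (f n) r - deriv v r) volume a b := by
      rw [intervalIntegrable_iff_integrableOn_Ioo_of_le hab]
      refine ⟨((measurable_deriv _).sub (measurable_deriv _)).aestronglyMeasurable, ?_⟩
      rw [hasFiniteIntegral_iff_norm]
      simp only [Real.norm_eq_abs]
      refine (hcs n).trans_lt (ENNReal.mul_lt_top hΛt.lt_top ?_)
      exact (ENNReal.rpow_ne_top_of_nonneg (by norm_num) hn.ne).lt_top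
    have h2 := (hfi n).sub h1
    simpa using h2
  refine ⟨hint, ?_⟩
  have hlim2 : Tendsto (fun n => f n b - f n a) atTop (𝓝 (∫ r in a..b, deriv v r)) := by
    rw [tendsto_iff_edist_tendsto_0]
    have h4 : Tendsto (fun m => Λ * energyDist R (f m) v ^ (1 / 2 : ℝ)) atTop (𝓝 0) := by
      have := (ENNReal.continuous_rpow_const (y := 1 / 2)).tendsto 0 |>.comp hlim
      rw [ENNReal.zero_rpow_of_pos (by norm_num)] at this
      have h5 := ENNReal.Tendsto.const_mul this (Or.inr hΛt)
      rw [mul_zero] at h5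
      exact h5
    refine tendsto_of_tendsto_of_tendsto_of_le_of_le tendsto_const_nhds h4
      (fun _ => zero_le) fun n => ?_
    refine le_trans ?_ (hcs n)
    rw [← intervalIntegral.integral_deriv_eq_sub
      (fun x _ => (hsm n).differentiable one_ne_zero x) (hfi n), edist_eq_enorm_sub,
      ← intervalIntegral.integral_sub (hfi n) hint, intervalIntegral.integral_of_le hab,
      setLIntegral_congr Ioo_ae_eq_Ioc]
    have h := enorm_integral_le_lintegral_enorm (μ := volume.restrict (Ioc a b))
      (fun r => deriv (f n) r - deriv v r)
    simpa only [Real.enorm_eq_ofReal_abs] using h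
  exact tendsto_nhds_unique hlim2 ((hpt b ⟨ha.trans_le hab, hb⟩).sub (hpt a ⟨ha, hab.trans_lt hb⟩))

lemma MemEnergySpace.continuousOn {v : ℝ → ℝ} (hv : MemEnergySpace R v) :
    ContinuousOn v (Ioo 0 R) := by
  intro r hr
  obtain ⟨a, ha0, har⟩ := exists_between hr.1
  obtain ⟨b, hrb, hbR⟩ := exists_between hr.2
  have hab : a ≤ b := (har.trans hrb).le
  have h1 := (hv.intervalIntegrable_and_integral ha0 hab hbR).1
  have h2 : ContinuousOn (fun x => v a + ∫ t in a..x, deriv v t) (uIcc a b) :=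
    continuousOn_const.add (intervalIntegral.continuousOn_primitive_interval
      ((intervalIntegrable_iff' (by finiteness)).1 h1))
  rw [uIcc_of_le hab] at h2
  have h3 : EqOn v (fun x => v a + ∫ t in a..x, deriv v t) (Icc a b) := by
    intro x hx
    have := (hv.intervalIntegrable_and_integral ha0 hx.1 (hx.2.trans_lt hbR)).2
    simp only [this]
    ring
  exact ((h2.congr h3).continuousAt (Icc_mem_nhds har hrb)).continuousWithinAt

/-- Lebesgue differentiation of the primitive of `deriv v`, applied on a sequence of compact
intervals exhausting (0, R). -/
lemma MemEnergySpace.ae_differentiableAt {v : ℝ → ℝ} (hv : MemEnergySpace R v) :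
    ∀ᵐ r, r ∈ Ioo 0 R → DifferentiableAt ℝ v r := by
  rcases le_or_gt R 0 with hR | hR
  · exact Eventually.of_forall fun r hr => absurd (hr.1.trans hr.2) (not_lt.2 hR)
  have ha : ∀ n : ℕ, 0 < R / ((n : ℝ) + 3) := fun n => by positivity
  -- The shift by 3 keeps both endpoints in order already for n = 0.
  have hab : ∀ n : ℕ, R / ((n : ℝ) + 3) ≤ R - R / ((n : ℝ) + 3) := fun n => by
    have : R / ((n : ℝ) + 3) ≤ R / 2 := by gcongr; linarith [n.cast_nonneg (α := ℝ)]
    linarith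
  have hb : ∀ n : ℕ, R - R / ((n : ℝ) + 3) < R := fun n => by linarith [ha n]
  have h := fun n : ℕ =>
    (hv.intervalIntegrable_and_integral (ha n) (hab n) (hb n)).1.ae_hasDerivAt_integral
  rw [← ae_all_iff] at h
  filter_upwards [h] with r hr hr0
  have hlim : Tendsto (fun n : ℕ => R / ((n : ℝ) + 3)) atTop (𝓝 0) :=
    Tendsto.div_atTop tendsto_const_nhds
      (tendsto_atTop_add_const_right _ _ tendsto_natCast_atTop_atTop)
  have hlim2 : Tendsto (fun n : ℕ => R - R / ((n : ℝ) + 3)) atTop (𝓝 R) := by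
    simpa using hlim.const_sub R
  obtain ⟨n, hn1, hn2⟩ := ((hlim.eventually (gt_mem_nhds hr0.1)).and
    (hlim2.eventually (lt_mem_nhds hr0.2))).exists
  set a := R / ((n : ℝ) + 3)
  set b := R - R / ((n : ℝ) + 3)
  have h1 := hr n (by rw [uIcc_of_le (hab n)]; exact ⟨hn1.le, hn2.le⟩) a left_mem_uIcc
  refine (h1.const_add (v a)).differentiableAt.congr_of_eventuallyEq ?_
  filter_upwards [Ioo_mem_nhds hn1 hn2] with x hx
  have := (hv.intervalIntegrable_and_integral (ha n) hx.1.le (hx.2.trans (hb n))).2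
  rw [this]
  ring

/-- The derivative of the sum splits only where v is differentiable, hence the appeal to almost
everywhere differentiability. -/
lemma MemEnergySpace.add_smul_test {v φ : ℝ → ℝ} (hv : MemEnergySpace R v)
    (hφ : IsTestFunction (Ioo 0 R) φ) (τ : ℝ) :
    MemEnergySpace R (fun r => v r + τ * φ r) := by
  have hvd := hv.ae_differentiableAt
  obtain ⟨f, hf, hpt, hlim⟩ := hv
  refine ⟨fun n r => f n r + τ * φ r, fun n => ⟨?_, ?_, ?_⟩, fun r hr => ?_, ?_⟩
  · exact (hf n).1.add (contDiff_const.mul hφ.1)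
  · exact (hf n).2.1.add hφ.2.1.mul_left
  · refine (tsupport_add _ _).trans (union_subset (hf n).2.2 ?_)
    exact (tsupport_mul_subset_right).trans hφ.2.2
  · exact (hpt r hr).add_const _
  · refine hlim.congr fun n => ?_
    refine lintegral_congr_ae ?_
    filter_upwards [ae_restrict_of_ae hvd, self_mem_ae_restrict measurableSet_Ioo] with r hvr hr
    have hφd : DifferentiableAt ℝ (fun r => τ * φ r) r :=
      (hφ.1.differentiable (by simp) r).const_mul τ
    have e1 : deriv (fun r => f n r + τ * φ r) r = deriv (f n) r + deriv (fun r => τ * φ r) r :=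
      deriv_fun_add ((hf n).1.differentiable (by simp) r) hφd
    have e2 : deriv (fun r => v r + τ * φ r) r = deriv v r + deriv (fun r => τ * φ r) r :=
      deriv_fun_add (hvr hr) hφd
    simp only [e1, e2, add_sub_add_right_eq_sub]

end EnergySpace

/-! ### The extremals: their integrals and quotient -/

section Extremals

variable {N : ℕ} {R : ℝ}

lemma weightedExtremal_eq {r : ℝ} (hr : r ∈ Ioo 0 R) (μ ν : ℝ) :
    weightedExtremal N R μ ν r = sobolevExtremal N μ ν (logVar N R r) := by
  have h : ((-Real.log (r / R)) ^ (-(1 / ((N : ℝ) - 2)))) ^ 2 =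
      (-Real.log (r / R)) ^ (-(2 / ((N : ℝ) - 2))) := by
    rw [← Real.rpow_natCast ((-Real.log (r / R)) ^ (-(1 / ((N : ℝ) - 2)))),
      ← Real.rpow_mul (neg_log_div_pos hr).le]
    congr 1
    push_cast
    ring
  rw [weightedExtremal, sobolevExtremal, logVar, h]

lemma base_pos {μ : ℝ} (hμ : μ ≠ 0) (ν t : ℝ) : 0 < μ ^ 2 + ν ^ 2 * t ^ 2 := by positivity

lemma contDiff_sobolevExtremal {μ : ℝ} (hμ : μ ≠ 0) (ν : ℝ) :
    ContDiff ℝ ∞ (sobolevExtremal N μ ν) := by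
  unfold sobolevExtremal
  exact ContDiff.rpow_const_of_ne (by fun_prop) fun t => (base_pos hμ ν t).ne'

lemma deriv_sobolevExtremal {μ : ℝ} (hμ : μ ≠ 0) (ν t : ℝ) :
    deriv (sobolevExtremal N μ ν) t =
      -((N : ℝ) - 2) * ν ^ 2 * t * (μ ^ 2 + ν ^ 2 * t ^ 2) ^ (-((N : ℝ) / 2)) := by
  have h1 : HasDerivAt (fun t : ℝ => μ ^ 2 + ν ^ 2 * t ^ 2) (ν ^ 2 * (2 * t)) t := by
    simpa using ((hasDerivAt_pow 2 t).const_mul (ν ^ 2)).const_add (μ ^ 2)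
  have h2 := h1.rpow_const (p := -(((N : ℝ) - 2) / 2)) (Or.inl (base_pos hμ ν t).ne')
  change deriv (fun t => (μ ^ 2 + ν ^ 2 * t ^ 2) ^ (-(((N : ℝ) - 2) / 2))) t = _
  rw [h2.deriv, show -(((N : ℝ) - 2) / 2) - 1 = -((N : ℝ) / 2) by ring]
  ring

lemma sobolevExtremal_pos {μ : ℝ} (hμ : μ ≠ 0) (ν t : ℝ) : 0 < sobolevExtremal N μ ν t :=
  Real.rpow_pos_of_pos (base_pos hμ ν t) _

/-- The value `Γ(N/2)² / (2 Γ(N))` of the beta integral behind the sharp constants. -/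
noncomputable def betaConst (N : ℕ) : ℝ :=
  Real.Gamma ((N : ℝ) / 2) * Real.Gamma ((N : ℝ) / 2) / (2 * Real.Gamma N)

lemma contDiffOn_weightedExtremal {μ : ℝ} (hμ : μ ≠ 0) (ν : ℝ) :
    ContDiffOn ℝ ∞ (weightedExtremal N R μ ν) (Ioo 0 R) :=
  ((contDiff_sobolevExtremal (N := N) hμ ν).comp_contDiffOn contDiffOn_logVar).congr
    fun _ hr => weightedExtremal_eq hr μ ν

lemma differentiableAt_weightedExtremal {μ : ℝ} (hμ : μ ≠ 0) (ν : ℝ) {r : ℝ} (hr : r ∈ Ioo 0 R) :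
    DifferentiableAt ℝ (weightedExtremal N R μ ν) r :=
  ((contDiffOn_weightedExtremal hμ ν).contDiffAt (isOpen_Ioo.mem_nhds hr)).differentiableAt
    (by simp)

variable (hN : 3 ≤ N)
include hN

lemma betaConst_pos : 0 < betaConst N := by
  have hn' : (3 : ℝ) ≤ N := by exact_mod_cast hN
  have h1 : 0 < Real.Gamma ((N : ℝ) / 2) := Real.Gamma_pos_of_pos (by linarith)
  have h2 : 0 < Real.Gamma (N : ℝ) := Real.Gamma_pos_of_pos (by linarith)
  unfold betaConst
  positivity

lemma unitSphereArea_div_unitBallVolume :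
    unitSphereArea N / unitBallVolume N = N * betaConst N * 2 ^ (N : ℝ) := by
  have hn' : (3 : ℝ) ≤ N := by exact_mod_cast hN
  have hn0 : (0 : ℝ) < N := by linarith
  have h1 : 0 < Real.Gamma ((N : ℝ) / 2) := Real.Gamma_pos_of_pos (by linarith)
  have h2 : 0 < Real.Gamma (N : ℝ) := Real.Gamma_pos_of_pos hn0
  have hb := unitBallVolume_pos (N := N) (by omega)
  have h3 := mul_unitBallVolume_eq (N := N) (by omega)
  have hpi : 0 < Real.pi ^ ((N : ℝ) / 2) := Real.rpow_pos_of_pos Real.pi_pos _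
  have h4 : unitBallVolume N = 2 * Real.pi ^ ((N : ℝ) / 2) / Real.Gamma ((N : ℝ) / 2) / N := by
    rw [← h3]
    field_simp
  rw [h4, unitSphereArea_eq_Gamma (by omega), betaConst]
  field_simp

/-- The power 2N/(N-2) turns the exponent -(N-2)/2 into -N, so the beta integral applies with α =
N/2 and c = N. -/
lemma radialPower_sobolevExtremal {μ ν : ℝ} (hμ : μ ≠ 0) (hν : ν ≠ 0) :
    radialPower N (sobolevExtremal N μ ν) =
      ENNReal.ofReal (betaConst N * (μ ^ 2 * ν ^ 2) ^ (-((N : ℝ) / 2))) := by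
  have hn' : (3 : ℝ) ≤ N := by exact_mod_cast hN
  have hn2 : (N : ℝ) - 2 ≠ 0 := by intro h; linarith
  have h := lintegral_rpow_mul_add_sq_rpow (α := (N : ℝ) / 2) (c := N) (a := μ ^ 2) (b := ν ^ 2)
    (by linarith) (by linarith) (by positivity) (by positivity)
  rw [Real.mul_rpow (by positivity) (by positivity), radialPower, betaConst]
  rw [show (N : ℝ) - N / 2 = N / 2 by ring, show 2 * ((N : ℝ) / 2) - 1 = N - 1 by ring] at h
  rw [mul_comm ((μ ^ 2) ^ (-((N : ℝ) / 2))), ← h]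
  refine setLIntegral_congr_fun measurableSet_Ioi fun t _ => ?_
  have e : |sobolevExtremal N μ ν t| ^ (2 * (N : ℝ) / ((N : ℝ) - 2)) =
      (μ ^ 2 + ν ^ 2 * t ^ 2) ^ (-(N : ℝ)) := by
    rw [abs_of_pos (sobolevExtremal_pos hμ ν t), sobolevExtremal,
      ← Real.rpow_mul (base_pos hμ ν t).le]
    congr 1
    field_simp
  simp only [e]

/-- The derivative contributes an extra t², so the beta integral applies with α = N/2 + 1 and c = N;
its Gamma factors reduce to those of the power integral. -/
lemma radialEnergy_sobolevExtremal {μ ν : ℝ} (hμ : μ ≠ 0) (hν : ν ≠ 0) :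
    radialEnergy N (sobolevExtremal N μ ν) =
      ENNReal.ofReal ((N : ℝ) * ((N : ℝ) - 2) * betaConst N *
        (μ ^ 2 * ν ^ 2) ^ (-(((N : ℝ) - 2) / 2))) := by
  have hn' : (3 : ℝ) ≤ N := by exact_mod_cast hN
  have hn2 : 0 < (N : ℝ) - 2 := by linarith
  have h := lintegral_rpow_mul_add_sq_rpow (α := (N : ℝ) / 2 + 1) (c := N) (a := μ ^ 2)
    (b := ν ^ 2) (by linarith) (by linarith) (by positivity) (by positivity)
  have h1 : radialEnergy N (sobolevExtremal N μ ν) =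
      ENNReal.ofReal (((N : ℝ) - 2) ^ 2 * (ν ^ 2) ^ 2) * ∫⁻ t in Ioi (0 : ℝ),
        ENNReal.ofReal (t ^ (2 * ((N : ℝ) / 2 + 1) - 1) *
          (μ ^ 2 + ν ^ 2 * t ^ 2) ^ (-(N : ℝ))) := by
    rw [radialEnergy, ← lintegral_const_mul' _ _ ENNReal.ofReal_ne_top]
    refine setLIntegral_congr_fun measurableSet_Ioi fun t ht => ?_
    have ht0 : (0 : ℝ) < t := ht
    have hb := base_pos hμ ν t
    simp only [deriv_sobolevExtremal hμ, sq_abs]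
    rw [← ENNReal.ofReal_mul (by positivity)]
    congr 1
    rw [mul_pow _ ((μ ^ 2 + ν ^ 2 * t ^ 2) ^ (-((N : ℝ) / 2))),
      ← Real.rpow_natCast ((μ ^ 2 + ν ^ 2 * t ^ 2) ^ (-((N : ℝ) / 2))), ← Real.rpow_mul hb.le,
      show 2 * ((N : ℝ) / 2 + 1) - 1 = (N - 1) + (2 : ℕ) by push_cast; ring, Real.rpow_add ht0,
      Real.rpow_natCast]
    have : -((N : ℝ) / 2) * ((2 : ℕ) : ℝ) = -N := by push_cast; ring
    rw [this]
    ring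
  rw [h1, h, ← ENNReal.ofReal_mul (by positivity)]
  congr 1
  have g1 : Real.Gamma ((N : ℝ) / 2 + 1) = (N : ℝ) / 2 * Real.Gamma ((N : ℝ) / 2) :=
    Real.Gamma_add_one (by positivity)
  have g2 : Real.Gamma ((N : ℝ) / 2) = ((N : ℝ) / 2 - 1) * Real.Gamma ((N : ℝ) / 2 - 1) := by
    rw [← Real.Gamma_add_one (by linarith)]
    congr 1
    ring
  have g3 : 0 < Real.Gamma ((N : ℝ) / 2 - 1) := Real.Gamma_pos_of_pos (by linarith)
  have g4 : 0 < Real.Gamma (N : ℝ) := Real.Gamma_pos_of_pos (by linarith)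
  have e1 : (ν ^ 2) ^ (-((N : ℝ) / 2 + 1)) = (ν ^ 2) ^ (-(((N : ℝ) - 2) / 2)) / (ν ^ 2) ^ 2 := by
    have hν2 : (0 : ℝ) < ν ^ 2 := by positivity
    rw [← Real.rpow_natCast (ν ^ 2) 2, ← Real.rpow_sub hν2]
    congr 1
    push_cast
    ring
  rw [betaConst, Real.mul_rpow (by positivity) (by positivity), e1,
    show (N : ℝ) - (N / 2 + 1) = N / 2 - 1 by ring,
    show -((N : ℝ) / 2 - 1) = -(((N : ℝ) - 2) / 2) by ring, g1]
  have hν2 : (0 : ℝ) < ν ^ 2 := by positivity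
  rw [g2, show (N : ℝ) / 2 - 1 = ((N : ℝ) - 2) / 2 by ring]
  field_simp

lemma weightedEnergy_weightedExtremal (hR : 0 < R) {μ ν : ℝ} (hμ : μ ≠ 0) (hν : ν ≠ 0) :
    weightedEnergy R (weightedExtremal N R μ ν) =
      ENNReal.ofReal ((N : ℝ) * betaConst N * (μ ^ 2 * ν ^ 2) ^ (-(((N : ℝ) - 2) / 2))) := by
  have hn' : (3 : ℝ) ≤ N := by exact_mod_cast hN
  have hn2 : 0 < (N : ℝ) - 2 := by linarith
  rw [weightedEnergy_eq hN hR (fun r hr => differentiableAt_weightedExtremal hμ ν hr)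
    (fun r hr => weightedExtremal_eq hr μ ν), radialEnergy_sobolevExtremal hN hμ hν,
    ← ENNReal.ofReal_mul (by positivity)]
  congr 1
  field_simp

lemma weightedPotential_weightedExtremal (hR : 0 < R) {μ ν : ℝ} (hμ : μ ≠ 0) (hν : ν ≠ 0) :
    weightedPotential N R (weightedExtremal N R μ ν) =
      ENNReal.ofReal ((((N : ℝ) - 2) * betaConst N) ^ (((N : ℝ) - 2) / (N : ℝ)) *
        (μ ^ 2 * ν ^ 2) ^ (-(((N : ℝ) - 2) / 2))) := by
  have hn' : (3 : ℝ) ≤ N := by exact_mod_cast hN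
  have hn2 : 0 < (N : ℝ) - 2 := by linarith
  have hβ := betaConst_pos hN
  rw [weightedPotential_eq hN hR (fun r hr => weightedExtremal_eq hr μ ν),
    radialPower_sobolevExtremal hN hμ hν, ← ENNReal.ofReal_mul hn2.le, ← mul_assoc,
    ENNReal.ofReal_rpow_of_nonneg (by positivity) (by positivity),
    Real.mul_rpow (by positivity) (by positivity), ← Real.rpow_mul (by positivity)]
  congr 3
  field_simp

/-- |𝕊_N|/ω_N is 2^N N times the beta constant, so C_M takes exactly the form of the quotient
computed for the extremals. -/
lemma weightedConst_eq_betaConst :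
    weightedConst N = N * betaConst N / (((N : ℝ) - 2) * betaConst N) ^ (((N : ℝ) - 2) / (N : ℝ)) := by
  have hn' : (3 : ℝ) ≤ N := by exact_mod_cast hN
  have hn0 : (0 : ℝ) < N := by linarith
  have hn2 : 0 < (N : ℝ) - 2 := by linarith
  have hβ := betaConst_pos hN
  have t : ∀ x : ℝ, 0 < x → x ^ (((N : ℝ) - 2) / (N : ℝ)) = x / x ^ (2 / (N : ℝ)) := by
    intro x hx
    rw [sub_div, div_self hn0.ne', Real.rpow_sub hx, Real.rpow_one]
  have h4 : ((2 : ℝ) ^ (N : ℝ)) ^ (2 / (N : ℝ)) = 4 := by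
    rw [← Real.rpow_mul zero_le_two, mul_div_cancel₀ _ hn0.ne']; norm_num
  rw [weightedConst_eq hN, unitSphereArea_div_unitBallVolume hN, Real.mul_rpow (by positivity)
    (by positivity), h4, Real.div_rpow hn0.le hn2.le, Real.mul_rpow hn2.le hβ.le, t _ hn0, t _ hβ,
    Real.mul_rpow hn0.le hβ.le]
  have := Real.rpow_pos_of_pos hn0 (2 / (N : ℝ))
  have := Real.rpow_pos_of_pos hβ (2 / (N : ℝ))
  have := Real.rpow_pos_of_pos hn2 (((N : ℝ) - 2) / (N : ℝ))
  field_simp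

lemma weightedPotential_weightedExtremal_pos (hR : 0 < R) {μ ν : ℝ} (hμ : μ ≠ 0) (hν : ν ≠ 0) :
    weightedPotential N R (weightedExtremal N R μ ν) ≠ 0 := by
  have hn' : (3 : ℝ) ≤ N := by exact_mod_cast hN
  have hn2 : 0 < (N : ℝ) - 2 := by linarith
  have hβ := betaConst_pos hN
  rw [weightedPotential_weightedExtremal hN hR hμ hν, Ne, ENNReal.ofReal_eq_zero, not_le]
  positivity

/-- Energy and potential carry the same power of μ²ν², so the parameters cancel. -/
lemma weightedQuotient_weightedExtremal (hR : 0 < R) {μ ν : ℝ} (hμ : μ ≠ 0) (hν : ν ≠ 0) :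
    weightedQuotient N R (weightedExtremal N R μ ν) = ENNReal.ofReal (weightedConst N) := by
  have hn' : (3 : ℝ) ≤ N := by exact_mod_cast hN
  have hn2 : 0 < (N : ℝ) - 2 := by linarith
  have hβ := betaConst_pos hN
  rw [weightedQuotient, weightedEnergy_weightedExtremal hN hR hμ hν,
    weightedPotential_weightedExtremal hN hR hμ hν, ← ENNReal.ofReal_div_of_pos (by positivity),
    weightedConst_eq_betaConst hN]
  congr 1
  have : 0 < (μ ^ 2 * ν ^ 2) ^ (-(((N : ℝ) - 2) / 2)) := by positivity
  field_simp

/-- In the variable t this is (N-2) ∫ t^(N-3) ψ² dt, a convergent beta integral with α = (N-2)/2 and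
c = N-2. It controls the cutoff error in the approximation by test functions. -/
lemma lintegral_hardy_weightedExtremal (hR : 0 < R) {μ ν : ℝ} (hμ : μ ≠ 0) (hν : ν ≠ 0) :
    ∫⁻ r in Ioo 0 R, ENNReal.ofReal
      ((weightedExtremal N R μ ν r) ^ 2 / (r * (-Real.log (r / R)) ^ 2)) ≠ ⊤ := by
  have hn' : (3 : ℝ) ≤ N := by exact_mod_cast hN
  have hn2 : 0 < (N : ℝ) - 2 := by linarith
  have h := lintegral_rpow_mul_add_sq_rpow (α := ((N : ℝ) - 2) / 2) (c := (N : ℝ) - 2) (a := μ ^ 2)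
    (b := ν ^ 2) (by linarith) (by linarith) (by positivity) (by positivity)
  rw [lintegral_Ioo_eq_expVar hN hR]
  have h1 : ∫⁻ t in Ioi (0 : ℝ),
      ENNReal.ofReal (((N : ℝ) - 2) * t ^ (-((N : ℝ) - 1)) * expVar N R t) *
        ENNReal.ofReal ((weightedExtremal N R μ ν (expVar N R t)) ^ 2 /
          (expVar N R t * (-Real.log (expVar N R t / R)) ^ 2)) =
      ENNReal.ofReal ((N : ℝ) - 2) * ∫⁻ t in Ioi (0 : ℝ),
        ENNReal.ofReal (t ^ (2 * (((N : ℝ) - 2) / 2) - 1) *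
          (μ ^ 2 + ν ^ 2 * t ^ 2) ^ (-((N : ℝ) - 2))) := by
    rw [← lintegral_const_mul' _ _ ENNReal.ofReal_ne_top]
    refine setLIntegral_congr_fun measurableSet_Ioi fun t ht => ?_
    have ht0 : (0 : ℝ) < t := ht
    have hb := base_pos hμ ν t
    have hr := expVar_mem (N := N) hR ht0
    have hr0 := hr.1
    rw [← ENNReal.ofReal_mul (by positivity), ← ENNReal.ofReal_mul hn2.le,
      weightedExtremal_eq hr, logVar_expVar hN hR ht0, neg_log_expVar_div hR, sobolevExtremal,
      ← Real.rpow_natCast (_ ^ _) 2, ← Real.rpow_mul hb.le, ← Real.rpow_natCast (t ^ _) 2,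
      ← Real.rpow_mul ht0.le]
    congr 1
    have e1 : -((N : ℝ) - 2) / 2 * ((2 : ℕ) : ℝ) = -((N : ℝ) - 2) := by push_cast; ring
    have e2 : t ^ (2 * (((N : ℝ) - 2) / 2) - 1) =
        t ^ (-((N : ℝ) - 1)) / t ^ (-((N : ℝ) - 2) * ((2 : ℕ) : ℝ)) := by
      rw [← Real.rpow_sub ht0]
      congr 1
      push_cast
      ring
    rw [← neg_div, e1, e2]
    have h5 : 0 < t ^ (-((N : ℝ) - 2) * ((2 : ℕ) : ℝ)) := by positivity
    field_simp
  rw [h1, h]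
  exact ENNReal.mul_ne_top ENNReal.ofReal_ne_top ENNReal.ofReal_ne_top

end Extremals

/-! ### Cutoffs in log(-log(r/R)) and membership in the energy space -/

/-- The logarithmic variable `s = log(-log(r/R))` on `(0, R)`. -/
noncomputable def logLogVar (R r : ℝ) : ℝ := Real.log (-Real.log (r / R))

/-- The inverse of `logLogVar`. -/
noncomputable def expExpVar (R s : ℝ) : ℝ := R * Real.exp (-Real.exp s)

section LogLog

variable {R : ℝ}

lemma expExpVar_mem (hR : 0 < R) (s : ℝ) : expExpVar R s ∈ Ioo 0 R := by
  refine ⟨by unfold expExpVar; positivity, ?_⟩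
  unfold expExpVar
  have : Real.exp (-Real.exp s) < 1 := by
    rw [Real.exp_lt_one_iff]
    linarith [Real.exp_pos s]
  nlinarith

lemma neg_log_expExpVar_div (hR : 0 < R) (s : ℝ) : -Real.log (expExpVar R s / R) = Real.exp s := by
  rw [expExpVar, mul_div_cancel_left₀ _ hR.ne', Real.log_exp, neg_neg]

lemma logLogVar_expExpVar (hR : 0 < R) (s : ℝ) : logLogVar R (expExpVar R s) = s := by
  rw [logLogVar, neg_log_expExpVar_div hR, Real.log_exp]

lemma expExpVar_logLogVar {r : ℝ} (hr : r ∈ Ioo 0 R) : expExpVar R (logLogVar R r) = r := by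
  have hR : 0 < R := hr.1.trans hr.2
  rw [expExpVar, logLogVar, Real.exp_log (neg_log_div_pos hr), neg_neg,
    Real.exp_log (div_pos hr.1 hR), mul_div_cancel₀ _ hR.ne']

lemma contDiff_expExpVar : ContDiff ℝ ∞ (expExpVar R) := by
  unfold expExpVar
  fun_prop

lemma hasDerivAt_expExpVar (s : ℝ) :
    HasDerivAt (expExpVar R) (-(Real.exp s * expExpVar R s)) s := by
  have h := (((Real.hasDerivAt_exp s).neg).exp).const_mul R
  convert! h using 1
  simp only [Pi.neg_apply]
  unfold expExpVar
  ring

lemma contDiffOn_logLogVar : ContDiffOn ℝ ∞ (logLogVar R) (Ioo 0 R) := by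
  intro r hr
  have hR : 0 < R := hr.1.trans hr.2
  have h1 : ContDiffAt ℝ ∞ (fun r => -Real.log (r / R)) r :=
    ((contDiffAt_id.div_const R).log (div_pos hr.1 hR).ne').neg
  exact (h1.log (neg_log_div_pos hr).ne').contDiffWithinAt

lemma hasDerivAt_logLogVar {r : ℝ} (hr : r ∈ Ioo 0 R) :
    HasDerivAt (logLogVar R) (-(1 / (r * -Real.log (r / R)))) r := by
  have hR : 0 < R := hr.1.trans hr.2
  have h0 := neg_log_div_pos hr
  have h1 := (((hasDerivAt_id r).div_const R).log (div_pos hr.1 hR).ne').neg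
  have h2 := h1.log h0.ne'
  convert! h2 using 1
  have hr0 := hr.1
  simp only [id, Pi.neg_apply]
  field_simp

/-- Smooth functions with finite energy and finite Hardy integral lie in the energy space. -/
lemma memEnergySpace_of_contDiffOn (hR : 0 < R) {v : ℝ → ℝ} (hv : ContDiffOn ℝ ∞ v (Ioo 0 R))
    (hE : weightedEnergy R v ≠ ⊤)
    (hH : ∫⁻ r in Ioo 0 R, ENNReal.ofReal (v r ^ 2 / (r * (-Real.log (r / R)) ^ 2)) ≠ ⊤) :
    MemEnergySpace R v := by
  let χ : ContDiffBump (0 : ℝ) := ⟨1, 2, one_pos, one_lt_two⟩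
  have hχs : ContDiff ℝ ∞ χ := χ.contDiff
  obtain ⟨C, hC⟩ := (hχs.continuous_deriv (by simp))
    |>.bounded_above_of_compact_support χ.hasCompactSupport.deriv
  have hC0 : 0 ≤ C := (norm_nonneg _).trans (hC 0)
  have hn : ∀ n : ℕ, (0 : ℝ) < (n : ℝ) + 1 := fun n => by positivity
  -- In the variable s the interval (0, R) is the whole line, so wide bumps χ(s/(n+1)) cut off both
  -- ends at once.
  set F : ℕ → ℝ → ℝ := fun n s => χ (s / ((n : ℝ) + 1)) * v (expExpVar R s) with hF
  have hFtest : ∀ n, IsTestFunction univ (F n) := by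
    intro n
    refine ⟨?_, ?_, subset_univ _⟩
    · refine ContDiff.mul (hχs.comp (contDiff_id.div_const _)) ?_
      refine contDiff_iff_contDiffAt.2 fun s => ?_
      exact (hv.contDiffAt (isOpen_Ioo.mem_nhds (expExpVar_mem hR s))).comp s
        contDiff_expExpVar.contDiffAt
    · refine HasCompactSupport.mul_right ?_
      refine HasCompactSupport.intro (isCompact_Icc (a := -(2 * ((n : ℝ) + 1)))
        (b := 2 * ((n : ℝ) + 1))) fun s hs => ?_
      refine χ.zero_of_le_dist ?_
      change (2 : ℝ) ≤ _
      rw [Real.dist_eq, sub_zero, abs_div, abs_of_pos (hn n), le_div_iff₀ (hn n)]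
      by_contra hlt
      exact hs (abs_le.1 (not_le.1 hlt).le)
  -- For n large the truncated function equals v on a neighbourhood of r, so values and derivatives
  -- agree there.
  have hpt : ∀ r ∈ Ioo 0 R, ∀ᶠ n : ℕ in atTop,
      (Ioo 0 R).indicator (fun r => F n (logLogVar R r)) =ᶠ[𝓝 r] v := by
    intro r hr
    obtain ⟨n₀, hn₀⟩ := exists_nat_gt |logLogVar R r|
    filter_upwards [eventually_ge_atTop n₀] with n hnn
    have h1 : |logLogVar R r| < (n : ℝ) + 1 := by
      have : (n₀ : ℝ) ≤ n := by exact_mod_cast hnn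
      linarith
    have h2 : ContinuousAt (fun r => |logLogVar R r|) r :=
      (hasDerivAt_logLogVar hr).continuousAt.abs
    filter_upwards [isOpen_Ioo.mem_nhds hr, h2.eventually (gt_mem_nhds h1)] with x hx hx2
    rw [indicator_of_mem hx, hF]
    simp only
    rw [χ.one_of_mem_closedBall, one_mul, expExpVar_logLogVar hx]
    change _ ∈ Metric.closedBall (0 : ℝ) 1
    rw [mem_closedBall_zero_iff, Real.norm_eq_abs, abs_div, abs_of_pos (hn n), div_le_one (hn n)]
    exact hx2.le
  have hvd : ∀ r ∈ Ioo 0 R, DifferentiableAt ℝ v r := fun r hr =>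
    (hv.contDiffAt (isOpen_Ioo.mem_nhds hr)).differentiableAt (by simp)
  refine ⟨fun n => (Ioo 0 R).indicator fun r => F n (logLogVar R r), fun n => ?_, fun r hr => ?_,
    ?_⟩
  · exact (hFtest n).indicator_comp isOpen_Ioo contDiffOn_logLogVar
      contDiff_expExpVar.continuous.continuousOn (fun s _ => expExpVar_mem hR s)
      (fun r hr => expExpVar_logLogVar hr)
  · refine tendsto_const_nhds.congr' ?_
    filter_upwards [hpt r hr] with n hnn using hnn.eq_of_nhds.symm
  -- Since |ds/dr| = 1/(r(-log(r/R))), the derivative of the cutoff times v is bounded by the Hardy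
  -- integrand, uniformly in n.
  · have hdom : ∀ n : ℕ, ∀ r ∈ Ioo 0 R,
        r * |deriv ((Ioo 0 R).indicator fun r => F n (logLogVar R r)) r - deriv v r| ^ 2 ≤
        2 * (r * |deriv v r| ^ 2) + 2 * C ^ 2 * (v r ^ 2 / (r * (-Real.log (r / R)) ^ 2)) := by
      intro n r hr
      have hL := neg_log_div_pos hr
      have hr0 := hr.1
      have h1 : (Ioo 0 R).indicator (fun r => F n (logLogVar R r)) =ᶠ[𝓝 r]
          fun r => χ (logLogVar R r / ((n : ℝ) + 1)) * v r := by
        filter_upwards [isOpen_Ioo.mem_nhds hr] with x hx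
        rw [indicator_of_mem hx, hF]
        simp only
        rw [expExpVar_logLogVar hx]
      have h2 : HasDerivAt (fun r => χ (logLogVar R r / ((n : ℝ) + 1))) 
          (deriv χ (logLogVar R r / ((n : ℝ) + 1)) *
            (-(1 / (r * -Real.log (r / R))) / ((n : ℝ) + 1))) r :=
        ((hχs.differentiable (by simp) _).hasDerivAt).comp r
          ((hasDerivAt_logLogVar hr).div_const _)
      rw [h1.deriv_eq, (HasDerivAt.fun_mul h2 (hvd r hr).hasDerivAt).deriv]
      set x := χ (logLogVar R r / ((n : ℝ) + 1)) with hx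
      set d := deriv χ (logLogVar R r / ((n : ℝ) + 1)) with hd
      set L := -Real.log (r / R) with hLdef
      have hx0 : 0 ≤ x := χ.nonneg
      have hx1 : x ≤ 1 := χ.le_one
      have hd2 : d ^ 2 ≤ C ^ 2 := by
        have := hC (logLogVar R r / ((n : ℝ) + 1))
        rw [Real.norm_eq_abs] at this
        rw [← sq_abs]
        gcongr
      have e : d * (-(1 / (r * L)) / ((n : ℝ) + 1)) * v r + x * deriv v r - deriv v r =
          (x - 1) * deriv v r + -(d / ((n : ℝ) + 1)) * (v r / (r * L)) := by
        field_simp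
        ring
      rw [e, sq_abs, sq_abs]
      have h3 : ((x - 1) * deriv v r) ^ 2 ≤ deriv v r ^ 2 := by
        rw [mul_pow]
        have : (x - 1) ^ 2 ≤ 1 := by nlinarith
        nlinarith [sq_nonneg (deriv v r)]
      have h4 : (-(d / ((n : ℝ) + 1)) * (v r / (r * L))) ^ 2 ≤ C ^ 2 * (v r / (r * L)) ^ 2 := by
        rw [mul_pow, neg_sq, div_pow]
        have h5 : d ^ 2 / ((n : ℝ) + 1) ^ 2 ≤ C ^ 2 := by
          refine (div_le_self (sq_nonneg d) ?_).trans hd2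
          nlinarith [n.cast_nonneg (α := ℝ)]
        gcongr
      have h6 : r * (v r / (r * L)) ^ 2 = v r ^ 2 / (r * L ^ 2) := by field_simp
      have h7 := add_sq_le (a := (x - 1) * deriv v r) (b := -(d / ((n : ℝ) + 1)) * (v r / (r * L)))
      calc _ ≤ r * (2 * (((x - 1) * deriv v r) ^ 2 +
            (-(d / ((n : ℝ) + 1)) * (v r / (r * L))) ^ 2)) := by gcongr
        _ ≤ r * (2 * (deriv v r ^ 2 + C ^ 2 * (v r / (r * L)) ^ 2)) := by gcongr
        _ = 2 * (r * deriv v r ^ 2) + 2 * C ^ 2 * (r * (v r / (r * L)) ^ 2) := by ring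
        _ = _ := by rw [h6]
    have hlim := tendsto_lintegral_of_dominated_convergence (μ := volume.restrict (Ioo 0 R))
      (F := fun n r => ENNReal.ofReal
        (r * |deriv ((Ioo 0 R).indicator fun r => F n (logLogVar R r)) r - deriv v r| ^ 2))
      (f := fun _ => 0)
      (fun r => ENNReal.ofReal (2 * (r * |deriv v r| ^ 2)) +
        ENNReal.ofReal (2 * C ^ 2 * (v r ^ 2 / (r * (-Real.log (r / R)) ^ 2))))
      (fun n => by
        have h1 := measurable_deriv ((Ioo 0 R).indicator fun r => F n (logLogVar R r))
        have h2 := measurable_deriv v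
        fun_prop)
      (fun n => by
        filter_upwards [self_mem_ae_restrict measurableSet_Ioo] with r hr
        exact (ENNReal.ofReal_le_ofReal (hdom n r hr)).trans ENNReal.ofReal_add_le)
      (by
        have h2 := measurable_deriv v
        rw [lintegral_add_left (by fun_prop)]
        simp only [ENNReal.ofReal_mul (zero_le_two (α := ℝ)), 
          ENNReal.ofReal_mul (by positivity : 0 ≤ 2 * C ^ 2)]
        rw [lintegral_const_mul' _ _ (by simp), lintegral_const_mul' _ _ (by finiteness)]
        exact ENNReal.add_ne_top.2 ⟨ENNReal.mul_ne_top (by simp) hE,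
          ENNReal.mul_ne_top (by finiteness) hH⟩)
      (by
        filter_upwards [self_mem_ae_restrict measurableSet_Ioo] with r hr
        refine tendsto_const_nhds.congr' ?_
        filter_upwards [hpt r hr] with n hnn
        rw [hnn.deriv_eq]
        simp)
    simpa using hlim

lemma memEnergySpace_weightedExtremal {N : ℕ} (hN : 3 ≤ N) (hR : 0 < R) {μ ν : ℝ} (hμ : μ ≠ 0)
    (hν : ν ≠ 0) : MemEnergySpace R (weightedExtremal N R μ ν) := by
  refine memEnergySpace_of_contDiffOn hR (contDiffOn_weightedExtremal hμ ν) ?_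
    (lintegral_hardy_weightedExtremal hN hR hμ hν)
  rw [weightedEnergy_weightedExtremal hN hR hμ hν]
  exact ENNReal.ofReal_ne_top

end LogLog

/-! ### The best constant -/

/-- The best constant in the weighted inequality. -/
lemma isGreatest_weightedConst {N : ℕ} (hN : 3 ≤ N) {R : ℝ} (hR : 0 < R) :
    IsGreatest {c : ℝ | ∀ v : ℝ → ℝ, IsTestFunction (Ioo 0 R) v → WeightedIneq N R c v}
      (weightedConst N) := by
  refine ⟨fun v hv => weightedIneq_weightedConst hN hR hv, fun c hc => ?_⟩
  -- Optimality is tested on an extremal: it is not a test function, but any admissible c is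
  -- admissible on the energy space too.
  have h := (memEnergySpace_weightedExtremal hN hR one_ne_zero one_ne_zero).weightedIneq hN hc
  have h0 := weightedPotential_weightedExtremal_pos hN hR one_ne_zero one_ne_zero
  have ht : weightedPotential N R (weightedExtremal N R 1 1) ≠ ⊤ := by
    rw [weightedPotential_weightedExtremal hN hR one_ne_zero one_ne_zero]
    exact ENNReal.ofReal_ne_top
  have h2 := (ENNReal.le_div_iff_mul_le (Or.inl h0) (Or.inl ht)).2 h
  have h3 := weightedQuotient_weightedExtremal hN hR one_ne_zero one_ne_zero
  rw [weightedQuotient] at h3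
  rw [h3] at h2
  exact (ENNReal.ofReal_le_ofReal_iff (weightedConst_pos hN).le).1 h2

/-! ### First variation at a minimizer -/

section EulerLagrange

variable {N : ℕ} {R : ℝ}

/-- The tangent line inequality for `x ↦ |x| ^ p`. -/
lemma abs_rpow_add_mul_le {p : ℝ} (hp : 1 ≤ p) (a b : ℝ) :
    |a| ^ p + p * (|a| ^ (p - 2) * a) * b ≤ |a + b| ^ p := by
  rcases eq_or_ne a 0 with rfl | ha
  · rw [abs_zero, Real.zero_rpow (by linarith)]
    simp only [mul_zero, zero_mul, add_zero]
    positivity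
  have ha' : 0 < |a| := abs_pos.2 ha
  have h1 : 1 + p * (b / a) ≤ |1 + b / a| ^ p := by
    -- Bernoulli's inequality covers b/a ≥ -1; below -1 the left side is negative because p ≥ 1.
    rcases le_or_gt (-1) (b / a) with h | h
    · rw [abs_of_nonneg (by linarith)]
      exact one_add_mul_self_le_rpow_one_add h hp
    · have : (0 : ℝ) ≤ |1 + b / a| ^ p := by positivity
      nlinarith
  have h2 : a + b = a * (1 + b / a) := by field_simp
  have h3 : |a| ^ (p - 2) * a = |a| ^ p / a := by
    rw [Real.rpow_sub ha', Real.rpow_two, sq_abs]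
    field_simp
  rw [h2, abs_mul, Real.mul_rpow ha'.le (abs_nonneg _), h3]
  calc _ = |a| ^ p * (1 + p * (b / a)) := by ring
    _ ≤ _ := by gcongr

/-- The weight `r⁻¹ (-log (r/R))^(-2(N-1)/(N-2))` of the potential term. -/
noncomputable def potentialWeight (N : ℕ) (R r : ℝ) : ℝ :=
  r⁻¹ * (-Real.log (r / R)) ^ (-(2 * ((N : ℝ) - 1) / ((N : ℝ) - 2)))

lemma potentialWeight_pos {r : ℝ} (hr : r ∈ Ioo 0 R) : 0 < potentialWeight N R r :=
  mul_pos (inv_pos.2 hr.1) (Real.rpow_pos_of_pos (neg_log_div_pos hr) _)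

lemma continuousOn_potentialWeight : ContinuousOn (potentialWeight N R) (Ioo 0 R) := by
  intro r hr
  have hR : 0 < R := hr.1.trans hr.2
  have hr0 := hr.1
  have h1 : ContinuousAt (fun r => -Real.log (r / R)) r :=
    ((continuousAt_id.div_const R).log (by positivity)).neg
  exact ((continuousAt_inv₀ hr0.ne').mul
    (h1.rpow_const (Or.inl (neg_log_div_pos hr).ne'))).continuousWithinAt

lemma continuousOn_abs_rpow_mul {q : ℝ} (hq : 0 ≤ q) {v : ℝ → ℝ} {s : Set ℝ}
    (hv : ContinuousOn v s) : ContinuousOn (fun r => |v r| ^ q * v r) s :=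
  (hv.abs.rpow_const fun _ _ => Or.inr hq).mul hv

lemma IsTestFunction.isTestFunction_deriv {U : Set ℝ} {φ : ℝ → ℝ} (hφ : IsTestFunction U φ) :
    IsTestFunction U (deriv φ) :=
  ⟨(contDiff_infty_iff_deriv.1 hφ.1).2, hφ.2.1.deriv, (tsupport_deriv_subset (𝕜 := ℝ)).trans hφ.2.2⟩

lemma IsTestFunction.continuous_mul {U : Set ℝ} (hU : IsOpen U) {g φ : ℝ → ℝ}
    (hφ : IsTestFunction U φ) (hg : ContinuousOn g U) : Continuous (fun r => g r * φ r) :=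
  (hg.mul hφ.1.continuous.continuousOn).continuous_of_tsupport_subset hU
    (tsupport_mul_subset_right.trans hφ.2.2)

lemma IsTestFunction.integrable_mul {U : Set ℝ} (hU : IsOpen U) {g φ : ℝ → ℝ}
    (hφ : IsTestFunction U φ) (hg : ContinuousOn g U) : Integrable (fun r => g r * φ r) :=
  (hφ.continuous_mul hU hg).integrable_of_hasCompactSupport hφ.2.1.mul_left

lemma integrableOn_energy {v : ℝ → ℝ} (hv : weightedEnergy R v ≠ ⊤) :
    IntegrableOn (fun r => r * deriv v r ^ 2) (Ioo 0 R) := by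
  have hm := measurable_deriv v
  refine (lintegral_ofReal_ne_top_iff_integrable (by fun_prop) ?_).1 ?_
  · filter_upwards [self_mem_ae_restrict measurableSet_Ioo] with r hr
    exact mul_nonneg hr.1.le (sq_nonneg _)
  · simpa only [weightedEnergy, sq_abs] using hv

lemma integrableOn_energy_mul {v φ : ℝ → ℝ} (hv : weightedEnergy R v ≠ ⊤)
    (hφ : weightedEnergy R φ ≠ ⊤) :
    IntegrableOn (fun r => r * deriv v r * deriv φ r) (Ioo 0 R) := by
  have hm := measurable_deriv v
  have hm' := measurable_deriv φ
  refine ((integrableOn_energy hv).add (integrableOn_energy hφ)).mono' (by fun_prop) ?_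
  filter_upwards [self_mem_ae_restrict measurableSet_Ioo] with r hr
  have hr0 := hr.1
  rw [Real.norm_eq_abs, abs_le, Pi.add_apply]
  constructor <;> nlinarith [mul_nonneg hr0.le (sq_nonneg (deriv v r + deriv φ r)),
    mul_nonneg hr0.le (sq_nonneg (deriv v r - deriv φ r)), mul_nonneg hr0.le (sq_nonneg (deriv v r)),
    mul_nonneg hr0.le (sq_nonneg (deriv φ r))]

lemma MemEnergySpace.weightedEnergy_add_smul {v φ : ℝ → ℝ} (hv : MemEnergySpace R v)
    (hφ : IsTestFunction (Ioo 0 R) φ) (τ : ℝ) :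
    weightedEnergy R (fun r => v r + τ * φ r) =
      ENNReal.ofReal ((∫ r in Ioo 0 R, r * deriv v r ^ 2) +
        2 * τ * (∫ r in Ioo 0 R, r * deriv v r * deriv φ r) +
        τ ^ 2 * ∫ r in Ioo 0 R, r * deriv φ r ^ 2) := by
  have hvE := hv.weightedEnergy_ne_top
  have hφE := hφ.weightedEnergy_ne_top (R := R)
  have i1 := integrableOn_energy hvE
  have i2 := integrableOn_energy_mul hvE hφE
  have i3 := integrableOn_energy hφE
  have i2' := i2.const_mul (2 * τ)
  have i3' := i3.const_mul (τ ^ 2)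
  have i12 : IntegrableOn (fun r => r * deriv v r ^ 2 +
      2 * τ * (r * deriv v r * deriv φ r)) (Ioo 0 R) := i1.add i2'
  have i123 : IntegrableOn (fun r => r * deriv v r ^ 2 +
      2 * τ * (r * deriv v r * deriv φ r) + τ ^ 2 * (r * deriv φ r ^ 2))
      (Ioo 0 R) := i12.add i3'
  rw [← integral_const_mul, ← integral_const_mul, ← integral_add i1 i2', ← integral_add i12 i3',
    ofReal_integral_eq_lintegral_ofReal i123]
  · refine lintegral_congr_ae ?_
    filter_upwards [ae_restrict_of_ae hv.ae_differentiableAt,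
      self_mem_ae_restrict measurableSet_Ioo] with r hvr hr
    have hφd : HasDerivAt (fun r => τ * φ r) (τ * deriv φ r) r :=
      ((hφ.1.differentiable (by simp) r).hasDerivAt).const_mul τ
    rw [(HasDerivAt.fun_add (hvr hr).hasDerivAt hφd).deriv, sq_abs]
    congr 1
    ring
  · filter_upwards [self_mem_ae_restrict measurableSet_Ioo] with r hr
    have e : r * deriv v r ^ 2 + 2 * τ * (r * deriv v r * deriv φ r) +
        τ ^ 2 * (r * deriv φ r ^ 2) =
        r * (deriv v r + τ * deriv φ r) ^ 2 := by ring
    change 0 ≤ r * deriv v r ^ 2 + 2 * τ * (r * deriv v r * deriv φ r) +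
        τ ^ 2 * (r * deriv φ r ^ 2)
    rw [e]
    exact mul_nonneg hr.1.le (sq_nonneg _)

lemma ofReal_integral_le_lintegral {f : ℝ → ℝ} {s : Set ℝ} (hf : IntegrableOn f s) :
    ENNReal.ofReal (∫ x in s, f x) ≤ ∫⁻ x in s, ENNReal.ofReal (f x) := by
  have h : ∫ x in s, f x ≤ ∫ x in s, max (f x) 0 :=
    integral_mono hf hf.pos_part fun x => le_max_left _ _
  refine (ENNReal.ofReal_le_ofReal h).trans ?_
  rw [ofReal_integral_eq_lintegral_ofReal hf.pos_part
    (Eventually.of_forall fun x => le_max_right _ _)]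
  exact lintegral_mono fun x => by simp

variable (hN : 3 ≤ N)
include hN

lemma integrableOn_potential {v : ℝ → ℝ} (hv : MemEnergySpace R v)
    (hP : weightedPotential N R v ≠ ⊤) :
    IntegrableOn (fun r => potentialWeight N R r * |v r| ^ (2 * (N : ℝ) / ((N : ℝ) - 2)))
      (Ioo 0 R) := by
  have hn' : (3 : ℝ) ≤ N := by exact_mod_cast hN
  have hn2 : 0 < (N : ℝ) - 2 := by linarith
  refine (lintegral_ofReal_ne_top_iff_integrable ?_ ?_).1 ?_
  · exact (continuousOn_potentialWeight.mul (hv.continuousOn.abs.rpow_const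
      fun _ _ => Or.inr (by positivity))).aestronglyMeasurable measurableSet_Ioo
  · filter_upwards [self_mem_ae_restrict measurableSet_Ioo] with r hr
    have := potentialWeight_pos (N := N) hr
    positivity
  · intro h
    refine hP ?_
    rw [weightedPotential]
    exact (congrArg (· ^ (((N : ℝ) - 2) / (N : ℝ))) h).trans
      (ENNReal.top_rpow_of_pos (div_pos hn2 (by linarith)))

/-- Convexity: the tangent line of |x|^p integrated against the weight. This one-sided bound is all
that minimality needs, and no differentiation under the integral sign occurs. -/
lemma MemEnergySpace.le_weightedPotential_add_smul {v φ : ℝ → ℝ} (hv : MemEnergySpace R v)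
    (hP : weightedPotential N R v ≠ ⊤) (hφ : IsTestFunction (Ioo 0 R) φ) (τ : ℝ) :
    ENNReal.ofReal ((∫ r in Ioo 0 R,
        potentialWeight N R r * |v r| ^ (2 * (N : ℝ) / ((N : ℝ) - 2))) +
      2 * (N : ℝ) / ((N : ℝ) - 2) * τ * ∫ r in Ioo 0 R,
        potentialWeight N R r * (|v r| ^ (2 * (N : ℝ) / ((N : ℝ) - 2) - 2) * v r) * φ r) ^
        (((N : ℝ) - 2) / (N : ℝ)) ≤ weightedPotential N R (fun r => v r + τ * φ r) := by
  have hn' : (3 : ℝ) ≤ N := by exact_mod_cast hN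
  have hn2 : 0 < (N : ℝ) - 2 := by linarith
  have hp : 2 ≤ 2 * (N : ℝ) / ((N : ℝ) - 2) := by
    rw [le_div_iff₀ hn2]
    linarith
  have i1 := integrableOn_potential hN hv hP
  have i2 : IntegrableOn (fun r => potentialWeight N R r *
      (|v r| ^ (2 * (N : ℝ) / ((N : ℝ) - 2) - 2) * v r) * φ r) (Ioo 0 R) :=
    (hφ.integrable_mul isOpen_Ioo ((continuousOn_potentialWeight (N := N)).mul
      (continuousOn_abs_rpow_mul (sub_nonneg.2 hp) hv.continuousOn))).integrableOn
  have i2' := i2.const_mul (2 * (N : ℝ) / ((N : ℝ) - 2) * τ)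
  rw [← integral_const_mul, ← integral_add i1 i2', weightedPotential]
  refine ENNReal.rpow_le_rpow ((ofReal_integral_le_lintegral (i1.add i2')).trans ?_)
    (div_nonneg hn2.le (by linarith))
  refine lintegral_mono_ae ?_
  filter_upwards [self_mem_ae_restrict measurableSet_Ioo] with r hr
  refine ENNReal.ofReal_le_ofReal ?_
  have h := mul_le_mul_of_nonneg_left
    (abs_rpow_add_mul_le (p := 2 * (N : ℝ) / ((N : ℝ) - 2)) (by linarith) (v r) (τ * φ r))
    (potentialWeight_pos (N := N) hr).le
  refine le_trans (le_of_eq ?_) h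
  simp only [Pi.add_apply]
  ring

lemma weightedPotential_eq_ofReal {v : ℝ → ℝ} (hv : MemEnergySpace R v)
    (hP : weightedPotential N R v ≠ ⊤) :
    weightedPotential N R v = ENNReal.ofReal (∫ r in Ioo 0 R,
      potentialWeight N R r * |v r| ^ (2 * (N : ℝ) / ((N : ℝ) - 2))) ^
        (((N : ℝ) - 2) / (N : ℝ)) := by
  rw [ofReal_integral_eq_lintegral_ofReal (integrableOn_potential hN hv hP)]
  · rfl
  · filter_upwards [self_mem_ae_restrict measurableSet_Ioo] with r hr
    have := potentialWeight_pos (N := N) hr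
    change 0 ≤ potentialWeight N R r * |v r| ^ (2 * (N : ℝ) / ((N : ℝ) - 2))
    positivity

/-- Members of the energy space are continuous on (0, R), so one nonzero value gives a nonempty open
set of them. -/
lemma integral_potential_pos {v : ℝ → ℝ} (hv : MemEnergySpace R v)
    (hP : weightedPotential N R v ≠ ⊤) (hv0 : ∃ r ∈ Ioo 0 R, v r ≠ 0) :
    0 < ∫ r in Ioo 0 R, potentialWeight N R r * |v r| ^ (2 * (N : ℝ) / ((N : ℝ) - 2)) := by
  have hn' : (3 : ℝ) ≤ N := by exact_mod_cast hN
  have hn2 : 0 < (N : ℝ) - 2 := by linarith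
  obtain ⟨r₀, hr₀, hvr⟩ := hv0
  rw [setIntegral_pos_iff_support_of_nonneg_ae ?_ (integrableOn_potential hN hv hP)]
  · have ho : IsOpen (Ioo 0 R ∩ v ⁻¹' {0}ᶜ) :=
      hv.continuousOn.isOpen_inter_preimage isOpen_Ioo isOpen_compl_singleton
    refine (ho.measure_pos volume ⟨r₀, hr₀, hvr⟩).trans_le (measure_mono fun r hr => ⟨?_, hr.1⟩)
    have h1 := potentialWeight_pos (N := N) hr.1
    have h2 : 0 < |v r| := abs_pos.2 hr.2
    exact (by positivity : 0 < potentialWeight N R r * |v r| ^ (2 * (N : ℝ) / ((N : ℝ) - 2))).ne'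
  · filter_upwards [self_mem_ae_restrict measurableSet_Ioo] with r hr
    have := potentialWeight_pos (N := N) hr
    change 0 ≤ potentialWeight N R r * |v r| ^ (2 * (N : ℝ) / ((N : ℝ) - 2))
    positivity

lemma MemEnergySpace.weightedIneq_weightedConst (hR : 0 < R) {v : ℝ → ℝ}
    (hv : MemEnergySpace R v) : WeightedIneq N R (weightedConst N) v :=
  hv.weightedIneq hN fun _ hw => _root_.weightedIneq_weightedConst hN hR hw

lemma MemEnergySpace.weightedPotential_ne_top (hR : 0 < R) {v : ℝ → ℝ}
    (hv : MemEnergySpace R v) : weightedPotential N R v ≠ ⊤ := by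
  intro h
  have h1 := hv.weightedIneq_weightedConst hN hR
  rw [WeightedIneq, h, ENNReal.mul_top (by simpa using weightedConst_pos hN), top_le_iff] at h1
  exact hv.weightedEnergy_ne_top h1

lemma MemEnergySpace.weightedPotential_ne_zero (hR : 0 < R) {v : ℝ → ℝ}
    (hv : MemEnergySpace R v) (hv0 : ∃ r ∈ Ioo 0 R, v r ≠ 0) : weightedPotential N R v ≠ 0 := by
  have hP := hv.weightedPotential_ne_top hN hR
  have h := integral_potential_pos hN hv hP hv0
  rw [weightedPotential_eq_ofReal hN hv hP]
  exact (ENNReal.rpow_pos (by simpa using h) ENNReal.ofReal_ne_top).ne'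

lemma MemEnergySpace.weightedConst_le_weightedQuotient (hR : 0 < R) {v : ℝ → ℝ}
    (hv : MemEnergySpace R v) (hv0 : ∃ r ∈ Ioo 0 R, v r ≠ 0) :
    ENNReal.ofReal (weightedConst N) ≤ weightedQuotient N R v := by
  rw [weightedQuotient, ENNReal.le_div_iff_mul_le
    (Or.inl (hv.weightedPotential_ne_zero hN hR hv0))
    (Or.inl (hv.weightedPotential_ne_top hN hR))]
  exact hv.weightedIneq_weightedConst hN hR

/-- Comparison with an explicit extremal, whose quotient is C_M. -/
lemma IsWeightedMinimizer.weightedEnergy_le (hR : 0 < R) {v : ℝ → ℝ}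
    (hv : IsWeightedMinimizer N R v) :
    weightedEnergy R v ≤ ENNReal.ofReal (weightedConst N) * weightedPotential N R v := by
  obtain ⟨hvX, hv0, hmin⟩ := hv
  have h := hmin _ (memEnergySpace_weightedExtremal hN hR one_ne_zero one_ne_zero)
    ⟨R / 2, ⟨by positivity, by linarith⟩, by
      rw [weightedExtremal_eq ⟨by positivity, by linarith⟩]
      exact (sobolevExtremal_pos one_ne_zero _ _).ne'⟩
  rw [weightedQuotient_weightedExtremal hN hR one_ne_zero one_ne_zero, weightedQuotient,
    ENNReal.div_le_iff (hvX.weightedPotential_ne_zero hN hR hv0)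
      (hvX.weightedPotential_ne_top hN hR)] at h
  exact h

/-- The weak Euler-Lagrange equation of a minimizer. -/
lemma IsWeightedMinimizer.weak_eulerLagrange (hR : 0 < R) {v : ℝ → ℝ}
    (hv : IsWeightedMinimizer N R v) :
    ∃ l : ℝ, ∀ φ, IsTestFunction (Ioo 0 R) φ →
      ∫ r in Ioo 0 R, r * deriv v r * deriv φ r = l * ∫ r in Ioo 0 R,
        potentialWeight N R r * (|v r| ^ (2 * (N : ℝ) / ((N : ℝ) - 2) - 2) * v r) * φ r := by
  have hn' : (3 : ℝ) ≤ N := by exact_mod_cast hN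
  have hn2 : 0 < (N : ℝ) - 2 := by linarith
  have hle := hv.weightedEnergy_le hN hR
  obtain ⟨hvX, hv0, -⟩ := hv
  have hP := hvX.weightedPotential_ne_top hN hR
  have hpos := integral_potential_pos hN hvX hP hv0
  rw [weightedPotential_eq_ofReal hN hvX hP] at hle
  set C := weightedConst N with hC
  have hC0 : 0 < C := weightedConst_pos hN
  set e := ((N : ℝ) - 2) / (N : ℝ) with he
  set p := 2 * (N : ℝ) / ((N : ℝ) - 2) with hp
  set P := ∫ r in Ioo 0 R, potentialWeight N R r * |v r| ^ p with hPdef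
  -- The multiplier is what differentiating C P^e produces: p e = 2 cancels the 2 from the quadratic
  -- energy.
  refine ⟨C * P ^ (e - 1), fun φ hφ => ?_⟩
  set D := ∫ r in Ioo 0 R, potentialWeight N R r * (|v r| ^ (p - 2) * v r) * φ r with hD
  set B := ∫ r in Ioo 0 R, r * deriv v r * deriv φ r with hB
  set E₀ := ∫ r in Ioo 0 R, r * deriv v r ^ 2 with hE₀
  set E₁ := ∫ r in Ioo 0 R, r * deriv φ r ^ 2 with hE₁
  have hnn : ∀ f : ℝ → ℝ, 0 ≤ ∫ r in Ioo 0 R, r * deriv f r ^ 2 := fun f =>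
    setIntegral_nonneg measurableSet_Ioo fun r hr => mul_nonneg hr.1.le (sq_nonneg _)
  have hexp : ∀ τ, weightedEnergy R (fun r => v r + τ * φ r) =
      ENNReal.ofReal (E₀ + 2 * τ * B + τ ^ 2 * E₁) := hvX.weightedEnergy_add_smul hφ
  have h0 : E₀ ≤ C * P ^ e := by
    have h1 := hexp 0
    simp only [zero_mul, add_zero, mul_zero, ne_eq, OfNat.ofNat_ne_zero, not_false_eq_true,
      zero_pow] at h1
    rw [h1, ENNReal.ofReal_rpow_of_pos hpos, ← ENNReal.ofReal_mul hC0.le,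
      ENNReal.ofReal_le_ofReal_iff (by positivity)] at hle
    exact hle
  have hge : ∀ τ, 0 < P + p * τ * D → C * (P + p * τ * D) ^ e ≤ E₀ + 2 * τ * B + τ ^ 2 * E₁ := by
    intro τ hτ
    have h1 := (hvX.add_smul_test hφ τ).weightedIneq_weightedConst hN hR
    have h2 := (mul_le_mul_right (hvX.le_weightedPotential_add_smul hN hP hφ τ)
      (ENNReal.ofReal C)).trans h1
    rw [hexp, ENNReal.ofReal_rpow_of_pos hτ, ← ENNReal.ofReal_mul hC0.le] at h2
    by_contra! hlt
    exact absurd h2 (not_le.2 ((ENNReal.ofReal_lt_ofReal_iff (by positivity)).2 hlt))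
  have hc : Continuous (fun τ : ℝ => P + p * τ * D) := by fun_prop
  -- Energy minus C times the lower bound for the potential is nonnegative near τ = 0, and at τ = 0
  -- it is at most 0 because v attains the constant.
  have hmin : IsLocalMin
      (fun τ => E₀ + 2 * τ * B + τ ^ 2 * E₁ - C * (P + p * τ * D) ^ e) 0 := by
    filter_upwards [hc.continuousAt.eventually (lt_mem_nhds (by simpa using hpos) :
      ∀ᶠ y in 𝓝 (P + p * 0 * D), 0 < y)] with τ hτ
    have := hge τ hτ
    simp only [mul_zero, zero_mul, add_zero, ne_eq, OfNat.ofNat_ne_zero, not_false_eq_true,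
      zero_pow]
    linarith
  have hlin : ∀ a : ℝ, HasDerivAt (fun τ : ℝ => a * τ) a 0 := fun a => by
    simpa using (hasDerivAt_id (0 : ℝ)).const_mul a
  have hd1 : HasDerivAt (fun τ : ℝ => E₀ + 2 * τ * B + τ ^ 2 * E₁) (2 * B) 0 := by
    have h1 := ((hlin 2).mul_const B).const_add E₀
    have h2 := (hasDerivAt_pow 2 (0 : ℝ)).mul_const E₁
    convert! h1.add h2 using 1
    simp
  have hd2 : HasDerivAt (fun τ : ℝ => C * (P + p * τ * D) ^ e)
      (C * (p * D * e * P ^ (e - 1))) 0 := by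
    have h1 := (((hlin p).mul_const D).const_add P).rpow_const (p := e)
      (Or.inl (by simpa using hpos.ne'))
    have h2 := h1.const_mul C
    simpa using h2
  have h := hmin.hasDerivAt_eq_zero (hd1.sub hd2)
  have hpe : p * e = 2 := by rw [hp, he]; field_simp
  linear_combination (1 / 2) * h + (1 / 2) * C * D * P ^ (e - 1) * hpe

end EulerLagrange

/-! ### The lemma of du Bois-Reymond -/

section DuBoisReymond

lemma hasDerivAt_integral_of_continuousOn_Ioo {a b : ℝ} {g : ℝ → ℝ} (hg : ContinuousOn g (Ioo a b))
    {x₀ x : ℝ} (hx₀ : x₀ ∈ Ioo a b) (hx : x ∈ Ioo a b) :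
    HasDerivAt (fun x => ∫ t in x₀..x, g t) (g x) x := by
  refine intervalIntegral.integral_hasDerivAt_right
    ((hg.mono ((ordConnected_Ioo).uIcc_subset hx₀ hx)).intervalIntegrable) ?_
    (hg.continuousAt (isOpen_Ioo.mem_nhds hx))
  exact ContinuousOn.stronglyMeasurableAtFilter isOpen_Ioo hg x hx

/-- A test function with vanishing integral is the derivative of a test function. -/
lemma IsTestFunction.exists_deriv_eq {a b : ℝ} {ψ : ℝ → ℝ} (hψ : IsTestFunction (Ioo a b) ψ)
    (h0 : ∫ x, ψ x = 0) : ∃ φ, IsTestFunction (Ioo a b) φ ∧ ∀ x, deriv φ x = ψ x := by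
  rcases (tsupport ψ).eq_empty_or_nonempty with he | hne
  · have : ψ = 0 := tsupport_eq_empty_iff.1 he
    refine ⟨fun _ => 0, ⟨contDiff_const, HasCompactSupport.zero, by simp [tsupport]⟩, fun x => ?_⟩
    rw [this]
    exact deriv_const x 0
  have hcomp : IsCompact (tsupport ψ) := hψ.2.1
  obtain ⟨a', ha', hmin⟩ := hcomp.exists_isLeast hne
  obtain ⟨b', hb', hmax⟩ := hcomp.exists_isGreatest hne
  have hzero : ∀ x, x ∉ Icc a' b' → ψ x = 0 := fun x hx =>
    image_eq_zero_of_notMem_tsupport fun h => hx ⟨hmin h, hmax h⟩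
  have hcont : Continuous ψ := hψ.1.continuous
  have hd : ∀ x, HasDerivAt (fun x => ∫ t in a..x, ψ t) (ψ x) x := fun x =>
    intervalIntegral.integral_hasDerivAt_right (hcont.intervalIntegrable _ _)
      hcont.stronglyMeasurable.stronglyMeasurableAtFilter hcont.continuousAt
  have hd' : deriv (fun x => ∫ t in a..x, ψ t) = ψ := funext fun x => (hd x).deriv
  have haa : a < a' := (hψ.2.2 ha').1
  have hbb : b' < b := (hψ.2.2 hb').2
  have hout : ∀ x, x ∉ Icc a' b' → ∫ t in a..x, ψ t = 0 := by
    intro x hx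
    rcases lt_or_ge x a' with hxa | hxa
    · refine (intervalIntegral.integral_congr fun t ht => ?_).trans intervalIntegral.integral_zero
      refine hzero t fun h => ?_
      have := (mem_uIcc.1 ht)
      rcases this with h' | h' <;> linarith [h.1]
    · have hxb : b' < x := lt_of_not_ge fun h => hx ⟨hxa, h⟩
      -- Beyond the support the primitive equals the total integral, which is zero.
      rw [intervalIntegral.integral_eq_integral_of_support_subset, h0]
      intro t ht
      have : t ∈ Icc a' b' := by_contra fun h => ht (hzero t h)
      exact ⟨haa.trans_le this.1, this.2.trans hxb.le⟩
  refine ⟨fun x => ∫ t in a..x, ψ t, ⟨?_, HasCompactSupport.intro isCompact_Icc hout, ?_⟩,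
    fun x => (hd x).deriv⟩
  · rw [contDiff_infty_iff_deriv, hd']
    exact ⟨fun x => (hd x).differentiableAt, hψ.1⟩
  · refine (closure_minimal (fun x hx => ?_) isClosed_Icc : tsupport _ ⊆ Icc a' b').trans
      (Icc_subset_Ioo haa hbb)
    exact by_contra fun h => hx (hout x h)

lemma exists_isTestFunction_integral_eq_one {a b : ℝ} (hab : a < b) :
    ∃ η, IsTestFunction (Ioo a b) η ∧ ∫ x, η x = 1 := by
  let χ : ContDiffBump ((a + b) / 2) := ⟨(b - a) / 8, (b - a) / 4, by linarith, by linarith⟩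
  refine ⟨χ.normed volume, ⟨χ.contDiff_normed, χ.hasCompactSupport_normed, ?_⟩,
    χ.integral_normed⟩
  rw [χ.tsupport_normed_eq, Real.closedBall_eq_Icc]
  change Icc ((a + b) / 2 - (b - a) / 4) ((a + b) / 2 + (b - a) / 4) ⊆ _
  exact Icc_subset_Ioo (by linarith) (by linarith)

lemma IsTestFunction.integrable_mul_of_locallyIntegrableOn {U : Set ℝ} {k φ : ℝ → ℝ}
    (hφ : IsTestFunction U φ) (hk : LocallyIntegrableOn k U) : Integrable (fun x => k x * φ x) := by
  have hcont : Continuous φ := hφ.1.continuous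
  have h : IntegrableOn (fun x => k x * φ x) (tsupport φ) :=
    (hk.integrableOn_compact_subset hφ.2.2 hφ.2.1).mul_continuousOn hcont.continuousOn hφ.2.1
  refine (integrableOn_iff_integrable_of_support_subset fun x hx => ?_).1 h
  exact subset_tsupport _ (right_ne_zero_of_mul hx)

/-- The lemma of du Bois-Reymond on an interval. -/
lemma exists_ae_eq_const_of_integral_mul_deriv {a b : ℝ} (hab : a < b) {k : ℝ → ℝ}
    (hk : LocallyIntegrableOn k (Ioo a b))
    (h : ∀ φ, IsTestFunction (Ioo a b) φ → ∫ x, k x * deriv φ x = 0) :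
    ∃ c, ∀ᵐ x, x ∈ Ioo a b → k x = c := by
  obtain ⟨η₀, hη₀, hint⟩ := exists_isTestFunction_integral_eq_one hab
  refine ⟨∫ x, k x * η₀ x, ?_⟩
  set c := ∫ x, k x * η₀ x with hc
  have hk' : LocallyIntegrableOn (fun x => k x - c) (Ioo a b) :=
    hk.sub ((locallyIntegrable_const c).locallyIntegrableOn _)
  refine (isOpen_Ioo.ae_eq_zero_of_integral_contDiff_smul_eq_zero hk' ?_).mono
    fun x hx hxU => sub_eq_zero.1 (hx hxU)
  intro η hη1 hη2 hη3
  have hη : IsTestFunction (Ioo a b) η := ⟨hη1, hη2, hη3⟩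
  have iη : Integrable η := hη1.continuous.integrable_of_hasCompactSupport hη2
  have iη₀ : Integrable η₀ := hη₀.1.continuous.integrable_of_hasCompactSupport hη₀.2.1
  set m := ∫ x, η x with hm
  -- Subtracting (∫η) η₀ makes the integral vanish, so the difference is the derivative of an
  -- admissible test function.
  have hψ : IsTestFunction (Ioo a b) (fun x => η x + -m * η₀ x) :=
    ⟨hη1.add (contDiff_const.mul hη₀.1), hη2.add hη₀.2.1.mul_left,
      (tsupport_add _ _).trans (union_subset hη3 (tsupport_mul_subset_right.trans hη₀.2.2))⟩
  have hψ0 : ∫ x, (η x + -m * η₀ x) = 0 := by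
    rw [integral_add iη (iη₀.const_mul _), integral_const_mul, hint]
    ring
  obtain ⟨φ, hφ, hφd⟩ := hψ.exists_deriv_eq hψ0
  have h1 := h φ hφ
  simp only [hφd] at h1
  have i1 := hη.integrable_mul_of_locallyIntegrableOn hk
  have i2 := hη₀.integrable_mul_of_locallyIntegrableOn hk
  have e1 : ∫ x, k x * (η x + -m * η₀ x) = (∫ x, k x * η x) + -m * c := by
    rw [hc, ← integral_const_mul, ← integral_add i1 (i2.const_mul _)]
    congr 1
    ext x
    ring
  have e2 : ∫ x, η x • (k x - c) = (∫ x, k x * η x) + -c * m := by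
    rw [hm, ← integral_const_mul, ← integral_add i1 (iη.const_mul _)]
    congr 1
    ext x
    simp only [smul_eq_mul]
    ring
  rw [e2]
  rw [e1] at h1
  linarith

end DuBoisReymond

/-! ### Minimizers are classical solutions -/

section Regularity

variable {N : ℕ} {R : ℝ}

lemma IsTestFunction.setIntegral_mul_eq {U : Set ℝ} {k φ : ℝ → ℝ}
    (hφ : IsTestFunction U φ) : ∫ x in U, k x * φ x = ∫ x, k x * φ x :=
  setIntegral_eq_integral_of_forall_compl_eq_zero fun x hx => by
    rw [hφ.eq_zero_of_notMem hx, mul_zero]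

/-- A minimizer is a classical solution of the Euler-Lagrange equation, written as a first order
system for `v` and the flux `q = r v'`. -/
lemma IsWeightedMinimizer.exists_flux (hN : 3 ≤ N) (hR : 0 < R) {v : ℝ → ℝ}
    (hv : IsWeightedMinimizer N R v) :
    ∃ (l : ℝ) (q : ℝ → ℝ), ∀ r ∈ Ioo 0 R, HasDerivAt v (q r / r) r ∧
      HasDerivAt q (-(l * (potentialWeight N R r *
        (|v r| ^ (2 * (N : ℝ) / ((N : ℝ) - 2) - 2) * v r)))) r := by
  have hn' : (3 : ℝ) ≤ N := by exact_mod_cast hN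
  have hn2 : 0 < (N : ℝ) - 2 := by linarith
  obtain ⟨l, hl⟩ := hv.weak_eulerLagrange hN hR
  have hvX := hv.1
  set p := 2 * (N : ℝ) / ((N : ℝ) - 2) with hp
  have hp2 : 0 ≤ p - 2 := by
    rw [hp, sub_nonneg, le_div_iff₀ hn2]
    linarith
  set g : ℝ → ℝ := fun r => potentialWeight N R r * (|v r| ^ (p - 2) * v r) with hg
  have hgc : ContinuousOn g (Ioo 0 R) :=
    continuousOn_potentialWeight.mul (continuousOn_abs_rpow_mul hp2 hvX.continuousOn)
  have hmid : R / 2 ∈ Ioo 0 R := ⟨by positivity, by linarith⟩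
  set G : ℝ → ℝ := fun r => ∫ t in (R / 2)..r, g t with hG
  have hGd : ∀ r ∈ Ioo 0 R, HasDerivAt G (g r) r := fun r hr =>
    hasDerivAt_integral_of_continuousOn_Ioo hgc hmid hr
  have hGc : ContinuousOn G (Ioo 0 R) := fun r hr => (hGd r hr).continuousAt.continuousWithinAt
  -- Dominated through |r v'| ≤ r v'² + r.
  have hfl : IntegrableOn (fun r => r * deriv v r) (Ioo 0 R) := by
    have hm := measurable_deriv v
    have i1 : IntegrableOn (fun r : ℝ => r) (Ioo 0 R) :=
      (continuous_id.integrableOn_Icc (a := 0) (b := R)).mono_set Ioo_subset_Icc_self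
    refine ((integrableOn_energy hvX.weightedEnergy_ne_top).add i1).mono' (by fun_prop) ?_
    filter_upwards [self_mem_ae_restrict measurableSet_Ioo] with r hr
    have hr0 := hr.1
    rw [Real.norm_eq_abs, abs_le, Pi.add_apply]
    constructor <;> nlinarith [mul_nonneg hr0.le (sq_nonneg (deriv v r + 1)),
      mul_nonneg hr0.le (sq_nonneg (deriv v r - 1)), mul_nonneg hr0.le (sq_nonneg (deriv v r))]
  have hlGc : ContinuousOn (fun r => l * G r) (Ioo 0 R) := continuousOn_const.mul hGc
  have hk : LocallyIntegrableOn (fun r => r * deriv v r + l * G r) (Ioo 0 R) :=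
    hfl.locallyIntegrableOn.add (hlGc.locallyIntegrableOn measurableSet_Ioo)
  -- Integrating the potential term by parts through its primitive G, the weak equation says that r
  -- v' + l G is orthogonal to all derivatives of test functions.
  obtain ⟨c, hc⟩ := exists_ae_eq_const_of_integral_mul_deriv hR hk fun φ hφ => by
    have i1 := hφ.isTestFunction_deriv.integrable_mul_of_locallyIntegrableOn hfl.locallyIntegrableOn
    have i2 := hφ.isTestFunction_deriv.integrable_mul isOpen_Ioo hGc
    have h1 := hl φ hφ
    rw [hφ.isTestFunction_deriv.setIntegral_mul_eq, hφ.setIntegral_mul_eq] at h1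
    have h2 := integral_mul_deriv_eq_deriv_mul_of_integrable (u := G) (u' := g) (v := φ)
      (v' := deriv φ) (fun x hx => hGd x (hφ.2.2 hx))
      (fun x _ => (hφ.1.differentiable (by simp) x).hasDerivAt) i2
      (hφ.integrable_mul isOpen_Ioo hgc) (hφ.integrable_mul isOpen_Ioo hGc)
    have e : ∀ x, (x * deriv v x + l * G x) * deriv φ x =
        x * deriv v x * deriv φ x + l * (G x * deriv φ x) := fun x => by ring
    simp only [e]
    rw [integral_add i1 (i2.const_mul l), integral_const_mul, h1, h2]
    ring
  set q : ℝ → ℝ := fun r => c - l * G r with hq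
  have hqd : ∀ r ∈ Ioo 0 R, HasDerivAt q (-(l * g r)) r := fun r hr =>
    ((hGd r hr).const_mul l).const_sub c
  have hqc : ContinuousOn (fun r => q r / r) (Ioo 0 R) := fun r hr =>
    ((hqd r hr).continuousAt.div continuousAt_id hr.1.ne').continuousWithinAt
  refine ⟨l, q, fun r hr => ⟨?_, hqd r hr⟩⟩
  obtain ⟨a, ha0, har⟩ := exists_between hr.1
  -- v is a primitive of `deriv v`, which equals the continuous function q/r almost everywhere;
  -- hence v is differentiable everywhere on (0, R).
  refine ((hasDerivAt_integral_of_continuousOn_Ioo hqc ⟨ha0, har.trans hr.2⟩ hr).const_add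
    (v a)).congr_of_eventuallyEq ?_
  filter_upwards [Ioo_mem_nhds har hr.2] with x hx
  have h1 := (hvX.intervalIntegrable_and_integral ha0 hx.1.le hx.2).2
  have h2 : ∫ t in a..x, deriv v t = ∫ t in a..x, q t / t := by
    refine intervalIntegral.integral_congr_ae ?_
    filter_upwards [hc] with t ht hta
    rw [uIoc_of_le hx.1.le] at hta
    have ht0 : 0 < t := ha0.trans hta.1
    have := ht ⟨ht0, hta.2.trans_lt hx.2⟩
    rw [eq_div_iff ht0.ne', hq]
    simp only
    linarith
  rw [← h2, h1]
  ring

end Regularity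

/-! ### Decaying solutions of h'' = h/4 - l|h|^(p-2)h -/

section Homoclinic

lemma hasDerivAt_abs_rpow_mul {q : ℝ} (hq : 0 < q) (x : ℝ) :
    HasDerivAt (fun x : ℝ => |x| ^ q * x) ((q + 1) * |x| ^ q) x := by
  rcases lt_trichotomy x 0 with hx | rfl | hx
  · have h1 := ((hasDerivAt_neg x).rpow_const (p := q) (Or.inl (by linarith))).mul (hasDerivAt_id x)
    rw [abs_of_neg hx]
    have h2 : HasDerivAt (fun x : ℝ => (-x) ^ q * x) ((q + 1) * (-x) ^ q) x := by
      convert! h1 using 1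
      rw [Real.rpow_sub_one (by linarith)]
      simp only [id]
      have := hx.ne
      field_simp
    refine h2.congr_of_eventuallyEq ?_
    filter_upwards [gt_mem_nhds hx] with y hy
    rw [abs_of_neg hy]
  · rw [abs_zero, Real.zero_rpow hq.ne', mul_zero, hasDerivAt_iff_tendsto_slope]
    have h1 : Tendsto (fun x : ℝ => |x| ^ q) (𝓝[≠] 0) (𝓝 0) := by
      have : ContinuousAt (fun x : ℝ => |x| ^ q) 0 :=
        continuousAt_id.abs.rpow_const (Or.inr hq.le)
      have h2 := this.tendsto
      rw [abs_zero, Real.zero_rpow hq.ne'] at h2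
      exact h2.mono_left nhdsWithin_le_nhds
    refine h1.congr' ?_
    filter_upwards [self_mem_nhdsWithin] with y hy
    have : y ≠ 0 := hy
    rw [slope_def_field]
    field_simp
    simp
  · have h1 := ((hasDerivAt_id x).rpow_const (p := q) (Or.inl hx.ne')).mul (hasDerivAt_id x)
    rw [abs_of_pos hx]
    have h2 : HasDerivAt (fun x : ℝ => x ^ q * x) ((q + 1) * x ^ q) x := by
      convert! h1 using 1
      simp only [id]
      rw [Real.rpow_sub_one hx.ne']
      have := hx.ne'
      field_simp
    refine h2.congr_of_eventuallyEq ?_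
    filter_upwards [lt_mem_nhds hx] with y hy
    rw [abs_of_pos hy]

lemma exists_lipschitzOnWith_abs_rpow_mul {q : ℝ} (hq : 0 < q) (M : ℝ) :
    ∃ K, LipschitzOnWith K (fun x : ℝ => |x| ^ q * x) (Icc (-M) M) := by
  refine ⟨((q + 1) * |M| ^ q).toNNReal, (convex_Icc _ _).lipschitzOnWith_of_nnnorm_hasDerivWithin_le
    (fun x _ => (hasDerivAt_abs_rpow_mul hq x).hasDerivWithinAt) fun x hx => ?_⟩
  rw [← NNReal.coe_le_coe, coe_nnnorm, Real.coe_toNNReal _ (by positivity), Real.norm_eq_abs,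
    abs_of_nonneg (by positivity)]
  have : |x| ≤ |M| := (abs_le.2 hx).trans (le_abs_self M)
  gcongr

/-- The first order system of `h'' = h/4 - l |h|^(p-2) h`. -/
noncomputable def emdenField (p l : ℝ) (x : ℝ × ℝ) : ℝ × ℝ :=
  (x.2, x.1 / 4 - l * (|x.1| ^ (p - 2) * x.1))

/-- The field is linear in the second component, so a bound on the first alone gives a Lipschitz
constant. -/
lemma exists_lipschitzOnWith_emdenField {p : ℝ} (hp : 2 < p) (l M : ℝ) :
    ∃ K, LipschitzOnWith K (emdenField p l) {x | |x.1| ≤ M} := by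
  obtain ⟨K, hK⟩ := exists_lipschitzOnWith_abs_rpow_mul (sub_pos.2 hp) M
  refine ⟨1 + ‖l‖₊ * K, LipschitzOnWith.of_dist_le_mul fun x hx y hy => ?_⟩
  have h1 := hK.dist_le_mul x.1 (abs_le.1 hx) y.1 (abs_le.1 hy)
  have hd1 : dist x.1 y.1 ≤ dist x y := le_max_left _ _
  have hd1' := hd1
  have hd2 : dist x.2 y.2 ≤ dist x y := le_max_right _ _
  have hd0 : 0 ≤ dist x y := dist_nonneg
  push_cast
  rw [Real.norm_eq_abs]
  have hlK : 0 ≤ |l| * (K : ℝ) := by positivity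
  refine max_le ?_ ?_
  · change dist x.2 y.2 ≤ _
    nlinarith
  · change dist (x.1 / 4 - l * (|x.1| ^ (p - 2) * x.1)) (y.1 / 4 - l * (|y.1| ^ (p - 2) * y.1)) ≤ _
    rw [Real.dist_eq] at h1 ⊢
    rw [Real.dist_eq] at hd1
    have e : x.1 / 4 - l * (|x.1| ^ (p - 2) * x.1) - (y.1 / 4 - l * (|y.1| ^ (p - 2) * y.1)) =
      (x.1 - y.1) / 4 - l * (|x.1| ^ (p - 2) * x.1 - |y.1| ^ (p - 2) * y.1) := by ring
    rw [e]
    refine (abs_sub _ _).trans ?_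
    rw [abs_mul, abs_div]
    have h3 : |l| * |(|x.1|) ^ (p - 2) * x.1 - |y.1| ^ (p - 2) * y.1| ≤ |l| * (K * dist x y) := by
      gcongr
      exact h1.trans (mul_le_mul_of_nonneg_left hd1' K.coe_nonneg)
    have h4 : |x.1 - y.1| / |(4 : ℝ)| ≤ dist x y := by
      rw [abs_of_pos (by norm_num : (0 : ℝ) < 4)]
      linarith
    nlinarith

/-- The soliton `M cosh(k (s - s₀))^(-2/(p-2))`, `k = (p-2)/4`. -/
noncomputable def soliton (p M s₀ s : ℝ) : ℝ :=
  M * Real.cosh ((p - 2) / 4 * (s - s₀)) ^ (-(2 / (p - 2)))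

lemma hasDerivAt_soliton {p : ℝ} (hp : 2 < p) (M s₀ s : ℝ) :
    HasDerivAt (soliton p M s₀) (-(M / 2) * (Real.sinh ((p - 2) / 4 * (s - s₀)) *
      Real.cosh ((p - 2) / 4 * (s - s₀)) ^ (-(2 / (p - 2)) - 1))) s := by
  have h0 : HasDerivAt (fun s => (p - 2) / 4 * (s - s₀)) ((p - 2) / 4) s := by
    simpa using ((hasDerivAt_id s).sub_const s₀).const_mul ((p - 2) / 4)
  have h1 := (h0.cosh.rpow_const (p := -(2 / (p - 2))) (Or.inl (Real.cosh_pos _).ne')).const_mul M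
  convert! h1 using 1
  have : p - 2 ≠ 0 := by linarith
  field_simp
  ring

/-- Writing sinh² = cosh² - 1 splits the second derivative into a linear term and a pure power of
cosh. The rate k = (p-2)/4 is what makes the linear coefficient (2k/(p-2))² equal to 1/4. -/
lemma hasDerivAt_deriv_soliton {p : ℝ} (hp : 2 < p) (M s₀ s : ℝ) :
    HasDerivAt (fun s => -(M / 2) * (Real.sinh ((p - 2) / 4 * (s - s₀)) *
      Real.cosh ((p - 2) / 4 * (s - s₀)) ^ (-(2 / (p - 2)) - 1)))
      (soliton p M s₀ s / 4 -
        p / 8 * M * Real.cosh ((p - 2) / 4 * (s - s₀)) ^ (-(2 / (p - 2)) - 2)) s := by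
  have h0 : HasDerivAt (fun s => (p - 2) / 4 * (s - s₀)) ((p - 2) / 4) s := by
    simpa using ((hasDerivAt_id s).sub_const s₀).const_mul ((p - 2) / 4)
  have h1 := (h0.sinh.mul (h0.cosh.rpow_const (p := -(2 / (p - 2)) - 1)
    (Or.inl (Real.cosh_pos _).ne'))).const_mul (-(M / 2))
  convert! h1 using 1
  set c := Real.cosh ((p - 2) / 4 * (s - s₀)) with hc
  have hcpos : 0 < c := Real.cosh_pos _
  have hsq : Real.sinh ((p - 2) / 4 * (s - s₀)) ^ 2 = c ^ 2 - 1 := Real.sinh_sq _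
  set a := -(2 / (p - 2)) with ha
  have e1 : c ^ (a - 1) = c ^ (a - 2) * c := by
    rw [← Real.rpow_add_one hcpos.ne']
    ring_nf
  have e2 : c ^ a = c ^ (a - 2) * c ^ 2 := by
    rw [← Real.rpow_natCast c 2, ← Real.rpow_add hcpos]
    norm_num
  have e3 : c ^ (a - 1 - 1) = c ^ (a - 2) := by ring_nf
  have hka : (p - 2) * a = -2 := by
    rw [ha]
    have : p - 2 ≠ 0 := by linarith
    field_simp
  rw [soliton, ← hc, e1, e2, e3]
  clear_value a
  linear_combination M * c ^ (a - 2) * (p - 2) * (a - 1) / 8 * hsq + M * c ^ (a - 2) * (c ^ 2 - 1) / 8 * hka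

lemma soliton_le {p M : ℝ} (hp : 2 < p) (hM : 0 < M) (s₀ s : ℝ) : |soliton p M s₀ s| ≤ M := by
  have h1 := Real.one_le_cosh ((p - 2) / 4 * (s - s₀))
  have h2 : Real.cosh ((p - 2) / 4 * (s - s₀)) ^ (-(2 / (p - 2))) ≤ 1 :=
    Real.rpow_le_one_of_one_le_of_nonpos h1
      (neg_nonpos.2 (div_nonneg zero_le_two (by linarith)))
  have h3 : 0 ≤ Real.cosh ((p - 2) / 4 * (s - s₀)) ^ (-(2 / (p - 2))) := by positivity
  rw [soliton, abs_of_nonneg (by positivity)]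
  nlinarith

/-- A solution of the Emden equation is the soliton of the same maximal value. -/
lemma eq_soliton_of_emden {p l M s₀ : ℝ} (hp : 2 < p) (hM : 0 < M) {h η : ℝ → ℝ}
    (hd : ∀ s, HasDerivAt h (η s) s)
    (hd' : ∀ s, HasDerivAt η (h s / 4 - l * (|h s| ^ (p - 2) * h s)) s)
    (hl : l * M ^ (p - 2) = p / 8) (h0 : h s₀ = M) (hη0 : η s₀ = 0) (hle : ∀ s, |h s| ≤ M) (s : ℝ) :
    h s = soliton p M s₀ s := by
  obtain ⟨K, hK⟩ := exists_lipschitzOnWith_emdenField hp l M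
  -- Both curves start from (M, 0) at s₀ and stay in the strip |x.1| ≤ M, where the field is
  -- Lipschitz.
  have key := ODE_solution_unique_univ (v := fun _ => emdenField p l)
    (s := fun _ => {x : ℝ × ℝ | |x.1| ≤ M}) (t₀ := s₀) (f := fun s => (h s, η s))
    (g := fun s => (soliton p M s₀ s, -(M / 2) * (Real.sinh ((p - 2) / 4 * (s - s₀)) *
      Real.cosh ((p - 2) / 4 * (s - s₀)) ^ (-(2 / (p - 2)) - 1)))) (fun _ => hK)
    (fun t => ⟨(hd t).prodMk (hd' t), hle t⟩)
    (fun t => ⟨?_, soliton_le hp hM s₀ t⟩) ?_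
  · exact congrArg Prod.fst (congrFun key s)
  · have h1 := (hasDerivAt_soliton hp M s₀ t).prodMk (hasDerivAt_deriv_soliton hp M s₀ t)
    convert! h1 using 1
    rw [emdenField]
    refine Prod.ext rfl ?_
    simp only
    congr 1
    set c := Real.cosh ((p - 2) / 4 * (t - s₀)) with hc
    have hcpos : 0 < c := Real.cosh_pos _
    have hp2 : p - 2 ≠ 0 := by linarith
    rw [soliton, ← hc, abs_of_pos (by positivity), Real.mul_rpow hM.le (by positivity),
      ← Real.rpow_mul hcpos.le, show -(2 / (p - 2)) * (p - 2) = -2 by field_simp,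
      show -(2 / (p - 2)) - 2 = -(2 / (p - 2)) + -2 by ring, Real.rpow_add hcpos]
    linear_combination M * c ^ (-(2 / (p - 2))) * c ^ (-2 : ℝ) * hl
  · simp [soliton, h0, hη0]

/-- A nontrivial homoclinic solution of the Emden equation is a soliton up to sign. -/
lemma exists_eq_soliton_of_tendsto_zero {p l : ℝ} (hp : 2 < p) {h η : ℝ → ℝ}
    (hd : ∀ s, HasDerivAt h (η s) s)
    (hd' : ∀ s, HasDerivAt η (h s / 4 - l * (|h s| ^ (p - 2) * h s)) s)
    (hlim : Tendsto h (cocompact ℝ) (𝓝 0)) (hne : ∃ s, h s ≠ 0) :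
    ∃ M s₀, 0 < M ∧ ((∀ s, h s = soliton p M s₀ s) ∨ ∀ s, h s = -soliton p M s₀ s) := by
  have hcont : Continuous h := continuous_iff_continuousAt.2 fun s => (hd s).continuousAt
  have hcη : Continuous η := continuous_iff_continuousAt.2 fun s => (hd' s).continuousAt
  -- Conservation of energy for the autonomous equation.
  have hHd : ∀ s, HasDerivAt (fun s => η s ^ 2 - h s ^ 2 / 4 + 2 * l / p * |h s| ^ p) 0 s := by
    intro s
    have h1 := (((hd' s).fun_pow 2).fun_sub (((hd s).fun_pow 2).div_const 4)).fun_add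
      (((hasDerivAt_abs_rpow (h s) (by linarith : 1 < p)).comp s (hd s)).const_mul (2 * l / p))
    convert! h1 using 1
    have : p ≠ 0 := by linarith
    field_simp
    push_cast
    ring
  have hconst : ∀ s t, η s ^ 2 - h s ^ 2 / 4 + 2 * l / p * |h s| ^ p =
      η t ^ 2 - h t ^ 2 / 4 + 2 * l / p * |h t| ^ p :=
    is_const_of_deriv_eq_zero (fun s => (hHd s).differentiableAt) fun s => (hHd s).deriv
  have htop : Tendsto h atTop (𝓝 0) := hlim.mono_left atTop_le_cocompact
  -- Decay is known for h only. The mean value theorem on [n, n+1] yields a sequence along which h'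
  -- tends to 0 as well, which is enough to see that the conserved energy is 0.
  have hmvt : ∀ n : ℕ, ∃ c ∈ Ioo (n : ℝ) (n + 1), η c = h (n + 1) - h n := by
    intro n
    obtain ⟨c, hc, e⟩ := exists_hasDerivAt_eq_slope h η (lt_add_one (n : ℝ)) hcont.continuousOn
      fun x _ => hd x
    exact ⟨c, hc, by rw [e]; simp⟩
  choose c hc hηc using hmvt
  have hcn : Tendsto (fun n : ℕ => (n : ℝ)) atTop atTop := tendsto_natCast_atTop_atTop
  have hctop : Tendsto c atTop atTop := tendsto_atTop_mono (fun n => (hc n).1.le) hcn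
  have hη0 : Tendsto (fun n => η (c n)) atTop (𝓝 0) := by
    simp only [hηc]
    simpa using (htop.comp (tendsto_atTop_add_const_right _ 1 hcn)).sub (htop.comp hcn)
  have hh0 : Tendsto (fun n => h (c n)) atTop (𝓝 0) := htop.comp hctop
  have hH0 : ∀ s, η s ^ 2 - h s ^ 2 / 4 + 2 * l / p * |h s| ^ p = 0 := by
    intro s
    have h1 : Tendsto (fun n => η (c n) ^ 2 - h (c n) ^ 2 / 4 + 2 * l / p * |h (c n)| ^ p) atTop
        (𝓝 0) := by
      have h2 := ((hη0.pow 2).sub ((hh0.pow 2).div_const 4)).add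
        ((hh0.abs.rpow_const (p := p) (Or.inr (by linarith))).const_mul (2 * l / p))
      simpa [Real.zero_rpow (by linarith : p ≠ 0)] using h2
    refine tendsto_nhds_unique (tendsto_const_nhds.congr fun n => ?_) h1
    exact hconst s (c n)
  obtain ⟨t, ht⟩ := hne
  -- |h| attains its maximum because it tends to 0 at both ends and is not identically zero.
  obtain ⟨s₀, hs₀⟩ := hcont.abs.exists_forall_ge' t (by
    have h1 := hlim.abs
    rw [abs_zero] at h1
    exact (h1.eventually (gt_mem_nhds (abs_pos.2 ht))).mono fun _ hx => hx.le)
  have hM : 0 < |h s₀| := (abs_pos.2 ht).trans_le (hs₀ t)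
  have hη : η s₀ = 0 := by
    have hmax : IsLocalMax (fun s => h s ^ 2) s₀ :=
      Eventually.of_forall fun s => sq_le_sq.2 (hs₀ s)
    have h1 := hmax.hasDerivAt_eq_zero ((hd s₀).fun_pow 2)
    have h2 : h s₀ ≠ 0 := abs_pos.1 hM
    simpa [h2] using h1
  -- At the maximum h' = 0, so zero energy reads M²/4 = (2l/p) M^p.
  have hl : l * |h s₀| ^ (p - 2) = p / 8 := by
    have h1 := hH0 s₀
    have h2 : |h s₀| ^ p = |h s₀| ^ (p - 2) * |h s₀| ^ 2 := by
      rw [← Real.rpow_natCast, ← Real.rpow_add hM]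
      norm_num
    rw [hη, h2, ← sq_abs (h s₀)] at h1
    have h3 : |h s₀| ^ 2 * (2 * l / p * |h s₀| ^ (p - 2) - 1 / 4) = 0 := by linear_combination h1
    have h4 := (mul_eq_zero.1 h3).resolve_left (by positivity)
    have : p ≠ 0 := by linarith
    field_simp at h4
    linarith
  refine ⟨|h s₀|, s₀, hM, ?_⟩
  rcases le_total 0 (h s₀) with h0 | h0
  · exact Or.inl (eq_soliton_of_emden hp hM hd hd' hl (abs_of_nonneg h0).symm hη hs₀)
  · refine Or.inr fun s => neg_eq_iff_eq_neg.1 (eq_soliton_of_emden hp hM (h := fun s => -h s)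
      (η := fun s => -η s) (fun s => (hd s).fun_neg) (fun s => ?_) hl (abs_of_nonpos h0).symm
      (by simp [hη]) (fun s => by simpa using hs₀ s) s)
    convert! (hd' s).fun_neg using 1
    simp only [abs_neg]
    ring

end Homoclinic

/-! ### Classification of the minimizers -/

section Minimizers

variable {N : ℕ} {R : ℝ}

/-- A nearby test function vanishes for s outside a compact set, and the error bound √(log(R/r)) is
e^(s/2), exactly cancelled by e^(-s/2). Thus v is small compared with √(log(R/r)) at both ends. -/
lemma MemEnergySpace.tendsto_cocompact (hR : 0 < R) {v : ℝ → ℝ} (hv : MemEnergySpace R v) :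
    Tendsto (fun s => Real.exp (-s / 2) * v (expExpVar R s)) (cocompact ℝ) (𝓝 0) := by
  obtain ⟨f, hf, hpt, hlim⟩ := hv
  rw [Metric.tendsto_nhds]
  intro ε hε
  have h1 : Tendsto (fun n => energyDist R (f n) v ^ (1 / 2 : ℝ)) atTop (𝓝 0) := by
    have h2 := ((ENNReal.continuous_rpow_const (y := (1 / 2 : ℝ))).tendsto 0).comp hlim
    rwa [ENNReal.zero_rpow_of_pos (by norm_num)] at h2
  obtain ⟨n, hn⟩ := (h1.eventually (gt_mem_nhds (ENNReal.ofReal_pos.2 (half_pos hε)))).exists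
  have hK : IsCompact (logLogVar R '' tsupport (f n)) :=
    (show IsCompact (tsupport (f n)) from (hf n).2.1).image_of_continuousOn
      (contDiffOn_logLogVar.continuousOn.mono (hf n).2.2)
  filter_upwards [hK.compl_mem_cocompact] with s hs
  have hx := expExpVar_mem hR s
  have h0 : f n (expExpVar R s) = 0 := image_eq_zero_of_notMem_tsupport fun h =>
    hs ⟨_, h, logLogVar_expExpVar hR s⟩
  have h2 := ofReal_abs_sub_le_energyDist hf hpt hlim hx n
  have hlog : Real.log (R / expExpVar R s) = Real.exp s := by
    rw [← neg_log_expExpVar_div hR s, ← Real.log_inv, inv_div]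
  have hsq : Real.exp s ^ (1 / 2 : ℝ) = Real.exp (s / 2) := by
    rw [← Real.exp_mul]
    ring_nf
  rw [h0, zero_sub, abs_neg, hlog, ENNReal.ofReal_rpow_of_pos (Real.exp_pos s), hsq] at h2
  have h3 := h2.trans (mul_le_mul_right hn.le _)
  rw [← ENNReal.ofReal_mul (Real.exp_pos _).le,
    ENNReal.ofReal_le_ofReal_iff (by positivity)] at h3
  rw [Real.dist_eq, sub_zero, abs_mul, abs_of_pos (Real.exp_pos _)]
  calc _ ≤ Real.exp (-s / 2) * (Real.exp (s / 2) * (ε / 2)) := by gcongr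
    _ = ε / 2 := by
      rw [← mul_assoc, ← Real.exp_add, show -s / 2 + s / 2 = 0 by ring, Real.exp_zero, one_mul]
    _ < ε := half_lt_self hε

lemma exists_soliton_eq_weightedExtremal (hN : 3 ≤ N) {M : ℝ} (hM : 0 < M) (s₀ : ℝ) :
    ∃ μ ν : ℝ, μ ≠ 0 ∧ ν ≠ 0 ∧ ∀ r ∈ Ioo 0 R,
      Real.exp (logLogVar R r / 2) * soliton (2 * (N : ℝ) / ((N : ℝ) - 2)) M s₀ (logLogVar R r) =
        weightedExtremal N R μ ν r := by
  have hn' : (3 : ℝ) ≤ N := by exact_mod_cast hN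
  have hn2 : 0 < (N : ℝ) - 2 := by linarith
  set n := (N : ℝ) - 2 with hn
  have hp : 2 * (N : ℝ) / n - 2 = 4 / n := by
    rw [show (N : ℝ) = n + 2 by rw [hn]; ring]
    field_simp
    ring
  -- μ² and ν² are read off from the two exponentials of cosh((s-s₀)/n), after e^(-s/n) is taken out
  -- and M is absorbed through the power -n/2.
  have hμ : 0 < M ^ (-(2 / n)) * (Real.exp (-(s₀ / n)) / 2) := by positivity
  have hν : 0 < M ^ (-(2 / n)) * (Real.exp (s₀ / n) / 2) := by positivity
  refine ⟨√(M ^ (-(2 / n)) * (Real.exp (-(s₀ / n)) / 2)),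
    √(M ^ (-(2 / n)) * (Real.exp (s₀ / n) / 2)), (Real.sqrt_pos.2 hμ).ne', (Real.sqrt_pos.2 hν).ne',
    fun r hr => ?_⟩
  have hL := neg_log_div_pos hr
  rw [weightedExtremal, Real.sq_sqrt hμ.le, Real.sq_sqrt hν.le, soliton, hp, ← hn]
  have hes : -Real.log (r / R) = Real.exp (logLogVar R r) := by
    rw [logLogVar, Real.exp_log hL]
  rw [hes]
  set s := logLogVar R r with hs
  have e1 : 4 / n / 4 * (s - s₀) = (s - s₀) / n := by field_simp
  have e2 : -(2 / (4 / n)) = -(n / 2) := by field_simp; norm_num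
  have e3 : M ^ (-(2 / n)) * (Real.exp (-(s₀ / n)) / 2) +
      M ^ (-(2 / n)) * (Real.exp (s₀ / n) / 2) * Real.exp s ^ (-(2 / n)) =
      M ^ (-(2 / n)) * Real.exp (-(s / n)) * Real.cosh ((s - s₀) / n) := by
    rw [Real.cosh_eq, ← Real.exp_mul, show -(s₀ / n) = -(s / n) + (s - s₀) / n by ring,
      show s * -(2 / n) = -(s / n) + -(s / n) by ring,
      show -((s - s₀) / n) = s₀ / n + -(s / n) by ring]
    simp only [Real.exp_add]
    ring
  rw [e1, e2, e3, Real.mul_rpow (by positivity) (by positivity),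
    Real.mul_rpow (by positivity) (by positivity), ← Real.rpow_mul hM.le, ← Real.exp_mul,
    show -(2 / n) * -(n / 2) = 1 by field_simp, Real.rpow_one,
    show -(s / n) * -(n / 2) = s / 2 by field_simp]
  ring

/-- The Emden-Fowler substitution h(s) = e^(-s/2) v(R exp(-e^s)) makes the Euler-Lagrange equation
autonomous, and membership in the energy space supplies the decay at both ends. -/
lemma IsWeightedMinimizer.exists_eqOn_weightedExtremal (hN : 3 ≤ N) (hR : 0 < R) {v : ℝ → ℝ}
    (hv : IsWeightedMinimizer N R v) :
    ∃ μ ν : ℝ, μ ≠ 0 ∧ ν ≠ 0 ∧ (EqOn v (weightedExtremal N R μ ν) (Ioo 0 R) ∨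
      EqOn v (fun r => -weightedExtremal N R μ ν r) (Ioo 0 R)) := by
  have hn' : (3 : ℝ) ≤ N := by exact_mod_cast hN
  have hn2 : 0 < (N : ℝ) - 2 := by linarith
  obtain ⟨l, q, hlq⟩ := hv.exists_flux hN hR
  set p := 2 * (N : ℝ) / ((N : ℝ) - 2) with hp
  have hp2 : 2 < p := by
    rw [hp, lt_div_iff₀ hn2]
    linarith
  have hexp1 : ∀ s, HasDerivAt (fun s => Real.exp (-s / 2)) (-(1 / 2) * Real.exp (-s / 2)) s := by
    intro s
    convert! ((hasDerivAt_neg s).div_const 2).exp using 1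
    ring
  have hexp2 : ∀ s, HasDerivAt (fun s => Real.exp (s / 2)) (1 / 2 * Real.exp (s / 2)) s := by
    intro s
    convert! ((hasDerivAt_id s).div_const 2).exp using 1
    simp only [id]
    ring
  have hprod : ∀ s : ℝ, Real.exp (-s / 2) * Real.exp s = Real.exp (s / 2) := fun s => by
    rw [← Real.exp_add]
    ring_nf
  have hd : ∀ s, HasDerivAt (fun s => Real.exp (-s / 2) * v (expExpVar R s))
      (-(1 / 2) * (Real.exp (-s / 2) * v (expExpVar R s)) -
        Real.exp (s / 2) * q (expExpVar R s)) s := by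
    intro s
    have hx := expExpVar_mem hR s
    have h1 := (hexp1 s).fun_mul ((hlq _ hx).1.comp s (hasDerivAt_expExpVar s))
    convert! h1 using 1
    have := hx.1.ne'
    have e : q (expExpVar R s) / expExpVar R s * -(Real.exp s * expExpVar R s) =
        -(Real.exp s * q (expExpVar R s)) := by field_simp
    simp only [Function.comp]
    rw [e]
    linear_combination q (expExpVar R s) * hprod s
  have hd' : ∀ s, HasDerivAt (fun s => -(1 / 2) * (Real.exp (-s / 2) * v (expExpVar R s)) -
        Real.exp (s / 2) * q (expExpVar R s))
      (Real.exp (-s / 2) * v (expExpVar R s) / 4 -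
        l * (|Real.exp (-s / 2) * v (expExpVar R s)| ^ (p - 2) *
          (Real.exp (-s / 2) * v (expExpVar R s)))) s := by
    intro s
    have hx := expExpVar_mem hR s
    have h1 := ((hd s).const_mul (-(1 / 2))).fun_sub
      ((hexp2 s).fun_mul ((hlq _ hx).2.comp s (hasDerivAt_expExpVar s)))
    convert! h1 using 1
    simp only [Function.comp]
    set x := expExpVar R s with hxdef
    have hx0 := hx.1.ne'
    -- For the critical exponent p the powers of e^s from the weight match those in |h|^(p-2)h, so
    -- no explicit s survives.
    have e : Real.exp (s / 2) * Real.exp s * x * potentialWeight N R x =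
        Real.exp (-s / 2) ^ (p - 2) * Real.exp (-s / 2) := by
      rw [potentialWeight, neg_log_expExpVar_div hR s, ← Real.exp_mul, ← Real.exp_mul]
      have e2 : s / 2 + s + s * (-(2 * ((N : ℝ) - 1) / ((N : ℝ) - 2))) =
          -s / 2 * (p - 2) + -s / 2 := by
        rw [hp]
        field_simp
        ring
      rw [← Real.exp_add (-s / 2 * (p - 2)), ← e2, Real.exp_add, Real.exp_add]
      field_simp
    rw [abs_mul, abs_of_pos (Real.exp_pos _), Real.mul_rpow (Real.exp_pos _).le (abs_nonneg _)]
    linear_combination (l * (|v x| ^ (p - 2) * v x)) * e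
  obtain ⟨r₀, hr₀, hvr₀⟩ := hv.2.1
  obtain ⟨M, s₀, hM, hsol⟩ := exists_eq_soliton_of_tendsto_zero hp2 hd hd'
    (hv.1.tendsto_cocompact hR) ⟨logLogVar R r₀, by
      rw [expExpVar_logLogVar hr₀]
      exact mul_ne_zero (Real.exp_pos _).ne' hvr₀⟩
  obtain ⟨μ, ν, hμ, hν, hext⟩ := exists_soliton_eq_weightedExtremal (R := R) hN hM s₀
  have hback : ∀ r ∈ Ioo 0 R, v r = Real.exp (logLogVar R r / 2) *
      (Real.exp (-logLogVar R r / 2) * v (expExpVar R (logLogVar R r))) := by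
    intro r hr
    rw [expExpVar_logLogVar hr, ← mul_assoc, ← Real.exp_add,
      show logLogVar R r / 2 + -logLogVar R r / 2 = 0 by ring, Real.exp_zero, one_mul]
  refine ⟨μ, ν, hμ, hν, hsol.imp (fun h r hr => ?_) fun h r hr => ?_⟩
  · rw [hback r hr, h, hext r hr]
  · simp only
    rw [hback r hr, h, mul_neg, hext r hr]

lemma weightedQuotient_congr {v w : ℝ → ℝ} (h : EqOn v w (Ioo 0 R)) :
    weightedQuotient N R v = weightedQuotient N R w := by
  have hd := Set.EqOn.deriv h isOpen_Ioo
  rw [weightedQuotient, weightedQuotient, weightedEnergy, weightedEnergy, weightedPotential,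
    weightedPotential]
  congr 1
  · exact setLIntegral_congr_fun measurableSet_Ioo fun r hr => by simp only [hd hr]
  · congr 1
    exact setLIntegral_congr_fun measurableSet_Ioo fun r hr => by simp only [h hr]

lemma MemEnergySpace.congr {v w : ℝ → ℝ} (hv : MemEnergySpace R v) (h : EqOn w v (Ioo 0 R)) :
    MemEnergySpace R w := by
  have hd := Set.EqOn.deriv h isOpen_Ioo
  obtain ⟨f, hf, hpt, hlim⟩ := hv
  refine ⟨f, hf, fun r hr => by rw [h hr]; exact hpt r hr, hlim.congr fun n => ?_⟩
  exact setLIntegral_congr_fun measurableSet_Ioo fun r hr => by simp only [hd hr]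

lemma MemEnergySpace.neg {v : ℝ → ℝ} (hv : MemEnergySpace R v) :
    MemEnergySpace R (fun r => -v r) := by
  obtain ⟨f, hf, hpt, hlim⟩ := hv
  refine ⟨fun n r => -f n r, fun n => ⟨(hf n).1.neg, (hf n).2.1.neg, ?_⟩,
    fun r hr => (hpt r hr).neg, hlim.congr fun n => ?_⟩
  · rw [show tsupport (fun r => -f n r) = tsupport (f n) from
      congrArg closure (Function.support_neg (f n))]
    exact (hf n).2.2
  · refine lintegral_congr fun r => ?_
    rw [deriv.fun_neg, deriv.fun_neg, abs_sub_comm, neg_sub_neg]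

lemma weightedQuotient_neg (v : ℝ → ℝ) :
    weightedQuotient N R (fun r => -v r) = weightedQuotient N R v := by
  simp only [weightedQuotient, weightedEnergy, weightedPotential, deriv.fun_neg, abs_neg]

lemma isWeightedMinimizer_of_weightedQuotient_eq (hN : 3 ≤ N) (hR : 0 < R) {v : ℝ → ℝ}
    (hv : MemEnergySpace R v) (hv0 : ∃ r ∈ Ioo 0 R, v r ≠ 0)
    (h : weightedQuotient N R v = ENNReal.ofReal (weightedConst N)) : IsWeightedMinimizer N R v :=
  ⟨hv, hv0, fun _ hw hw0 => h.trans_le (hw.weightedConst_le_weightedQuotient hN hR hw0)⟩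

lemma isWeightedMinimizer_iff (hN : 3 ≤ N) (hR : 0 < R) (v : ℝ → ℝ) :
    IsWeightedMinimizer N R v ↔ ∃ μ ν : ℝ, μ ≠ 0 ∧ ν ≠ 0 ∧
      (EqOn v (weightedExtremal N R μ ν) (Ioo 0 R) ∨
        EqOn v (fun r => -weightedExtremal N R μ ν r) (Ioo 0 R)) := by
  refine ⟨fun h => h.exists_eqOn_weightedExtremal hN hR, ?_⟩
  rintro ⟨μ, ν, hμ, hν, h⟩
  have hmid : R / 2 ∈ Ioo 0 R := ⟨by positivity, by linarith⟩
  have hX := memEnergySpace_weightedExtremal hN hR hμ hν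
  have hne : weightedExtremal N R μ ν (R / 2) ≠ 0 := by
    rw [weightedExtremal_eq hmid]
    exact (sobolevExtremal_pos hμ _ _).ne'
  have hq := weightedQuotient_weightedExtremal hN hR hμ hν
  rcases h with h | h
  · exact isWeightedMinimizer_of_weightedQuotient_eq hN hR (hX.congr h)
      ⟨_, hmid, by rwa [h hmid]⟩ ((weightedQuotient_congr h).trans hq)
  · exact isWeightedMinimizer_of_weightedQuotient_eq hN hR (hX.neg.congr h)
      ⟨_, hmid, by rw [h hmid]; exact neg_ne_zero.2 hne⟩
      ((weightedQuotient_congr h).trans ((weightedQuotient_neg _).trans hq))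

end Minimizers

/-! ### The theorem -/

theorem lemma1 (N : ℕ) (hN : 3 ≤ N) (R : ℝ) (hR : 0 < R) :
    -- the transformation `v r = w t` is a bijection between the test functions `v` on `(0, R)` and
    -- the test functions `w` on `(0, ∞)`
    (∀ v : ℝ → ℝ, IsTestFunction (Ioo 0 R) v →
      ∃! w : ℝ → ℝ, IsTestFunction (Ioi 0) w ∧ ∀ r ∈ Ioo 0 R, v r = w (logVar N R r)) ∧
    (∀ w : ℝ → ℝ, IsTestFunction (Ioi 0) w →
      ∃! v : ℝ → ℝ, IsTestFunction (Ioo 0 R) v ∧ ∀ r ∈ Ioo 0 R, v r = w (logVar N R r)) ∧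
    -- it turns the weighted inequality for `v` into the Sobolev inequality for `x ↦ w |x|`
    (∀ v w : ℝ → ℝ, IsTestFunction (Ioo 0 R) v → IsTestFunction (Ioi 0) w →
      (∀ r ∈ Ioo 0 R, v r = w (logVar N R r)) →
      IsTestFunction univ (fun x : EuclideanSpace ℝ (Fin N) => w ‖x‖) ∧
      ∀ c : ℝ, WeightedIneq N R c v ↔
        SobolevIneq N
          (c * ((N : ℝ) - 2) ^ (2 * ((N : ℝ) - 1) / (N : ℝ)) *
            ((N : ℝ) * unitBallVolume N) ^ (2 / (N : ℝ)))
          (fun x => w ‖x‖)) ∧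
    -- the weighted inequality is equivalent to the Sobolev inequality in `ℝ^N`
    (∀ c : ℝ, (∀ v : ℝ → ℝ, IsTestFunction (Ioo 0 R) v → WeightedIneq N R c v) ↔
      ∀ u : EuclideanSpace ℝ (Fin N) → ℝ, IsTestFunction univ u →
        SobolevIneq N
          (c * ((N : ℝ) - 2) ^ (2 * ((N : ℝ) - 1) / (N : ℝ)) *
            ((N : ℝ) * unitBallVolume N) ^ (2 / (N : ℝ))) u) ∧
    -- the best constant, and its second expression
    IsGreatest {c : ℝ | ∀ v : ℝ → ℝ, IsTestFunction (Ioo 0 R) v → WeightedIneq N R c v}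
      (weightedConst N) ∧
    weightedConst N =
      1 / 4 * ((N : ℝ) / ((N : ℝ) - 2)) ^ (((N : ℝ) - 2) / (N : ℝ)) *
        (unitSphereArea N / unitBallVolume N) ^ (2 / (N : ℝ)) ∧
    -- the minimizers, up to sign, and the minimum
    (∀ v : ℝ → ℝ, IsWeightedMinimizer N R v ↔
      ∃ μ ν : ℝ, μ ≠ 0 ∧ ν ≠ 0 ∧
        (EqOn v (weightedExtremal N R μ ν) (Ioo 0 R) ∨
          EqOn v (fun r => -weightedExtremal N R μ ν r) (Ioo 0 R))) ∧
    (∀ μ ν : ℝ, μ ≠ 0 → ν ≠ 0 →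
      weightedQuotient N R (weightedExtremal N R μ ν) = ENNReal.ofReal (weightedConst N) ∧
      ∀ r ∈ Ioo 0 R, weightedExtremal N R μ ν r = sobolevExtremal N μ ν (logVar N R r)) := by
  refine ⟨fun v hv => existsUnique_radial hN hR hv, fun w hw => existsUnique_weighted hN hR hw,
    fun v w hv hw hvw => ⟨isTestFunction_comp_norm hw,
      weightedIneq_iff_sobolevIneq hN hR hv hw hvw⟩, fun c => ⟨fun h u hu => ?_, fun h v hv => ?_⟩,
    isGreatest_weightedConst hN hR, weightedConst_eq hN, isWeightedMinimizer_iff hN hR,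
    fun μ ν hμ hν => ⟨weightedQuotient_weightedExtremal hN hR hμ hν,
      fun r hr => weightedExtremal_eq hr μ ν⟩⟩
  -- Nonradial u are reached through the constants: (m) for all v forces c ≤ C_M, and the sharp
  -- Sobolev inequality holds for every u.
  · refine (sobolevIneq_sobolevConst hN hu).mono ?_
    rw [← weightedConst_mul_constFactor hN, mul_assoc, mul_assoc]
    exact mul_le_mul_of_nonneg_right ((isGreatest_weightedConst hN hR).2 h) (constFactor_pos hN).le
  · obtain ⟨w, ⟨hw, hvw⟩, -⟩ := existsUnique_radial hN hR hv
    exact (weightedIneq_iff_sobolevIneq hN hR hv hw hvw c).2 (h _ (isTestFunction_comp_norm hw))
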